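/- Let $N\ge 1$, let $Y=(y_1,\dots,y_N)$ consist of pairwise distinct points of $\mathbb R^3$ and let $\alpha=(\alpha_1,\dots,\alpha_N)\in\mathbb R^N$. Put $\tilde G_z(x)=\frac{e^{iz|x|}}{4\pi|x|}$ for $x\ne0$, $\tilde G_z(0)=0$, and $$[\Gamma_{\alpha,Y}(z)]_{j\ell}=\Big(\alpha_j-\frac{iz}{4\pi}\Big)\delta_{j\ell}-\tilde G_z(y_j-y_\ell),\qquad w(x)=\sum_{j=1}^N\Big(1+\frac1{|x-y_j|}\Big).$$ Let $H_{\alpha,Y}$ be the operator in $L^2(\mathbb R^3)$ whose domain consists of the functions $$\psi=\varphi+\sum_{j=1}^N a_j\,\tilde G_z(\cdot-y_j),\qquad a_j=\sum_{\ell=1}^N[\Gamma_{\alpha,Y}(z)^{-1}]_{j\ell}\,\varphi(y_\ell),$$ with $\varphi\in H^2(\mathbb R^3)$ (continuous representative), $\operatorname{Im}z>0$ and $\Gamma_{\alpha,Y}(z)$ invertible, and which acts by $(H_{\alpha,Y}-z^2)\psi=(-\Delta-z^2)\varphi$. Then $H_{\alpha,Y}$ generates a strongly continuous one-parameter unitary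 group $e^{itH_{\alpha,Y}}$. Let $P_{ac}$ be the orthogonal projection onto the absolutely continuous subspace of $H_{\alpha,Y}$, i.e. onto the vectors whose spectral measure is absolutely continuous with respect to Lebesgue measure. (1) If $\Gamma_{\alpha,Y}(\mu)$ is invertible for every $\mu\in[0,\infty)$, with locally bounded inverse, then there is a constant $C$ (depending on $\alpha,Y$) such that for all $t>0$ and all $f\in L^2(\mathbb R^3)$ with $wf\in L^1(\mathbb R^3)$ $$\|w^{-1}e^{itH_{\alpha,Y}}P_{ac}f\|_{L^\infty}\le \frac{C}{t^{3/2}}\,\|wf\|_{L^1}.$$ (2) If $N=1$, the estimate in (1) holds for every $\alpha\ne0$; if moreover $\alpha>0$, it also holds with $P_{ac}$ replaced by the identity. (3) If $N=1$ and $\alpha=0$, there is a constant $C$ such that for all $f\in L^2(\mathbb R^3)$ with $wf\in L^1(\mathbb R^3)$ $$\|w^{-1}e^{itH_{0,y}}f\|_{L^\infty}\le \frac{C}{t^{1/2}}\,\|wf\|_{L^1}\quad (t\ge1),\qquad \|w^{-1}e^{itH_{0,y}}f\|_{L^\infty}\le \frac{C}{t^{3/2}}\,\|wf\|_{L^1}\quad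 (0<t\le1).$$ -/

import Mathlib

open MeasureTheory
open scoped Laplacian SchwartzMap ENNReal

noncomputable section

namespace PointInteraction

/-- Euclidean three-space. -/
abbrev R3 : Type := EuclideanSpace ℝ (Fin 3)

/-- The complex Hilbert space `L²(ℝ³)` (Lebesgue measure). -/
abbrev L2 : Type := Lp ℂ 2 (volume : Measure R3)

/-- The function `G̃_z(x) = e^{iz|x|} / (4π|x|)` for `x ≠ 0`, and `G̃_z(0) = 0`. For `Im z > 0` it is
(almost everywhere) the integral kernel of `(-Δ - z²)⁻¹`. -/
def green (z : ℂ) (x : R3) : ℂ :=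
  if x = 0 then 0 else Complex.exp (Complex.I * z * (‖x‖ : ℂ)) / (4 * (Real.pi : ℂ) * (‖x‖ : ℂ))

/-- The matrix `Γ_{α,Y}(z)`, with entries `(α_j - iz/4π) δ_{jl} - G̃_z(y_j - y_l)`. -/
def Gam {N : ℕ} (α : Fin N → ℝ) (Y : Fin N → R3) (z : ℂ) : Matrix (Fin N) (Fin N) ℂ :=
  Matrix.of fun j l =>
    (if j = l then (α j : ℂ) - Complex.I * z / (4 * (Real.pi : ℂ)) else 0) - green z (Y j - Y l)

/-- The weight `w(x) = ∑_j (1 + 1/|x - y_j|)` (finite off the null set `Y`). -/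
def weight {N : ℕ} (Y : Fin N → R3) (x : R3) : ℝ :=
  ∑ j, (1 + 1 / ‖x - Y j‖)

/-- The graph of the Hamiltonian `H_{α,Y}`: the pairs `(ψ, g)` with `ψ` in the domain and
`g = H_{α,Y} ψ`. Membership says that for some `z` with `Im z > 0` and `Γ_{α,Y}(z)` invertible
there is `φ ∈ H²(ℝ³)`, with continuous representative `φc`, such that
`ψ = φ + ∑_j a_j G̃_z(· - y_j)` with `a = Γ_{α,Y}(z)⁻¹ (φ(y_1), …, φ(y_N))`, and
`g - z² ψ = (-Δ - z²) φ` (in the sense of distributions). -/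
def hamiltonian {N : ℕ} (α : Fin N → ℝ) (Y : Fin N → R3) : Set (L2 × L2) :=
  {p | ∃ (z : ℂ) (φ : L2) (φc : R3 → ℂ),
    0 < z.im ∧ IsUnit (Gam α Y z) ∧
    TemperedDistribution.MemSobolev 2 2 (φ : 𝓢'(R3, ℂ)) ∧
    Continuous φc ∧ (φ : R3 → ℂ) =ᵐ[volume] φc ∧
    (p.1 : R3 → ℂ) =ᵐ[volume] (fun x =>
      φc x + ∑ j, ((Gam α Y z)⁻¹.mulVec (fun l => φc (Y l))) j * green z (x - Y j)) ∧
    ((p.2 - z ^ 2 • p.1 : L2) : 𝓢'(R3, ℂ)) = -Δ (φ : 𝓢'(R3, ℂ)) - z ^ 2 • (φ : 𝓢'(R3, ℂ))}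

/-- `U` is the strongly continuous one-parameter unitary group `U t = e^{itA}` generated by the
operator whose graph is `A`: a vector `ψ` is in the domain and `A ψ = g` exactly when
`t ↦ U t ψ` is differentiable at `0` with derivative `i g`. (An isometric representation of the
group `ℝ` is unitary.) At most one `U` has this property. -/
structure IsUnitaryGroupOf (A : Set (L2 × L2)) (U : ℝ → L2 →L[ℂ] L2) : Prop where
  map_zero : U 0 = ContinuousLinearMap.id ℂ L2
  map_add : ∀ s t, U (s + t) = (U s).comp (U t)
  norm_map : ∀ t f, ‖U t f‖ = ‖f‖
  continuous_orbit : ∀ f, Continuous fun t => U t f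
  mem_iff_hasDerivAt : ∀ ψ g : L2,
    (ψ, g) ∈ A ↔ HasDerivAt (fun t => U t ψ) (Complex.I • g) 0

open Classical in
/-- The unitary group `t ↦ e^{itA}` (a default value if `A` generates no such group). -/
def expI (A : Set (L2 × L2)) : ℝ → L2 →L[ℂ] L2 :=
  if h : ∃ U, IsUnitaryGroupOf A U then h.choose else fun _ => ContinuousLinearMap.id ℂ L2

/-- `μ` is the spectral measure of the vector `f` for the generator `A` of `U t = e^{itA}`: the
finite Borel measure with `⟪f, e^{itA} f⟫ = ∫ e^{itx} dμ(x)` for all `t`. -/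
def IsSpectralMeasure (U : ℝ → L2 →L[ℂ] L2) (f : L2) (μ : Measure ℝ) : Prop :=
  IsFiniteMeasure μ ∧
    ∀ t : ℝ, inner ℂ f (U t f) = ∫ x : ℝ, Complex.exp (Complex.I * (t : ℂ) * (x : ℂ)) ∂μ

/-- The absolutely continuous subspace: the vectors whose spectral measure is absolutely continuous
with respect to Lebesgue measure. These vectors form a closed subspace, so passing to the closed
span, which gives it its type, adds nothing. -/
def acSubspace (U : ℝ → L2 →L[ℂ] L2) : Submodule ℂ L2 :=
  (Submodule.span ℂ {f : L2 | ∃ μ : Measure ℝ, IsSpectralMeasure U f μ ∧ μ ≪ volume}).topologicalClosure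

/-- `P_ac`, the orthogonal projection onto the absolutely continuous subspace. -/
def acProjection (U : ℝ → L2 →L[ℂ] L2) : L2 →L[ℂ] L2 :=
  haveI : CompleteSpace (acSubspace U) :=
    (Submodule.isClosed_topologicalClosure _).completeSpace_coe
  (acSubspace U).starProjection

/-- `‖w⁻¹ T f‖_{L^∞} ≤ B ‖w f‖_{L¹}` for all `f ∈ L²` with `w f ∈ L¹`. -/
def WeightedBound {N : ℕ} (Y : Fin N → R3) (T : L2 →L[ℂ] L2) (B : ℝ) : Prop :=
  ∀ f : L2, MemLp (fun x => weight Y x • f x) 1 volume →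
    eLpNorm (fun x => (weight Y x)⁻¹ • T f x) ∞ volume ≤
      ENNReal.ofReal B * eLpNorm (fun x => weight Y x • f x) 1 volume

/-- `Γ_{α,Y}(μ)` is invertible for every `μ ∈ [0,∞)`, with locally bounded inverse. -/
def RegularGam {N : ℕ} (α : Fin N → ℝ) (Y : Fin N → R3) : Prop :=
  (∀ μ : ℝ, 0 ≤ μ → IsUnit (Gam α Y (μ : ℂ))) ∧
    ∀ R : ℝ, ∃ B : ℝ, ∀ μ ∈ Set.Icc 0 R, ∀ j l, ‖(Gam α Y (μ : ℂ))⁻¹ j l‖ ≤ B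

end PointInteraction

end

/-!
The dispersive estimates for point interactions rest on Krein's formula, which writes the resolvent of
`H` at `z²` as the free resolvent plus a finite sum of products of Green functions, with coefficients
`Γ(z)⁻¹`. Every statement about `H` becomes a statement about this explicit bounded operator
`kreinRes α Y z`.

*The unitary group.* For large `κ` the matrix `Γ(iκ)` is positive definite (`exists_posDef_Gam`), so
`T = kreinRes α Y (iκ)` is a positive injective operator and `H = T⁻¹ - κ²`. The continuous functional
calculus of `T` gives `e^{itH}` on the range of `T`, where the symbol `r e^{it(1/r - κ²)}` is
continuous up to `r = 0`, and `e^{itH}` extends isometrically (`invGroup`, `hasDerivAt_invGroup_iff`,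
`isUnitaryGroupOf_hamiltonian`).

*The spectrum.* All resolvents of `H` are functions of `T` (`fcalc_resSymbol_eq`), so Stone's formula
(`inner_energyCalc_eq_integral`) expresses the functional calculus through the jump of the resolvent
across `(0, ∞)`. For `f`, `g` with `w f`, `w g` integrable the kernel of the resolvent is integrable
against `f` and `g` and extends continuously to real `λ ≠ 0`, provided `Γ(λ)` is invertible there.
Hence the jump is a continuous density (`isDensity_specDensity`), and the spectrum on `(0, ∞)` is
absolutely continuous. The spectral subspace for `(-∞, 0]` is finite-dimensional, because the form of
`T` is below `κ⁻²` off the span of `N` Green functions; it is spanned by eigenvectors, to which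
absolutely continuous vectors are orthogonal by the Riemann–Lebesgue lemma. So the absolutely
continuous subspace is exactly the spectral subspace for `(0, ∞)` (`acProjection_invGroup`).

*The estimate.* With `x = λ²` the matrix elements of `e^{itH} P_ac` become integrals over `λ ∈ ℝ` of
`λ e^{itλ²}` times the resolvent kernel, and Fubini's theorem reduces them to
`∫ e^{itλ²} λ e^{iλs} dλ` and `∫ e^{itλ²} λ (Γ(λ)⁻¹)_{jk} e^{iλs} dλ`, where `s` is the length of a path
from `x` to `y`, direct or through the points `y_j` and `y_k` (`norm_inner_expI_le`). The weight `w`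
absorbs both the singularities `1/‖x - y_j‖` and a linear growth in `s`. One integration by parts
removes the factor `λ` at the price of a derivative and gains `1/t`, and van der Corput's lemma for
amplitudes of bounded variation gains `1/√t`. Both `Γ(λ)⁻¹` and its derivative have bounded variation
when `Γ` is invertible on the whole real axis, since `Γ(λ)⁻¹ = O(1/λ)` and its first two derivatives
are `O(1/λ²)` (`exists_hasVarBound_Gam_inv`).

*One point.* Here `Γ(λ) = α - iλ/4π`, which is invertible on the real axis unless `α = 0`. In that case
`λ Γ(λ)⁻¹` is constant, so that the pole part gains only `1/√t`. For `α ≥ 0` there is no eigenvalue in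
`(-∞, 0]` (`eq_zero_of_kreinRes_single_eq`), and the projection is the identity.
-/

namespace PointInteraction

open Filter Topology Set FourierTransform
open scoped ComplexOrder Matrix

/-! ### Functions of a bounded positive operator -/

section Calculus

variable {E : Type*} [NormedAddCommGroup E] [InnerProductSpace ℂ E] [CompleteSpace E]

/-- The operator `F(T)` for a function `F` of a real variable and a bounded positive operator `T`,
obtained from Mathlib's complex functional calculus by ignoring imaginary parts. It is meaningful
when `F` is continuous on `[0, ∞)`, which contains the spectrum. -/
noncomputable def fcalc (T : E →L[ℂ] E) (F : ℝ → ℂ) : E →L[ℂ] E := cfc (fun z : ℂ => F z.re) T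

variable {T : E →L[ℂ] E}

theorem spectrum_of_isPositive (hT : T.IsPositive) {z : ℂ} (hz : z ∈ spectrum ℂ T) :
    0 ≤ z.re ∧ (z.re : ℂ) = z := by
  have h0 : (0 : E →L[ℂ] E) ≤ T := (ContinuousLinearMap.nonneg_iff_isPositive T).2 hT
  have h : 0 ≤ z.re ∧ 0 = z.im := by
    have := spectrum_nonneg_of_nonneg h0 hz
    simpa [Complex.le_def] using this
  exact ⟨h.1, Complex.ext (by simp) (by simpa using h.2)⟩

theorem continuousOn_fcalc (hT : T.IsPositive) {F : ℝ → ℂ} (hF : ContinuousOn F (Ici 0)) :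
    ContinuousOn (fun z : ℂ => F z.re) (spectrum ℂ T) :=
  hF.comp Complex.continuous_re.continuousOn fun _ hz => (spectrum_of_isPositive hT hz).1

theorem fcalc_congr (hT : T.IsPositive) {F G : ℝ → ℂ} (h : ∀ r, 0 ≤ r → F r = G r) :
    fcalc T F = fcalc T G :=
  cfc_congr fun _ hz => h _ (spectrum_of_isPositive hT hz).1

theorem fcalc_ofReal (hT : T.IsPositive) : fcalc T (fun r => (r : ℂ)) = T := by
  have hn : IsStarNormal T := hT.isSelfAdjoint.isStarNormal
  have : fcalc T (fun r => (r : ℂ)) = cfc (fun z : ℂ => z) T :=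
    cfc_congr fun _ hz => (spectrum_of_isPositive hT hz).2
  rw [this, cfc_id' ℂ T]

theorem fcalc_const (hT : T.IsPositive) (a : ℂ) : fcalc T (fun _ => a) = a • (1 : E →L[ℂ] E) := by
  have hn : IsStarNormal T := hT.isSelfAdjoint.isStarNormal
  rw [fcalc, cfc_const a T, Algebra.algebraMap_eq_smul_one]

theorem fcalc_mul (hT : T.IsPositive) {F G : ℝ → ℂ} (hF : ContinuousOn F (Ici 0))
    (hG : ContinuousOn G (Ici 0)) : fcalc T (fun r => F r * G r) = fcalc T F * fcalc T G :=
  cfc_mul (fun z : ℂ => F z.re) (fun z : ℂ => G z.re) T (continuousOn_fcalc hT hF) (continuousOn_fcalc hT hG)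

theorem fcalc_add (hT : T.IsPositive) {F G : ℝ → ℂ} (hF : ContinuousOn F (Ici 0))
    (hG : ContinuousOn G (Ici 0)) : fcalc T (fun r => F r + G r) = fcalc T F + fcalc T G :=
  cfc_add T (fun z : ℂ => F z.re) (fun z : ℂ => G z.re) (continuousOn_fcalc hT hF) (continuousOn_fcalc hT hG)

theorem fcalc_sub (hT : T.IsPositive) {F G : ℝ → ℂ} (hF : ContinuousOn F (Ici 0))
    (hG : ContinuousOn G (Ici 0)) : fcalc T (fun r => F r - G r) = fcalc T F - fcalc T G :=
  cfc_sub (fun z : ℂ => F z.re) (fun z : ℂ => G z.re) T (continuousOn_fcalc hT hF) (continuousOn_fcalc hT hG)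

theorem fcalc_const_mul (hT : T.IsPositive) (a : ℂ) {F : ℝ → ℂ} (hF : ContinuousOn F (Ici 0)) :
    fcalc T (fun r => a * F r) = a • fcalc T F := by
  have hn : IsStarNormal T := hT.isSelfAdjoint.isStarNormal
  rw [fcalc_mul hT continuousOn_const hF, fcalc_const hT, smul_mul_assoc, one_mul]

theorem fcalc_star (F : ℝ → ℂ) : fcalc T (fun r => starRingEnd ℂ (F r)) = star (fcalc T F) :=
  cfc_star (fun z : ℂ => F z.re) T

theorem norm_fcalc_le (hT : T.IsPositive) {F : ℝ → ℂ} {C : ℝ} (hC : 0 ≤ C)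
    (h : ∀ r, 0 ≤ r → ‖F r‖ ≤ C) : ‖fcalc T F‖ ≤ C :=
  norm_cfc_le hC fun _ hz => h _ (spectrum_of_isPositive hT hz).1

theorem norm_fcalc_le_of_le_norm (hT : T.IsPositive) {F : ℝ → ℂ} {C : ℝ} (hC : 0 ≤ C)
    (h : ∀ r, 0 ≤ r → r ≤ ‖T‖ → ‖F r‖ ≤ C) : ‖fcalc T F‖ ≤ C := by
  rcases subsingleton_or_nontrivial (E →L[ℂ] E) with hs | hs
  · rw [Subsingleton.elim (fcalc T F) 0]; simpa using hC
  refine norm_cfc_le hC fun z hz => h _ (spectrum_of_isPositive hT hz).1 ?_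
  have := spectrum.norm_le_norm_of_mem hz
  exact (Complex.re_le_norm z).trans this

theorem fcalc_commute (hT : T.IsPositive) {F G : ℝ → ℂ} (hF : ContinuousOn F (Ici 0))
    (hG : ContinuousOn G (Ici 0)) (f : E) : fcalc T F (fcalc T G f) = fcalc T G (fcalc T F f) := by
  have h1 := fcalc_mul hT hF hG
  have h2 := fcalc_mul hT hG hF
  have : fcalc T F * fcalc T G = fcalc T G * fcalc T F := by
    rw [← h1, ← h2]; congr 1; ext r; ring
  exact DFunLike.congr_fun this f

theorem fcalc_mul_apply (hT : T.IsPositive) {F G : ℝ → ℂ} (hF : ContinuousOn F (Ici 0))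
    (hG : ContinuousOn G (Ici 0)) (f : E) :
    fcalc T (fun r => F r * G r) f = fcalc T F (fcalc T G f) := by
  rw [fcalc_mul hT hF hG]; rfl

theorem inner_fcalc_left (F : ℝ → ℂ) (f g : E) :
    inner ℂ (fcalc T F f) g = inner ℂ f (fcalc T (fun r => starRingEnd ℂ (F r)) g) := by
  rw [fcalc_star, ContinuousLinearMap.star_eq_adjoint, ContinuousLinearMap.adjoint_inner_right]

theorem norm_fcalc_apply_eq (hT : T.IsPositive) {F G : ℝ → ℂ} (hF : ContinuousOn F (Ici 0))
    (hG : ContinuousOn G (Ici 0)) (h : ∀ r, 0 ≤ r → ‖F r‖ = ‖G r‖) (f : E) :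
    ‖fcalc T F f‖ = ‖fcalc T G f‖ := by
  have key : ∀ {F : ℝ → ℂ}, ContinuousOn F (Ici 0) →
      ((‖fcalc T F f‖ ^ 2 : ℝ) : ℂ) = inner ℂ f (fcalc T (fun r => ((‖F r‖ ^ 2 : ℝ) : ℂ)) f) := by
    intro F hF
    have hF' : ContinuousOn (fun r => starRingEnd ℂ (F r)) (Ici 0) :=
      Complex.continuous_conj.comp_continuousOn hF
    have : fcalc T (fun r => ((‖F r‖ ^ 2 : ℝ) : ℂ)) = fcalc T (fun r => starRingEnd ℂ (F r) * F r) := by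
      congr 1; ext r; rw [mul_comm, Complex.mul_conj, Complex.normSq_eq_norm_sq]
    rw [this, fcalc_mul_apply hT hF' hF, ← inner_fcalc_left, inner_self_eq_norm_sq_to_K]
    simp
  have h2 := (key hF).trans ((congrArg (fun S : E →L[ℂ] E => inner ℂ f (S f))
    (fcalc_congr hT fun r hr => by rw [h r hr])).trans (key hG).symm)
  have h3 : ‖fcalc T F f‖ ^ 2 = ‖fcalc T G f‖ ^ 2 := by exact_mod_cast h2
  exact (pow_left_inj₀ (norm_nonneg _) (norm_nonneg _) two_ne_zero).1 h3

theorem re_inner_fcalc_nonneg (hT : T.IsPositive) {F : ℝ → ℝ} (hF : ContinuousOn F (Ici 0))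
    (h : ∀ r, 0 ≤ r → 0 ≤ F r) (f : E) : 0 ≤ (inner ℂ f (fcalc T (fun r => (F r : ℂ)) f)).re := by
  have hS : ContinuousOn (fun r => ((√(F r) : ℝ) : ℂ)) (Ici 0) :=
    Complex.continuous_ofReal.comp_continuousOn (Real.continuous_sqrt.comp_continuousOn hF)
  have : fcalc T (fun r => (F r : ℂ)) =
      fcalc T (fun r => ((√(F r) : ℝ) : ℂ) * ((√(F r) : ℝ) : ℂ)) :=
    fcalc_congr hT fun r hr => by rw [← Complex.ofReal_mul, Real.mul_self_sqrt (h r hr)]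
  rw [this, fcalc_mul_apply hT hS hS]
  have h2 := inner_fcalc_left (T := T) (fun r => ((√(F r) : ℝ) : ℂ)) f
    (fcalc T (fun r => ((√(F r) : ℝ) : ℂ)) f)
  simp only [Complex.conj_ofReal] at h2
  rw [← h2]
  exact inner_self_nonneg (𝕜 := ℂ)

end Calculus

/-- Uniformly bounded operators converging on a dense set converge strongly. -/
theorem tendsto_apply_of_dense {ι E F : Type*} [NormedAddCommGroup E] [NormedSpace ℂ E]
    [NormedAddCommGroup F] [NormedSpace ℂ F] {l : Filter ι} {A : ι → E →L[ℂ] F} {B : E →L[ℂ] F}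
    {C : ℝ} (hA : ∀ i, ‖A i‖ ≤ C) {s : Set E} (hs : Dense s)
    (h : ∀ f ∈ s, Tendsto (fun i => A i f) l (𝓝 (B f))) (f : E) :
    Tendsto (fun i => A i f) l (𝓝 (B f)) := by
  rw [Metric.tendsto_nhds]
  intro ε hε
  have hD : 0 < |C| + ‖B‖ + 1 := by positivity
  obtain ⟨g, hg, hfg⟩ := Metric.dense_iff.1 hs f (ε / (2 * (|C| + ‖B‖ + 1))) (by positivity)
  have hfg' : ‖f - g‖ < ε / (2 * (|C| + ‖B‖ + 1)) := by
    rw [← dist_eq_norm, dist_comm]; exact hg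
  filter_upwards [Metric.tendsto_nhds.1 (h g hfg) (ε / 2) (by positivity)] with i hi
  rw [dist_eq_norm] at hi ⊢
  have e1 : A i f - B f = A i (f - g) + (A i g - B g) - B (f - g) := by
    simp only [map_sub]; abel
  have e2 : ‖A i (f - g)‖ ≤ |C| * ‖f - g‖ :=
    ((A i).le_opNorm _).trans (by gcongr; exact (hA i).trans (le_abs_self C))
  have e3 : ‖B (f - g)‖ ≤ ‖B‖ * ‖f - g‖ := B.le_opNorm _
  have e4 : (|C| + ‖B‖ + 1) * ‖f - g‖ < ε / 2 := by
    calc _ < (|C| + ‖B‖ + 1) * (ε / (2 * (|C| + ‖B‖ + 1))) := by gcongr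
      _ = ε / 2 := by field_simp
  calc ‖A i f - B f‖ ≤ ‖A i (f - g)‖ + ‖A i g - B g‖ + ‖B (f - g)‖ := by
        rw [e1]; exact (norm_sub_le _ _).trans (by gcongr; exact norm_add_le _ _)
    _ < ε := by nlinarith [norm_nonneg (f - g)]

/-! ### The unitary group of an operator with positive resolvent -/

section Group

variable {E : Type*} [NormedAddCommGroup E] [InnerProductSpace ℂ E] [CompleteSpace E]
  {T : E →L[ℂ] E}

/-- An injective self-adjoint operator has dense range. -/
theorem denseRange_of_isPositive (hT : T.IsPositive) (hinj : Function.Injective T) :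
    DenseRange T := by
  have h1 : (LinearMap.range (T : E →ₗ[ℂ] E))ᗮ = ⊥ := by
    rw [ContinuousLinearMap.orthogonal_range, hT.isSelfAdjoint.adjoint_eq]
    exact LinearMap.ker_eq_bot.2 hinj
  have h2 := (Submodule.topologicalClosure_eq_top_iff).2 h1
  have h3 := (Submodule.dense_iff_topologicalClosure_eq_top).2 h2
  exact h3

theorem denseRange_sq (hT : T.IsPositive) (hinj : Function.Injective T) :
    DenseRange fun f => T (T f) :=
  (denseRange_of_isPositive hT hinj).comp (denseRange_of_isPositive hT hinj) T.continuous

/-- The function `r ↦ r e^{it(1/r - c)}`, which is continuous up to `r = 0`: the symbol of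
`e^{it(T⁻¹ - c)} T`. -/
noncomputable def phase (c t r : ℝ) : ℂ := (r : ℂ) * Complex.exp (Complex.I * (t * (r⁻¹ - c) : ℝ))

theorem norm_phase (c t r : ℝ) : ‖phase c t r‖ = |r| := by
  rw [phase, norm_mul, mul_comm Complex.I, Complex.norm_exp_ofReal_mul_I]; simp

/-- The phase oscillates without limit as `r → 0`, but the factor `r` makes the product continuous. -/
theorem continuousOn_phase (c t : ℝ) : ContinuousOn (phase c t) (Ici 0) := by
  intro r hr
  by_cases h0 : r = 0
  · subst h0
    refine ContinuousAt.continuousWithinAt ?_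
    rw [ContinuousAt, show phase c t 0 = 0 by simp [phase], tendsto_zero_iff_norm_tendsto_zero]
    simp only [norm_phase]
    simpa using (continuous_abs.tendsto (0 : ℝ))
  · refine ContinuousAt.continuousWithinAt ?_
    unfold phase
    fun_prop (disch := assumption)

theorem phase_zero (c r : ℝ) : phase c 0 r = r := by simp [phase]

theorem phase_mul_phase (c s t r : ℝ) : phase c s r * phase c t r = r * phase c (s + t) r := by
  simp only [phase]
  rw [show Complex.I * ((s + t) * (r⁻¹ - c) : ℝ) =
    Complex.I * (s * (r⁻¹ - c) : ℝ) + Complex.I * (t * (r⁻¹ - c) : ℝ) by push_cast; ring,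
    Complex.exp_add]
  ring

theorem continuousOn_ofReal_Ici : ContinuousOn (fun r : ℝ => (r : ℂ)) (Ici 0) :=
  Complex.continuous_ofReal.continuousOn

/-- The unitary group `e^{it(T⁻¹ - c)}` of a bounded positive injective operator `T`: the extension
by continuity of `T f ↦ u_t(T) f`, where `u_t(r) = r e^{it(1/r - c)}`. -/
noncomputable def invGroup (T : E →L[ℂ] E) (c t : ℝ) : E →L[ℂ] E :=
  (fcalc T (phase c t) : E →ₗ[ℂ] E).extendOfNorm (T : E →ₗ[ℂ] E)

theorem norm_fcalc_phase (hT : T.IsPositive) (c t : ℝ) (f : E) :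
    ‖fcalc T (phase c t) f‖ = ‖T f‖ := by
  conv_rhs => rw [← fcalc_ofReal hT]
  exact norm_fcalc_apply_eq hT (continuousOn_phase c t) continuousOn_ofReal_Ici
    (fun r hr => by rw [norm_phase]; simp) f

theorem invGroup_apply (hT : T.IsPositive) (hinj : Function.Injective T) (c t : ℝ) (f : E) :
    invGroup T c t (T f) = fcalc T (phase c t) f :=
  LinearMap.extendOfNorm_eq (f := (fcalc T (phase c t) : E →ₗ[ℂ] E)) (e := (T : E →ₗ[ℂ] E))
    (denseRange_of_isPositive hT hinj)
    ⟨1, fun x => by simpa using (norm_fcalc_phase hT c t x).le⟩ f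

theorem norm_invGroup (hT : T.IsPositive) (hinj : Function.Injective T) (c t : ℝ) (f : E) :
    ‖invGroup T c t f‖ = ‖f‖ := by
  refine (denseRange_of_isPositive hT hinj).induction_on
    (p := fun f => ‖invGroup T c t f‖ = ‖f‖) f
    (isClosed_eq (by fun_prop) (by fun_prop)) fun f => ?_
  rw [invGroup_apply hT hinj, norm_fcalc_phase hT]

theorem invGroup_zero (hT : T.IsPositive) (hinj : Function.Injective T) (c : ℝ) :
    invGroup T c 0 = ContinuousLinearMap.id ℂ E := by
  ext f
  refine (denseRange_of_isPositive hT hinj).induction_on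
    (p := fun f => invGroup T c 0 f = ContinuousLinearMap.id ℂ E f) f
    (isClosed_eq (by fun_prop) (by fun_prop)) fun f => ?_
  rw [invGroup_apply hT hinj, fcalc_congr hT fun r _ => phase_zero c r, fcalc_ofReal hT]
  rfl

theorem invGroup_comm (hT : T.IsPositive) (hinj : Function.Injective T) (c t : ℝ) (f : E) :
    T (invGroup T c t f) = invGroup T c t (T f) := by
  refine (denseRange_of_isPositive hT hinj).induction_on
    (p := fun f => T (invGroup T c t f) = invGroup T c t (T f)) f
    (isClosed_eq (by fun_prop) (by fun_prop)) fun f => ?_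
  rw [invGroup_apply hT hinj, invGroup_apply hT hinj]
  have := fcalc_commute hT continuousOn_ofReal_Ici (continuousOn_phase c t) f
  rwa [fcalc_ofReal hT] at this

theorem invGroup_add (hT : T.IsPositive) (hinj : Function.Injective T) (c s t : ℝ) :
    invGroup T c (s + t) = (invGroup T c s).comp (invGroup T c t) := by
  ext f
  refine (denseRange_sq hT hinj).induction_on
    (p := fun f => invGroup T c (s + t) f = (invGroup T c s).comp (invGroup T c t) f) f
    (isClosed_eq (by fun_prop) (by fun_prop)) fun f => ?_
  rw [ContinuousLinearMap.comp_apply, ← invGroup_comm hT hinj c t, invGroup_apply hT hinj,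
    invGroup_apply hT hinj, invGroup_apply hT hinj,
    ← fcalc_mul_apply hT (continuousOn_phase c s) (continuousOn_phase c t)]
  simp only [phase_mul_phase]
  rw [fcalc_mul hT continuousOn_ofReal_Ici (continuousOn_phase c _), fcalc_ofReal hT]
  have := fcalc_commute hT continuousOn_ofReal_Ici (continuousOn_phase c (s + t)) f
  rw [fcalc_ofReal hT] at this
  exact this.symm

theorem norm_invGroup_le (hT : T.IsPositive) (hinj : Function.Injective T) (c t : ℝ) :
    ‖invGroup T c t‖ ≤ 1 :=
  ContinuousLinearMap.opNorm_le_bound _ zero_le_one fun f => by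
    rw [norm_invGroup hT hinj, one_mul]

theorem norm_phase_sub_le (c s t : ℝ) {r : ℝ} (hr : 0 ≤ r) :
    ‖phase c t r - phase c s r‖ ≤ |t - s| * (1 + |c| * r) := by
  have h1 : phase c t r - phase c s r = phase c s r *
      (Complex.exp (Complex.I * ((t - s) * (r⁻¹ - c) : ℝ)) - 1) := by
    simp only [phase]
    rw [show Complex.I * (t * (r⁻¹ - c) : ℝ) = Complex.I * (s * (r⁻¹ - c) : ℝ) +
      Complex.I * ((t - s) * (r⁻¹ - c) : ℝ) by push_cast; ring, Complex.exp_add]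
    ring
  rw [h1, norm_mul, norm_phase, abs_of_nonneg hr]
  calc r * ‖Complex.exp (Complex.I * ((t - s) * (r⁻¹ - c) : ℝ)) - 1‖
      ≤ r * |(t - s) * (r⁻¹ - c)| := by
        gcongr
        exact Real.norm_exp_I_mul_ofReal_sub_one_le
    _ = |t - s| * |r * r⁻¹ - r * c| := by
        rw [abs_mul, ← mul_sub, abs_mul r, abs_of_nonneg hr]; ring
    _ ≤ |t - s| * (1 + |c| * r) := by
        gcongr
        refine (abs_sub _ _).trans ?_
        gcongr
        · rw [abs_of_nonneg (by positivity)]; exact mul_inv_le_one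
        · rw [abs_mul, abs_of_nonneg hr, mul_comm]

theorem continuous_invGroup (hT : T.IsPositive) (hinj : Function.Injective T) (c : ℝ) (f : E) :
    Continuous fun t => invGroup T c t f := by
  rw [continuous_iff_continuousAt]
  intro s
  refine tendsto_apply_of_dense (A := fun t => invGroup T c t) (fun t => norm_invGroup_le hT hinj c t)
    (denseRange_of_isPositive hT hinj) ?_ f
  rintro _ ⟨f, rfl⟩
  simp only [invGroup_apply hT hinj]
  rw [tendsto_iff_norm_sub_tendsto_zero]
  have hb : ∀ t, ‖fcalc T (phase c t) f - fcalc T (phase c s) f‖ ≤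
      |t - s| * (1 + |c| * ‖T‖) * ‖f‖ := by
    intro t
    rw [← sub_apply,
      ← fcalc_sub hT (continuousOn_phase c t) (continuousOn_phase c s)]
    refine (ContinuousLinearMap.le_opNorm _ _).trans ?_
    gcongr
    refine norm_fcalc_le_of_le_norm hT (by positivity) fun r hr hr' => ?_
    exact (norm_phase_sub_le c s t hr).trans (by gcongr)
  refine squeeze_zero (fun _ => norm_nonneg _) hb ?_
  have : Continuous fun t : ℝ => |t - s| * (1 + |c| * ‖T‖) * ‖f‖ := by fun_prop
  simpa using this.tendsto s

theorem norm_exp_sub_one_sub_le (x : ℝ) :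
    ‖Complex.exp (Complex.I * x) - 1 - Complex.I * x‖ ≤ 3 * x ^ 2 := by
  by_cases h : |x| ≤ 1
  · have h2 := Complex.norm_exp_sub_one_sub_id_le (x := Complex.I * x) (by simpa using h)
    have h3 : ‖Complex.I * (x : ℂ)‖ ^ 2 = x ^ 2 := by simp
    rw [h3] at h2
    nlinarith [sq_nonneg x]
  · push Not at h
    have h1 : ‖Complex.exp (Complex.I * x)‖ = 1 := by
      rw [mul_comm, Complex.norm_exp_ofReal_mul_I]
    calc _ ≤ ‖Complex.exp (Complex.I * x)‖ + ‖(1 : ℂ)‖ + ‖Complex.I * (x : ℂ)‖ :=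
          (norm_sub_le _ _).trans (by gcongr; exact norm_sub_le _ _)
      _ = 2 + |x| := by rw [h1]; simp; norm_num
      _ ≤ 3 * x ^ 2 := by rw [← sq_abs]; nlinarith

theorem hasDerivAt_invGroup (hT : T.IsPositive) (hinj : Function.Injective T) (c : ℝ) (f : E) :
    HasDerivAt (fun t => invGroup T c t (T f)) (Complex.I • (f - (c : ℂ) • T f)) 0 := by
  rw [hasDerivAt_iff_tendsto_slope_zero]
  simp only [zero_add, invGroup_apply hT hinj]
  have h0 : fcalc T (phase c 0) = T := by
    rw [fcalc_congr hT fun r _ => phase_zero c r, fcalc_ofReal hT]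
  rw [h0]
  have key := tendsto_apply_of_dense (l := 𝓝[≠] (0 : ℝ)) (F := E)
    (A := fun t : ℝ => t⁻¹ • (fcalc T (phase c t) - T)) (B := Complex.I • (1 - (c : ℂ) • T))
    (C := 1 + |c| * ‖T‖) (fun t => ?_) (denseRange_of_isPositive hT hinj) ?_ f
  · simpa using key
  · rw [norm_smul]
    have : ‖fcalc T (phase c t) - T‖ ≤ |t| * (1 + |c| * ‖T‖) := by
      have e0 : fcalc T (phase c t) - T = fcalc T (phase c t) - fcalc T (phase c 0) := by rw [h0]
      rw [e0, ← fcalc_sub hT (continuousOn_phase c t) (continuousOn_phase c 0)]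
      refine norm_fcalc_le_of_le_norm hT (by positivity) fun r hr hr' => ?_
      have := norm_phase_sub_le c 0 t hr
      rw [sub_zero] at this
      exact this.trans (by gcongr)
    by_cases ht : t = 0
    · subst ht; simp; positivity
    · calc ‖t⁻¹‖ * ‖fcalc T (phase c t) - T‖ ≤ |t|⁻¹ * (|t| * (1 + |c| * ‖T‖)) := by
            rw [Real.norm_eq_abs, abs_inv]; gcongr
        _ = 1 + |c| * ‖T‖ := by
            have : |t| ≠ 0 := abs_ne_zero.2 ht
            field_simp
  · rintro _ ⟨f, rfl⟩
    rw [tendsto_iff_norm_sub_tendsto_zero]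
    -- On the range of `T` the remainder has the symbol `r² (e^{ix} - 1 - ix)` with `x = t(1/r - c)`.
    have hb : ∀ t : ℝ, t ≠ 0 → ‖(t⁻¹ • (fcalc T (phase c t) - T)) (T f) -
        (Complex.I • (1 - (c : ℂ) • T)) (T f)‖ ≤ 3 * |t| * (1 + |c| * ‖T‖) ^ 2 * ‖f‖ := by
      intro t ht
      have hc1 : ContinuousOn (fun r : ℝ => (r : ℂ) * (phase c t r - r)) (Ici 0) :=
        continuousOn_ofReal_Ici.mul ((continuousOn_phase c t).sub continuousOn_ofReal_Ici)
      have hc3 : ContinuousOn (fun r : ℝ => (1 : ℂ) - c * r) (Ici 0) := by fun_prop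
      have hc2 : ContinuousOn (fun r : ℝ => (r : ℂ) * (1 - c * r)) (Ici 0) := by fun_prop
      have e1 : fcalc T (fun r : ℝ => (t : ℂ)⁻¹ * ((r : ℂ) * (phase c t r - r)) -
          Complex.I * ((r : ℂ) * (1 - c * r))) = (t : ℂ)⁻¹ • (T * (fcalc T (phase c t) - T)) -
          Complex.I • (T * (1 - (c : ℂ) • T)) := by
        rw [fcalc_sub hT (F := fun r : ℝ => (t : ℂ)⁻¹ * ((r : ℂ) * (phase c t r - r)))
          (G := fun r : ℝ => Complex.I * ((r : ℂ) * (1 - c * r)))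
          (continuousOn_const.mul hc1) (continuousOn_const.mul hc2),
          fcalc_const_mul hT _ hc1, fcalc_const_mul hT _ hc2, fcalc_mul hT continuousOn_ofReal_Ici
          (G := fun r => phase c t r - r) ((continuousOn_phase c t).sub continuousOn_ofReal_Ici), fcalc_mul hT
          continuousOn_ofReal_Ici hc3, fcalc_sub hT (continuousOn_phase c t)
          continuousOn_ofReal_Ici, fcalc_sub hT (F := fun _ => 1) (G := fun r => (c : ℂ) * r) continuousOn_const (by fun_prop),
          fcalc_const_mul hT _ continuousOn_ofReal_Ici, fcalc_const hT, fcalc_ofReal hT, one_smul]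
      have e2 : (t⁻¹ • (fcalc T (phase c t) - T)) (T f) - (Complex.I • (1 - (c : ℂ) • T)) (T f) =
          fcalc T (fun r : ℝ => (t : ℂ)⁻¹ * ((r : ℂ) * (phase c t r - r)) -
          Complex.I * ((r : ℂ) * (1 - c * r))) f := by
        rw [e1]
        have hcm := fcalc_commute hT continuousOn_ofReal_Ici (continuousOn_phase c t) f
        rw [fcalc_ofReal hT] at hcm
        simp only [sub_apply, smul_apply,
          mul_apply_eq_comp, map_sub, hcm, one_apply_eq_self, map_smul]
        congr 1
        rw [← Complex.coe_smul, Complex.ofReal_inv]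
      rw [e2]
      refine (ContinuousLinearMap.le_opNorm _ _).trans ?_
      gcongr
      refine norm_fcalc_le_of_le_norm hT (by positivity) fun r hr hr' => ?_
      by_cases hr0 : r = 0
      · subst hr0; simp; positivity
      have hrc : (r : ℂ) ≠ 0 := by exact_mod_cast hr0
      have htc : (t : ℂ) ≠ 0 := by exact_mod_cast ht
      have e3 : (t : ℂ)⁻¹ * ((r : ℂ) * (phase c t r - r)) - Complex.I * ((r : ℂ) * (1 - c * r)) =
          (t : ℂ)⁻¹ * (r : ℂ) ^ 2 * (Complex.exp (Complex.I * (t * (r⁻¹ - c) : ℝ)) - 1 -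
            Complex.I * (t * (r⁻¹ - c) : ℝ)) := by
        simp only [phase]; push_cast; field_simp
      rw [e3, norm_mul, norm_mul, norm_inv, norm_pow, Complex.norm_real, Complex.norm_real,
        Real.norm_eq_abs, Real.norm_eq_abs, sq_abs]
      have ht' : 0 < |t| := abs_pos.2 ht
      calc |t|⁻¹ * r ^ 2 * ‖Complex.exp (Complex.I * (t * (r⁻¹ - c) : ℝ)) - 1 -
            Complex.I * (t * (r⁻¹ - c) : ℝ)‖
          ≤ |t|⁻¹ * r ^ 2 * (3 * (t * (r⁻¹ - c)) ^ 2) := by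
            gcongr; exact norm_exp_sub_one_sub_le _
        _ = 3 * |t| * |1 - c * r| ^ 2 := by
            rw [sq_abs]
            have : t ^ 2 = |t| ^ 2 := (sq_abs t).symm
            rw [mul_pow, this]; field_simp
        _ ≤ 3 * |t| * (1 + |c| * ‖T‖) ^ 2 := by
            gcongr
            refine (abs_sub _ _).trans ?_
            rw [abs_one, abs_mul, abs_of_nonneg hr]
            gcongr
    refine squeeze_zero' (Eventually.of_forall fun _ => norm_nonneg _)
      (eventually_mem_nhdsWithin.mono fun t ht => hb t ht) ?_
    have : Continuous fun t : ℝ => 3 * |t| * (1 + |c| * ‖T‖) ^ 2 * ‖f‖ := by fun_prop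
    simpa using (this.tendsto 0).mono_left nhdsWithin_le_nhds

/-- The generator of `invGroup T c` is exactly `T⁻¹ - c`. Applying `T` to a differentiable orbit moves
it into the range of `T`, where the derivative is explicit. -/
theorem hasDerivAt_invGroup_iff (hT : T.IsPositive) (hinj : Function.Injective T) (c : ℝ)
    (ψ g : E) : HasDerivAt (fun t => invGroup T c t ψ) (Complex.I • g) 0 ↔
      ψ = T (g + (c : ℂ) • ψ) := by
  constructor
  · intro h
    have h1 : HasDerivAt (fun t => T (invGroup T c t ψ)) (T (Complex.I • g)) 0 :=
      (T.restrictScalars ℝ).hasFDerivAt.comp_hasDerivAt 0 h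
    simp only [invGroup_comm hT hinj] at h1
    have h2 := h1.unique (hasDerivAt_invGroup hT hinj c ψ)
    rw [map_smul] at h2
    have h3 : T g = ψ - (c : ℂ) • T ψ := smul_right_injective E Complex.I_ne_zero h2
    rw [map_add, h3, map_smul]
    abel
  · intro h
    have := hasDerivAt_invGroup hT hinj c (g + (c : ℂ) • ψ)
    rw [← h] at this
    simpa using this

end Group

theorem hasDerivAt_norm_sq {E : Type*} [NormedAddCommGroup E] [InnerProductSpace ℂ E]
    {u : ℝ → E} {u' : E} {t : ℝ} (h : HasDerivAt u u' t) :
    HasDerivAt (fun s => ‖u s‖ ^ 2) (2 * (inner ℂ (u t) u').re) t := by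
  let _ : InnerProductSpace ℝ E := InnerProductSpace.rclikeToReal ℂ E
  have := h.norm_sq
  rwa [real_inner_eq_re_inner ℂ] at this

theorem IsUnitaryGroupOf.hasDerivAt {A : Set (L2 × L2)} {U : ℝ → L2 →L[ℂ] L2}
    (hU : IsUnitaryGroupOf A U) {ψ g : L2} (h : (ψ, g) ∈ A) (t : ℝ) :
    HasDerivAt (fun t => U t ψ) (Complex.I • U t g) t ∧ (U t ψ, U t g) ∈ A := by
  have h0 := (hU.mem_iff_hasDerivAt ψ g).1 h
  have h1 : HasDerivAt (fun s => U t (U s ψ)) (Complex.I • U t g) 0 := by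
    have := ((U t).restrictScalars ℝ).hasFDerivAt.comp_hasDerivAt 0 h0
    simpa [Function.comp_def] using this
  constructor
  · have h2 : HasDerivAt (fun s => U t (U s ψ)) (Complex.I • U t g) (t - t) := by
      rwa [sub_self]
    have h3 := HasDerivAt.scomp t (h := fun s => s - t) h2 ((hasDerivAt_id t).sub_const t)
    simp only [one_smul] at h3
    refine h3.congr_of_eventuallyEq (Eventually.of_forall fun s => ?_)
    simp only [Function.comp_apply]
    rw [← ContinuousLinearMap.comp_apply, ← hU.map_add, add_sub_cancel]
  · rw [hU.mem_iff_hasDerivAt]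
    refine h1.congr_of_eventuallyEq (Eventually.of_forall fun s => ?_)
    show U s (U t ψ) = U t (U s ψ)
    rw [← ContinuousLinearMap.comp_apply, ← ContinuousLinearMap.comp_apply, ← hU.map_add,
      ← hU.map_add, add_comm]

/-- A unitary group is determined by its generator. -/
theorem IsUnitaryGroupOf.unique {A : Set (L2 × L2)} {U V : ℝ → L2 →L[ℂ] L2}
    (hU : IsUnitaryGroupOf A U) (hV : IsUnitaryGroupOf A V)
    (hA : Dense {ψ : L2 | ∃ g, (ψ, g) ∈ A}) : U = V := by
  -- The generator of an isometric group is skew: `Re ⟪ψ, i g⟫ = 0` on its graph.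
  have hskew : ∀ {ψ g : L2}, HasDerivAt (fun t => U t ψ) (Complex.I • g) 0 →
      (inner ℂ ψ (Complex.I • g)).re = 0 := by
    intro ψ g h
    have h1 := hasDerivAt_norm_sq h
    simp only [hU.norm_map] at h1
    have h2 := h1.unique (hasDerivAt_const _ _)
    rw [hU.map_zero, ContinuousLinearMap.id_apply] at h2
    linarith
  ext1 t
  have key : ∀ ψ ∈ {ψ : L2 | ∃ g, (ψ, g) ∈ A}, U t ψ = V t ψ := by
    rintro ψ ⟨g, hg⟩
    have hd : ∀ s, HasDerivAt (fun s => ‖U s ψ - V s ψ‖ ^ 2) 0 s := by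
      intro s
      have h1 := ((hU.hasDerivAt hg s).1.sub (hV.hasDerivAt hg s).1)
      have h4 : HasDerivAt (fun t => U t (U s ψ - V s ψ)) (Complex.I • (U s g - V s g)) 0 := by
        have := ((hU.mem_iff_hasDerivAt _ _).1 (hU.hasDerivAt hg s).2).sub
          ((hU.mem_iff_hasDerivAt _ _).1 (hV.hasDerivAt hg s).2)
        simpa [smul_sub, Pi.sub_def] using this
      have h5 := hskew h4
      have h2 := hasDerivAt_norm_sq h1
      simp only [Pi.sub_apply] at h2
      rw [← smul_sub, h5, mul_zero] at h2
      exact h2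
    have hc := is_const_of_deriv_eq_zero (fun s => (hd s).differentiableAt)
      (fun s => (hd s).deriv) t 0
    simp only [hU.map_zero, hV.map_zero, sub_self, norm_zero] at hc
    have : ‖U t ψ - V t ψ‖ = 0 := by simpa using hc
    exact sub_eq_zero.1 (norm_eq_zero.1 this)
  have := Continuous.ext_on hA (U t).continuous (V t).continuous key
  ext1 f
  exact congrFun this f

/-- The group of `T⁻¹ - c`, with the graph written in terms of the bounded operator `T`. -/
theorem isUnitaryGroupOf_invGroup {T : L2 →L[ℂ] L2} (hT : T.IsPositive)
    (hinj : Function.Injective T) (c : ℝ) :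
    IsUnitaryGroupOf {p : L2 × L2 | p.1 = T (p.2 + (c : ℂ) • p.1)} (invGroup T c) where
  map_zero := invGroup_zero hT hinj c
  map_add := invGroup_add hT hinj c
  norm_map := norm_invGroup hT hinj c
  continuous_orbit := continuous_invGroup hT hinj c
  mem_iff_hasDerivAt ψ g := (hasDerivAt_invGroup_iff hT hinj c ψ g).symm

theorem expI_eq_invGroup {T : L2 →L[ℂ] L2} (hT : T.IsPositive)
    (hinj : Function.Injective T) (c : ℝ) :
    expI {p : L2 × L2 | p.1 = T (p.2 + (c : ℂ) • p.1)} = invGroup T c := by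
  have hex : ∃ U, IsUnitaryGroupOf {p : L2 × L2 | p.1 = T (p.2 + (c : ℂ) • p.1)} U :=
    ⟨_, isUnitaryGroupOf_invGroup hT hinj c⟩
  rw [expI, dif_pos hex]
  refine hex.choose_spec.unique (isUnitaryGroupOf_invGroup hT hinj c) ?_
  refine (denseRange_of_isPositive hT hinj).mono ?_
  rintro _ ⟨h, rfl⟩
  exact ⟨h - (c : ℂ) • T h, by simp⟩

/-! ### Functions of the energy -/

/-- Continuous functions of the energy with compact support in `(0, ∞)`. -/
structure IsTest (F : ℝ → ℂ) : Prop where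
  cont : Continuous F
  supp : ∃ a b : ℝ, 0 < a ∧ ∀ x, x ∉ Icc a b → F x = 0

namespace IsTest

variable {F G : ℝ → ℂ}

theorem eq_zero_of_nonpos (hF : IsTest F) {x : ℝ} (hx : x ≤ 0) : F x = 0 := by
  obtain ⟨a, b, ha, h⟩ := hF.supp
  exact h x fun hx' => by linarith [hx'.1]

theorem mul (hF : IsTest F) (hG : Continuous G) : IsTest fun x => G x * F x := by
  obtain ⟨a, b, ha, h⟩ := hF.supp
  exact ⟨hG.mul hF.cont, a, b, ha, fun x hx => by simp [h x hx]⟩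

theorem conj (hF : IsTest F) : IsTest fun x => starRingEnd ℂ (F x) := by
  obtain ⟨a, b, ha, h⟩ := hF.supp
  exact ⟨Complex.continuous_conj.comp hF.cont, a, b, ha, fun x hx => by simp [h x hx]⟩

theorem hasCompactSupport (hF : IsTest F) : HasCompactSupport F := by
  obtain ⟨a, b, ha, h⟩ := hF.supp
  exact HasCompactSupport.of_support_subset_isCompact (isCompact_Icc (a := a) (b := b))
    fun x hx => by_contra fun hx' => hx (h x hx')

theorem continuousOn_mul_comp (hF : IsTest F) {c : ℝ} (hc : 0 < c) {G : ℝ → ℂ}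
    (hG : ContinuousOn G (Ioi 0)) : ContinuousOn (fun r => G r * F (r⁻¹ - c)) (Ici 0) := by
  intro r hr
  rcases (mem_Ici.1 hr).eq_or_lt with h0 | h0
  · subst h0
    obtain ⟨a, b, ha, h⟩ := hF.supp
    have hev : ∀ᶠ r in 𝓝[Ici 0] (0 : ℝ), G r * F (r⁻¹ - c) = 0 := by
      have hlt : ∀ᶠ r in 𝓝[Ici 0] (0 : ℝ), r < (|b| + c)⁻¹ :=
        nhdsWithin_le_nhds (Iio_mem_nhds (by positivity))
      filter_upwards [hlt, self_mem_nhdsWithin] with r hr1 hr2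
      rcases (mem_Ici.1 hr2).eq_or_lt with h1 | h1
      · subst h1
        rw [inv_zero, hF.eq_zero_of_nonpos (by linarith), mul_zero]
      · rw [h, mul_zero]
        intro hx
        have : |b| + c < r⁻¹ := (lt_inv_comm₀ h1 (by positivity)).1 hr1
        linarith [hx.2, le_abs_self b]
    refine (continuousWithinAt_const (b := (0 : ℂ))).congr_of_eventuallyEq hev ?_
    rw [inv_zero, hF.eq_zero_of_nonpos (by linarith), mul_zero]
  · have h1 : ContinuousAt G r := hG.continuousAt (Ioi_mem_nhds h0)
    have h2 : ContinuousAt (fun r => F (r⁻¹ - c)) r :=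
      hF.cont.continuousAt.comp (f := fun r : ℝ => r⁻¹ - c)
        ((continuousAt_inv₀ h0.ne').sub continuousAt_const)
    exact (h1.mul h2).continuousWithinAt

theorem continuousOn_comp (hF : IsTest F) {c : ℝ} (hc : 0 < c) :
    ContinuousOn (fun r => F (r⁻¹ - c)) (Ici 0) := by
  simpa using hF.continuousOn_mul_comp hc (G := fun _ => 1) continuousOn_const

theorem mul_continuousOn (hF : IsTest F) (hG : ContinuousOn G (Ioi 0)) :
    IsTest fun x => F x * G x := by
  obtain ⟨a, b, ha, h⟩ := hF.supp
  refine ⟨continuous_iff_continuousAt.2 fun x => ?_, a, b, ha, fun x hx => by simp [h x hx]⟩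
  by_cases hx : 0 < x
  · exact hF.cont.continuousAt.mul (hG.continuousAt (Ioi_mem_nhds hx))
  · have : (fun x => F x * G x) =ᶠ[𝓝 x] fun _ => 0 := by
      filter_upwards [Iio_mem_nhds (show x < a by linarith)] with y hy
      rw [h y fun h => by linarith [h.1, mem_Iio.1 hy], zero_mul]
    exact continuousAt_const.congr this.symm

theorem exists_bound (hF : IsTest F) : ∃ B, 0 ≤ B ∧ ∀ x, ‖F x‖ ≤ B := by
  obtain ⟨B, hB⟩ := hF.hasCompactSupport.exists_bound_of_continuous hF.cont
  exact ⟨B, (norm_nonneg _).trans (hB 0), hB⟩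

end IsTest

section Energy

variable {E : Type*} [NormedAddCommGroup E] [InnerProductSpace ℂ E] [CompleteSpace E]

/-- The operator `F(H)` for `H = T⁻¹ - c` and a function `F` vanishing on `(-∞, 0]` and near
infinity. At `r = 0` the junk value `0⁻¹ = 0` gives `F(-c) = 0`, the correct limit. -/
noncomputable def energyCalc (T : E →L[ℂ] E) (c : ℝ) (F : ℝ → ℂ) : E →L[ℂ] E :=
  fcalc T fun r => F (r⁻¹ - c)

variable {T : E →L[ℂ] E} {c : ℝ} {F G : ℝ → ℂ}

theorem energyCalc_mul (hT : T.IsPositive) (hc : 0 < c) (hF : IsTest F) (hG : IsTest G) (f : E) :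
    energyCalc T c (fun x => F x * G x) f = energyCalc T c F (energyCalc T c G f) :=
  fcalc_mul_apply hT (hF.continuousOn_comp hc) (hG.continuousOn_comp hc) f

theorem inner_energyCalc_left (f g : E) : inner ℂ (energyCalc T c F f) g =
    inner ℂ f (energyCalc T c (fun x => starRingEnd ℂ (F x)) g) :=
  inner_fcalc_left _ f g

theorem norm_energyCalc_le (hT : T.IsPositive) {B : ℝ} (hB : 0 ≤ B) (h : ∀ x, ‖F x‖ ≤ B) :
    ‖energyCalc T c F‖ ≤ B :=
  norm_fcalc_le hT hB fun _ _ => h _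

theorem energyCalc_comm (hT : T.IsPositive) (hc : 0 < c) (hF : IsTest F) (f : E) :
    T (energyCalc T c F f) = energyCalc T c F (T f) := by
  have := fcalc_commute hT continuousOn_ofReal_Ici (hF.continuousOn_comp hc) f
  rwa [fcalc_ofReal hT] at this

theorem invGroup_energyCalc (hT : T.IsPositive) (hinj : Function.Injective T) (hc : 0 < c)
    (hF : IsTest F) (t : ℝ) (f : E) : invGroup T c t (energyCalc T c F f) =
      energyCalc T c (fun x => Complex.exp (Complex.I * (t : ℂ) * (x : ℂ)) * F x) f := by
  have hG : ContinuousOn (fun r : ℝ => (r : ℂ)⁻¹ * F (r⁻¹ - c)) (Ici 0) :=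
    hF.continuousOn_mul_comp hc (G := fun r : ℝ => (r : ℂ)⁻¹) <|
      Complex.continuous_ofReal.continuousOn.inv₀ fun r hr => by
        exact_mod_cast (ne_of_gt hr : r ≠ 0)
  have h1 : energyCalc T c F f = T (fcalc T (fun r : ℝ => (r : ℂ)⁻¹ * F (r⁻¹ - c)) f) := by
    have := fcalc_mul_apply hT continuousOn_ofReal_Ici hG f
    rw [fcalc_ofReal hT] at this
    rw [← this, energyCalc]
    refine DFunLike.congr_fun (fcalc_congr hT fun r _ => ?_) f
    by_cases h0 : r = 0
    · subst h0; simp [hF.eq_zero_of_nonpos (show -c ≤ 0 by linarith)]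
    · have : (r : ℂ) ≠ 0 := by exact_mod_cast h0
      field_simp
  rw [h1, invGroup_apply hT hinj, ← fcalc_mul_apply hT (continuousOn_phase c t) hG, energyCalc]
  refine DFunLike.congr_fun (fcalc_congr hT fun r _ => ?_) f
  by_cases h0 : r = 0
  · subst h0; simp [phase, hF.eq_zero_of_nonpos (show -c ≤ 0 by linarith)]
  · have : (r : ℂ) ≠ 0 := by exact_mod_cast h0
    simp only [phase]
    push_cast
    field_simp

/-! ### Stone's formula -/

/-- The symbol `r / (1 - (c + w) r) = 1 / (1/r - c - w)` of the resolvent `(T⁻¹ - c - w)⁻¹`. -/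
noncomputable def resSymbol (c : ℝ) (w : ℂ) (r : ℝ) : ℂ := r / (1 - (c + w) * r)

theorem resSymbol_denom_ne {c : ℝ} {w : ℂ} (hw : w.im ≠ 0) (r : ℝ) :
    (1 : ℂ) - (c + w) * r ≠ 0 := by
  intro h
  have him := congrArg Complex.im h
  simp [hw] at him
  subst him
  simp at h

theorem norm_resSymbol_le {c : ℝ} {w : ℂ} (hw : w.im ≠ 0) (r : ℝ) :
    ‖resSymbol c w r‖ ≤ |w.im|⁻¹ := by
  rw [resSymbol, norm_div, div_le_iff₀ (norm_pos_iff.2 (resSymbol_denom_ne hw r)),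
    Complex.norm_real, Real.norm_eq_abs]
  have : |r| * |w.im| ≤ ‖(1 : ℂ) - (c + w) * r‖ := by
    refine le_trans (le_of_eq ?_) (Complex.abs_im_le_norm _)
    simp [abs_mul, mul_comm]
  rw [inv_mul_eq_div, le_div_iff₀ (abs_pos.2 hw)]
  exact this

theorem continuous_resSymbol_uncurry {c ε : ℝ} (hε : ε ≠ 0) :
    Continuous fun p : ℝ × ℝ => resSymbol c (p.1 + Complex.I * ε) p.2 := by
  unfold resSymbol
  refine Continuous.div (by fun_prop) (by fun_prop) fun p => ?_
  exact resSymbol_denom_ne (by simpa using hε) p.2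

/-- The Poisson kernel `(1/π) ε / ((s - x)² + ε²)`, `s = 1/r - c`, as a difference of two
resolvent symbols. -/
noncomputable def poissonSymbol (c ε x r : ℝ) : ℂ :=
  (resSymbol c (x + Complex.I * ε) r - resSymbol c (x + Complex.I * (-ε : ℝ)) r) /
    (2 * Real.pi * Complex.I)

theorem poissonSymbol_eq {c ε x r : ℝ} (hε : 0 < ε) (hr : r ≠ 0) :
    poissonSymbol c ε x r = ((Real.pi⁻¹ * ε⁻¹ * (1 + ((x - (r⁻¹ - c)) / ε) ^ 2)⁻¹ : ℝ) : ℂ) := by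
  have h1 := resSymbol_denom_ne (c := c) (w := x + Complex.I * ε) (by simpa using hε.ne') r
  have h2 := resSymbol_denom_ne (c := c) (w := x + Complex.I * (-ε : ℝ)) (by simpa using hε.ne') r
  have hrc : (r : ℂ) ≠ 0 := by exact_mod_cast hr
  have hεc : (ε : ℂ) ≠ 0 := by exact_mod_cast hε.ne'
  have hpi : (Real.pi : ℂ) ≠ 0 := by exact_mod_cast Real.pi_ne_zero
  have h3 : (1 : ℝ) + ((x - (r⁻¹ - c)) / ε) ^ 2 ≠ 0 := by positivity
  have h3' : (1 : ℂ) + ((x - ((r : ℂ)⁻¹ - c)) / ε) ^ 2 ≠ 0 := by exact_mod_cast h3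
  rw [poissonSymbol, resSymbol, resSymbol, div_sub_div _ _ h1 h2, div_div, div_eq_iff
    (mul_ne_zero (mul_ne_zero h1 h2) (by simp [hpi]))]
  push_cast at h1 h2 ⊢
  have h4 : ((1 : ℂ) - (c + (x + Complex.I * ε)) * r) * (1 - (c + (x + Complex.I * -ε)) * r) =
      r ^ 2 * ε ^ 2 * (1 + ((x - ((r : ℂ)⁻¹ - c)) / ε) ^ 2) := by
    field_simp
    ring_nf
    simp only [Complex.I_sq]
    ring
  rw [h4]
  generalize (1 : ℂ) + ((x - ((r : ℂ)⁻¹ - c)) / ε) ^ 2 = q at h3' ⊢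
  field_simp
  ring

theorem norm_poissonSymbol_le {c ε : ℝ} (hε : 0 < ε) (x r : ℝ) :
    ‖poissonSymbol c ε x r‖ ≤ ε⁻¹ := by
  rw [poissonSymbol, norm_div]
  have h1 := norm_resSymbol_le (c := c) (w := x + Complex.I * ε) (by simpa using hε.ne') r
  have h2 := norm_resSymbol_le (c := c) (w := x + Complex.I * (-ε : ℝ)) (by simpa using hε.ne') r
  simp only [Complex.add_im, Complex.ofReal_im, Complex.mul_im, Complex.I_re, Complex.I_im,
    Complex.ofReal_re, zero_mul, one_mul, zero_add, abs_neg, abs_of_pos hε] at h1 h2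
  have h3 : ‖(2 * Real.pi * Complex.I : ℂ)‖ = 2 * Real.pi := by
    simp [abs_of_pos Real.pi_pos]
  rw [h3, div_le_iff₀ (by positivity)]
  have h4 : ε⁻¹ * 1 ≤ ε⁻¹ * Real.pi := by
    gcongr; linarith [Real.pi_gt_three]
  refine (norm_sub_le _ _).trans ?_
  linarith

theorem continuous_poissonSymbol_uncurry {c ε : ℝ} (hε : 0 < ε) :
    Continuous fun p : ℝ × ℝ => poissonSymbol c ε p.1 p.2 := by
  unfold poissonSymbol
  refine Continuous.div_const ?_ _
  refine (continuous_resSymbol_uncurry hε.ne').sub ?_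
  exact continuous_resSymbol_uncurry (ε := -ε) (by simpa using hε.ne')

/-- The substitution `x = 1/r - c + εv` in the Poisson integral. -/
theorem integral_poissonSymbol_mul {c ε r : ℝ} (hε : 0 < ε) (hr : r ≠ 0) (F : ℝ → ℂ) :
    ∫ x, F x * poissonSymbol c ε x r =
      ∫ v, ((Real.pi⁻¹ * (1 + v ^ 2)⁻¹ : ℝ) : ℂ) * F (r⁻¹ - c + ε * v) := by
  have h1 : ∀ x, F x * poissonSymbol c ε x r = (fun v : ℝ => (ε : ℂ)⁻¹ *
      (((Real.pi⁻¹ * (1 + v ^ 2)⁻¹ : ℝ) : ℂ) * F (r⁻¹ - c + ε * v))) ((x - (r⁻¹ - c)) / ε) := by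
    intro x
    rw [poissonSymbol_eq hε hr]
    have : r⁻¹ - c + ε * ((x - (r⁻¹ - c)) / ε) = x := by field_simp; ring
    simp only [this]
    push_cast
    ring
  simp_rw [h1]
  rw [integral_sub_right_eq_self (fun x => (fun v : ℝ => (ε : ℂ)⁻¹ *
      (((Real.pi⁻¹ * (1 + v ^ 2)⁻¹ : ℝ) : ℂ) * F (r⁻¹ - c + ε * v))) (x / ε)) (r⁻¹ - c),
    Measure.integral_comp_div (fun v : ℝ => (ε : ℂ)⁻¹ *
      (((Real.pi⁻¹ * (1 + v ^ 2)⁻¹ : ℝ) : ℂ) * F (r⁻¹ - c + ε * v))) ε, integral_const_mul,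
    abs_of_pos hε]
  have hεc : (ε : ℂ) ≠ 0 := by exact_mod_cast hε.ne'
  rw [Complex.real_smul, mul_inv_cancel_left₀ hεc]

theorem tendsto_poisson_tail {δ : ℝ} (hδ : 0 < δ) :
    Tendsto (fun ε : ℝ => ∫ v : ℝ, {v : ℝ | δ ≤ ε * |v|}.indicator
      (fun v => Real.pi⁻¹ * (1 + v ^ 2)⁻¹) v) (𝓝[>] 0) (𝓝 0) := by
  have hI : Integrable fun v : ℝ => Real.pi⁻¹ * (1 + v ^ 2)⁻¹ :=
    integrable_inv_one_add_sq.const_mul _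
  have := tendsto_integral_filter_of_dominated_convergence (μ := volume) (l := 𝓝[>] (0 : ℝ))
    (F := fun ε v => {v : ℝ | δ ≤ ε * |v|}.indicator (fun v => Real.pi⁻¹ * (1 + v ^ 2)⁻¹) v)
    (f := fun _ => (0 : ℝ)) (fun v => Real.pi⁻¹ * (1 + v ^ 2)⁻¹) ?_ ?_ hI ?_
  · simpa using this
  · refine Eventually.of_forall fun ε => ?_
    refine hI.aestronglyMeasurable.indicator ?_
    exact measurableSet_le measurable_const (by fun_prop)
  · refine Eventually.of_forall fun ε => Eventually.of_forall fun v => ?_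
    refine (norm_indicator_le_norm_self _ _).trans (le_of_eq ?_)
    rw [Real.norm_of_nonneg (by positivity)]
  · refine Eventually.of_forall fun v => ?_
    refine tendsto_const_nhds.congr' ?_
    have h1 : Tendsto (fun ε : ℝ => ε * |v|) (𝓝[>] 0) (𝓝 0) := by
      have : Continuous fun ε : ℝ => ε * |v| := by fun_prop
      simpa using (this.tendsto 0).mono_left nhdsWithin_le_nhds
    filter_upwards [h1.eventually (gt_mem_nhds hδ)] with ε hε
    rw [indicator_of_notMem]
    simpa using hε

/-- Poisson averages of a continuous function with compact support converge uniformly. -/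
theorem exists_poisson_approx (hF : IsTest F) {η : ℝ} (hη : 0 < η) :
    ∀ᶠ ε in 𝓝[>] (0 : ℝ), ∀ s : ℝ,
      ‖(∫ v : ℝ, ((Real.pi⁻¹ * (1 + v ^ 2)⁻¹ : ℝ) : ℂ) * F (s + ε * v)) - F s‖ ≤ η := by
  obtain ⟨B, hB0, hB⟩ := hF.exists_bound
  have hU := hF.hasCompactSupport.uniformContinuous_of_continuous hF.cont
  obtain ⟨δ, hδ, hδ'⟩ := Metric.uniformContinuous_iff.1 hU (η / 2) (by positivity)
  have hI : Integrable fun v : ℝ => Real.pi⁻¹ * (1 + v ^ 2)⁻¹ :=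
    integrable_inv_one_add_sq.const_mul _
  have hI1 : ∫ v : ℝ, Real.pi⁻¹ * (1 + v ^ 2)⁻¹ = 1 := by
    rw [integral_const_mul, integral_univ_inv_one_add_sq, inv_mul_cancel₀ Real.pi_ne_zero]
  have htail := (tendsto_poisson_tail hδ).eventually (gt_mem_nhds
    (show 0 < η / (2 * (2 * B + 1)) by positivity))
  filter_upwards [htail, self_mem_nhdsWithin] with ε hε hε0 s
  have hε0' : 0 < ε := hε0
  have hFi : Integrable fun v : ℝ => ((Real.pi⁻¹ * (1 + v ^ 2)⁻¹ : ℝ) : ℂ) * F (s + ε * v) := by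
    have hm : Continuous fun v : ℝ => F (s + ε * v) := hF.cont.comp (by fun_prop)
    exact hI.ofReal.mul_bdd (c := B) hm.aestronglyMeasurable (Eventually.of_forall fun v => hB _)
  have hs : F s = ∫ v : ℝ, ((Real.pi⁻¹ * (1 + v ^ 2)⁻¹ : ℝ) : ℂ) * F s := by
    rw [integral_mul_const, integral_complex_ofReal, hI1]; simp
  have hsi : Integrable fun v : ℝ => ((Real.pi⁻¹ * (1 + v ^ 2)⁻¹ : ℝ) : ℂ) * F s :=
    hI.ofReal.mul_const _
  rw [hs, ← integral_sub hFi hsi]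
  have hmeas : MeasurableSet {v : ℝ | δ ≤ ε * |v|} :=
    measurableSet_le measurable_const (by fun_prop)
  have hbound : ∀ v : ℝ, ‖((Real.pi⁻¹ * (1 + v ^ 2)⁻¹ : ℝ) : ℂ) * F (s + ε * v) -
      ((Real.pi⁻¹ * (1 + v ^ 2)⁻¹ : ℝ) : ℂ) * F s‖ ≤ (η / 2) * (Real.pi⁻¹ * (1 + v ^ 2)⁻¹) +
      (2 * B) * {v : ℝ | δ ≤ ε * |v|}.indicator (fun v => Real.pi⁻¹ * (1 + v ^ 2)⁻¹) v := by
    intro v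
    rw [← mul_sub, norm_mul, Complex.norm_real, Real.norm_of_nonneg (by positivity)]
    by_cases hv : δ ≤ ε * |v|
    · rw [indicator_of_mem (by exact hv)]
      have : ‖F (s + ε * v) - F s‖ ≤ 2 * B :=
        (norm_sub_le _ _).trans (by linarith [hB (s + ε * v), hB s])
      have h0 : 0 ≤ Real.pi⁻¹ * (1 + v ^ 2)⁻¹ := by positivity
      nlinarith
    · rw [indicator_of_notMem (by exact hv)]
      push Not at hv
      have := hδ' (a := s + ε * v) (b := s) (by
        rw [Real.dist_eq, add_sub_cancel_left, abs_mul, abs_of_pos hε0']; exact hv)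
      rw [dist_eq_norm] at this
      have h0 : 0 ≤ Real.pi⁻¹ * (1 + v ^ 2)⁻¹ := by positivity
      nlinarith
  refine (norm_integral_le_of_norm_le ?_ (Eventually.of_forall hbound)).trans ?_
  · exact (hI.const_mul _).add ((hI.indicator hmeas).const_mul _)
  · rw [integral_add (hI.const_mul _) ((hI.indicator hmeas).const_mul _)]
    have h5 : (2 * B) * (η / (2 * (2 * B + 1))) ≤ η / 2 := by
      rw [mul_div_assoc', div_le_div_iff₀ (by positivity) (by positivity)]
      nlinarith
    have h6 : (2 * B) * ∫ v : ℝ, {v : ℝ | δ ≤ ε * |v|}.indicator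
        (fun v => Real.pi⁻¹ * (1 + v ^ 2)⁻¹) v ≤ (2 * B) * (η / (2 * (2 * B + 1))) := by
      gcongr
    have h7 : ∫ v : ℝ, (η / 2) * (Real.pi⁻¹ * (1 + v ^ 2)⁻¹) = η / 2 := by
      rw [integral_const_mul, hI1, mul_one]
    rw [h7, integral_const_mul]
    linarith

/-- The matrix element `⟪g, (H - w)⁻¹ f⟫` of the resolvent of `H = T⁻¹ - c`. -/
noncomputable def resElem (T : E →L[ℂ] E) (c : ℝ) (g f : E) (w : ℂ) : ℂ :=
  inner ℂ g (fcalc T (resSymbol c w) f)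

/-- The functional calculus commutes with the Poisson integral. -/
theorem fcalc_poisson (hT : T.IsPositive) (hF : IsTest F) {ε : ℝ} (hε : 0 < ε) :
    Integrable (fun x => fcalc T (fun r => F x * poissonSymbol c ε x r)) ∧
      fcalc T (fun r => ∫ x, F x * poissonSymbol c ε x r) =
        ∫ x, fcalc T (fun r => F x * poissonSymbol c ε x r) := by
  have hn : IsStarNormal T := hT.isSelfAdjoint.isStarNormal
  have hc1 : ContinuousOn (Function.uncurry fun (x : ℝ) (z : ℂ) => F x * poissonSymbol c ε x z.re)
      (univ ×ˢ spectrum ℂ T) := by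
    refine Continuous.continuousOn ?_
    exact (hF.cont.comp continuous_fst).mul ((continuous_poissonSymbol_uncurry hε).comp
      (continuous_fst.prodMk (Complex.continuous_re.comp continuous_snd)))
  have hb : ∀ᵐ x : ℝ, ∀ z ∈ spectrum ℂ T, ‖F x * poissonSymbol c ε x z.re‖ ≤ ‖F x‖ * ε⁻¹ :=
    Eventually.of_forall fun x z _ => by
      rw [norm_mul]; gcongr; exact norm_poissonSymbol_le hε x z.re
  have hi : Integrable fun x => ‖F x‖ * ε⁻¹ :=
    ((hF.cont.integrable_of_hasCompactSupport hF.hasCompactSupport).norm).mul_const _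
  exact ⟨integrable_cfc (fun (x : ℝ) (z : ℂ) => F x * poissonSymbol c ε x z.re) _ T hc1 hb hi.2,
    cfc_integral (fun (x : ℝ) (z : ℂ) => F x * poissonSymbol c ε x z.re) _ T hc1 hb hi.2⟩

theorem inner_fcalc_poissonSymbol (hT : T.IsPositive) {ε : ℝ} (hε : 0 < ε) (x : ℝ) (f g : E) :
    inner ℂ g (fcalc T (fun r => F x * poissonSymbol c ε x r) f) =
      F x * ((resElem T c g f (x + Complex.I * ε) -
        resElem T c g f (x + Complex.I * (-ε : ℝ))) / (2 * Real.pi * Complex.I)) := by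
  have h1 : ContinuousOn (resSymbol c (x + Complex.I * ε)) (Ici 0) :=
    ((continuous_resSymbol_uncurry hε.ne').comp
      (continuous_const.prodMk continuous_id : Continuous fun r : ℝ => (x, r))).continuousOn
  have h2 : ContinuousOn (resSymbol c (x + Complex.I * (-ε : ℝ))) (Ici 0) :=
    ((continuous_resSymbol_uncurry (ε := -ε) (by simpa using hε.ne')).comp
      (continuous_const.prodMk continuous_id : Continuous fun r : ℝ => (x, r))).continuousOn
  have e : (fun r => F x * poissonSymbol c ε x r) = fun r =>
      (F x / (2 * Real.pi * Complex.I)) * (resSymbol c (x + Complex.I * ε) r -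
        resSymbol c (x + Complex.I * (-ε : ℝ)) r) := by
    ext r; rw [poissonSymbol]; ring
  rw [e, fcalc_const_mul hT _ (F := fun r => resSymbol c (x + Complex.I * ε) r -
    resSymbol c (x + Complex.I * (-ε : ℝ)) r) (h1.sub h2), fcalc_sub hT h1 h2]
  simp only [smul_apply, sub_apply, inner_smul_right, inner_sub_right, resElem]
  ring

/-- **Stone's formula**: if the resolvent matrix element has locally bounded boundary values on
both sides of `(0, ∞)`, their difference `ρ` is the density of `F ↦ ⟪g, F(H) f⟫`. -/
theorem inner_energyCalc_eq_integral (hT : T.IsPositive) (hc : 0 < c) (f g : E) {ρ : ℝ → ℂ}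
    (hρ : ∀ x : ℝ, 0 < x → Tendsto (fun ε : ℝ => (resElem T c g f (x + Complex.I * ε) -
      resElem T c g f (x + Complex.I * (-ε : ℝ))) / (2 * Real.pi * Complex.I))
      (𝓝[>] 0) (𝓝 (ρ x)))
    (hb : ∀ a b : ℝ, 0 < a → ∃ B : ℝ, ∀ x ∈ Icc a b, ∀ ε ∈ Ioo (0 : ℝ) 1,
      ‖(resElem T c g f (x + Complex.I * ε) -
        resElem T c g f (x + Complex.I * (-ε : ℝ))) / (2 * Real.pi * Complex.I)‖ ≤ B)
    (hF : IsTest F) :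
    inner ℂ g (energyCalc T c F f) = ∫ x, F x * ρ x := by
  set D : ℝ → ℝ → ℂ := fun ε x => (resElem T c g f (x + Complex.I * ε) -
      resElem T c g f (x + Complex.I * (-ε : ℝ))) / (2 * Real.pi * Complex.I) with hD
  let Λ : (E →L[ℂ] E) →L[ℂ] ℂ := (innerSL ℂ g).comp (ContinuousLinearMap.apply ℂ E f)
  have hΛ : ∀ A : E →L[ℂ] E, Λ A = inner ℂ g (A f) := fun A => rfl
  have hstep : ∀ ε : ℝ, 0 < ε → Integrable (fun x => F x * D ε x) ∧
      inner ℂ g (fcalc T (fun r => ∫ x, F x * poissonSymbol c ε x r) f) = ∫ x, F x * D ε x := by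
    intro ε hε
    obtain ⟨h1, h2⟩ := fcalc_poisson (c := c) hT hF hε
    have h3 : ∀ x, Λ (fcalc T (fun r => F x * poissonSymbol c ε x r)) = F x * D ε x := fun x =>
      inner_fcalc_poissonSymbol hT hε x f g
    constructor
    · simpa only [h3] using Λ.integrable_comp h1
    · rw [h2, ← hΛ, ← Λ.integral_comp_comm h1]
      simp only [h3]
  -- The Poisson averages of `F` converge uniformly to `F`, so the corresponding operators converge
  -- in norm.
  have hlim1 : Tendsto (fun ε : ℝ => inner ℂ g
      (fcalc T (fun r => ∫ x, F x * poissonSymbol c ε x r) f)) (𝓝[>] 0)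
      (𝓝 (inner ℂ g (energyCalc T c F f))) := by
    have : Tendsto (fun ε : ℝ => fcalc T (fun r => ∫ x, F x * poissonSymbol c ε x r)) (𝓝[>] 0)
        (𝓝 (energyCalc T c F)) := by
      rw [Metric.tendsto_nhds]
      intro η hη
      filter_upwards [exists_poisson_approx hF (half_pos hη), self_mem_nhdsWithin] with ε hε hε0
      have hε0' : 0 < ε := hε0
      have hn : IsStarNormal T := hT.isSelfAdjoint.isStarNormal
      have hcont : ContinuousOn (fun r => ∫ x, F x * poissonSymbol c ε x r) (Ici 0) := by
        refine Continuous.continuousOn ?_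
        obtain ⟨B, hB0, hB⟩ := hF.exists_bound
        refine continuous_of_dominated (bound := fun x => ‖F x‖ * ε⁻¹)
          (fun r => ?_) (fun r => Eventually.of_forall fun x => ?_) ?_
          (Eventually.of_forall fun x => ?_)
        · exact (hF.cont.mul ((continuous_poissonSymbol_uncurry hε0').comp
            (continuous_id.prodMk continuous_const))).aestronglyMeasurable
        · rw [norm_mul]; gcongr; exact norm_poissonSymbol_le hε0' x r
        · exact ((hF.cont.integrable_of_hasCompactSupport hF.hasCompactSupport).norm).mul_const _
        · exact continuous_const.mul ((continuous_poissonSymbol_uncurry hε0').comp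
            (continuous_const.prodMk continuous_id))
      rw [dist_eq_norm, energyCalc, ← fcalc_sub hT hcont (hF.continuousOn_comp hc)]
      refine (norm_fcalc_le hT (by positivity) fun r hr => ?_).trans_lt (half_lt_self hη)
      by_cases h0 : r = 0
      · subst h0
        have : ∀ x, poissonSymbol c ε x 0 = 0 := fun x => by simp [poissonSymbol, resSymbol]
        simp [this, hF.eq_zero_of_nonpos (show -c ≤ 0 by linarith)]
        positivity
      · rw [integral_poissonSymbol_mul hε0' h0]
        exact hε _
    exact ((Λ.continuous.tendsto _).comp this)
  -- On the other side the jump converges boundedly on the support of `F`.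
  have hlim2 : Tendsto (fun ε : ℝ => ∫ x, F x * D ε x) (𝓝[>] 0) (𝓝 (∫ x, F x * ρ x)) := by
    obtain ⟨a, b, ha, hab⟩ := hF.supp
    obtain ⟨B, hB⟩ := hb a b ha
    refine tendsto_integral_filter_of_dominated_convergence (fun x => ‖F x‖ * B) ?_ ?_ ?_ ?_
    · filter_upwards [self_mem_nhdsWithin] with ε hε
      exact (hstep ε hε).1.aestronglyMeasurable
    · filter_upwards [Ioo_mem_nhdsGT (zero_lt_one (α := ℝ))] with ε hε
      refine Eventually.of_forall fun x => ?_
      by_cases hx : x ∈ Icc a b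
      · rw [norm_mul]; gcongr; exact hB x hx ε hε
      · simp [hab x hx]
    · exact ((hF.cont.integrable_of_hasCompactSupport hF.hasCompactSupport).norm).mul_const _
    · refine Eventually.of_forall fun x => ?_
      by_cases hx : 0 < x
      · exact (hρ x hx).const_mul _
      · simp only [hF.eq_zero_of_nonpos (not_lt.1 hx), zero_mul]
        exact tendsto_const_nhds
  refine tendsto_nhds_unique hlim1 (hlim2.congr' ?_)
  filter_upwards [self_mem_nhdsWithin] with ε hε
  exact (hstep ε hε).2.symm

end Energy

/-! ### The spectral subspace of the nonpositive energies -/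

/-- Piecewise linear cutoffs of the energy axis, increasing to the indicator of `(0, ∞)`. -/
noncomputable def cutoff (n : ℕ) (x : ℝ) : ℝ := max 0 (min 1 (min ((n + 1) * x - 1) (n + 2 - x)))

theorem cutoff_nonneg (n : ℕ) (x : ℝ) : 0 ≤ cutoff n x := le_max_left _ _

theorem cutoff_le_one (n : ℕ) (x : ℝ) : cutoff n x ≤ 1 := max_le zero_le_one (min_le_left _ _)

theorem continuous_cutoff (n : ℕ) : Continuous (cutoff n) := by unfold cutoff; fun_prop

theorem cutoff_eq_one {n : ℕ} {x : ℝ} (h1 : 2 ≤ (n + 1) * x) (h2 : x ≤ n + 1) :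
    cutoff n x = 1 := by
  rw [cutoff, min_eq_left (le_min (by linarith) (by linarith)), max_eq_right zero_le_one]

theorem cutoff_eq_zero {n : ℕ} {x : ℝ} (h : x ∉ Icc ((n + 1 : ℝ)⁻¹) (n + 2)) : cutoff n x = 0 := by
  rw [cutoff, max_eq_left]
  refine (min_le_right _ _).trans ?_
  by_cases h1 : (n + 1 : ℝ)⁻¹ ≤ x
  · have h2 : (n + 2 : ℝ) < x := by
      by_contra h2; exact h ⟨h1, not_lt.1 h2⟩
    exact (min_le_right _ _).trans (by linarith)
  · push Not at h1
    have : (n + 1 : ℝ) * x < 1 := by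
      have h3 : (0 : ℝ) < n + 1 := by positivity
      calc (n + 1 : ℝ) * x < (n + 1 : ℝ) * (n + 1 : ℝ)⁻¹ := by gcongr
        _ = 1 := mul_inv_cancel₀ h3.ne'
    exact (min_le_left _ _).trans (by linarith)

theorem eventually_cutoff_eq_one {a : ℝ} (ha : 0 < a) (b : ℝ) :
    ∀ᶠ n : ℕ in atTop, ∀ x ∈ Icc a b, cutoff n x = 1 := by
  filter_upwards [eventually_ge_atTop ⌈2 / a⌉₊, eventually_ge_atTop ⌈b⌉₊] with n h1 h2 x hx
  have h1' : 2 / a ≤ n := Nat.ceil_le.1 h1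
  have h2' : b ≤ n := Nat.ceil_le.1 h2
  rw [div_le_iff₀ ha] at h1'
  refine cutoff_eq_one ?_ (by linarith [hx.2])
  nlinarith [hx.1]

theorem isTest_cutoff (n : ℕ) : IsTest fun x => (cutoff n x : ℂ) :=
  ⟨Complex.continuous_ofReal.comp (continuous_cutoff n), (n + 1 : ℝ)⁻¹, n + 2, by positivity,
    fun x hx => by simp [cutoff_eq_zero hx]⟩

theorem isTest_cutoff_mul (n : ℕ) {G : ℝ → ℂ} (hG : ContinuousOn G (Ioi 0)) :
    IsTest fun x => (cutoff n x : ℂ) * G x :=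
  (isTest_cutoff n).mul_continuousOn hG

section Singular

variable {E : Type*} [NormedAddCommGroup E] [InnerProductSpace ℂ E] [CompleteSpace E]
  {T : E →L[ℂ] E} {c : ℝ} {F : ℝ → ℂ}

/-- The spectral subspace of `H = T⁻¹ - c` for `(-∞, 0]`: the vectors killed by all `F(H)` with
`F` supported in `(0, ∞)`. -/
noncomputable def nonposSpace (T : E →L[ℂ] E) (c : ℝ) : Submodule ℂ E :=
  ⨅ F : {F : ℝ → ℂ // IsTest F}, LinearMap.ker (energyCalc T c F.1 : E →ₗ[ℂ] E)

theorem mem_nonposSpace {v : E} :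
    v ∈ nonposSpace T c ↔ ∀ F, IsTest F → energyCalc T c F v = 0 := by
  simp [nonposSpace, Submodule.mem_iInf]

theorem isClosed_nonposSpace : IsClosed (nonposSpace T c : Set E) := by
  rw [nonposSpace, Submodule.coe_iInf]
  exact isClosed_iInter fun F => (energyCalc T c F.1).isClosed_ker

/-- The span of the ranges of the operators `F(H)` with `F` supported in `(0, ∞)`. -/
noncomputable def posRange (T : E →L[ℂ] E) (c : ℝ) : Submodule ℂ E :=
  Submodule.span ℂ {u | ∃ F f, IsTest F ∧ energyCalc T c F f = u}

theorem orthogonal_posRange : (posRange T c)ᗮ = nonposSpace T c := by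
  ext v
  rw [posRange, Submodule.mem_orthogonal, mem_nonposSpace]
  constructor
  · intro h F hF
    rw [← inner_self_eq_zero (𝕜 := ℂ), inner_energyCalc_left, ← inner_conj_symm,
      h _ (Submodule.subset_span ⟨_, _, hF.conj, rfl⟩), map_zero]
  · intro h u hu
    induction hu using Submodule.span_induction with
    | mem u hu =>
      obtain ⟨F, f, hF, rfl⟩ := hu
      rw [inner_energyCalc_left, h _ hF.conj, inner_zero_right]
    | zero => simp
    | add x y _ _ hx hy => rw [inner_add_left, hx, hy, add_zero]
    | smul a x _ hx => rw [inner_smul_left, hx, mul_zero]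

/-- The spectral subspace for `(0, ∞)`, as the closure of the ranges of the `F(H)`. -/
theorem orthogonal_nonposSpace : (nonposSpace T c)ᗮ = (posRange T c).topologicalClosure := by
  rw [← orthogonal_posRange, Submodule.orthogonal_orthogonal_eq_closure]

/-- The cutoffs of `H` increase strongly to the spectral projection for `(0, ∞)`. -/
theorem tendsto_energyCalc_cutoff (hT : T.IsPositive) (hc : 0 < c) (f : E) :
    Tendsto (fun n => energyCalc T c (fun x => (cutoff n x : ℂ)) f) atTop
      (𝓝 ((nonposSpace T c)ᗮ.starProjection f)) := by
  have hVc : CompleteSpace (nonposSpace T c) := isClosed_nonposSpace.completeSpace_coe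
  have hb : ∀ n : ℕ, ‖energyCalc T c (fun x => (cutoff n x : ℂ))‖ ≤ 1 := fun n =>
    norm_energyCalc_le hT zero_le_one fun x => by
      rw [Complex.norm_real, Real.norm_of_nonneg (cutoff_nonneg n x)]; exact cutoff_le_one n x
  have hd : Dense ((nonposSpace T c ⊔ posRange T c : Submodule ℂ E) : Set E) := by
    rw [Submodule.dense_iff_topologicalClosure_eq_top,
      Submodule.topologicalClosure_eq_top_iff, ← Submodule.inf_orthogonal, orthogonal_posRange,
      inf_comm, Submodule.inf_orthogonal_eq_bot]
  refine tendsto_apply_of_dense hb hd (fun f hf => ?_) f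
  obtain ⟨v, hv, u, hu, rfl⟩ := Submodule.mem_sup.1 hf
  have h1 : ∀ n : ℕ, energyCalc T c (fun x => (cutoff n x : ℂ)) v = 0 := fun n =>
    mem_nonposSpace.1 hv _ (isTest_cutoff n)
  have h2 : (nonposSpace T c)ᗮ.starProjection v = 0 := by
    rw [Submodule.starProjection_apply_eq_zero_iff]
    exact Submodule.le_orthogonal_orthogonal _ hv
  have h3 : (nonposSpace T c)ᗮ.starProjection u = u := by
    rw [Submodule.starProjection_eq_self_iff, orthogonal_nonposSpace]
    exact Submodule.le_topologicalClosure _ hu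
  simp only [map_add, h1, h2, h3, zero_add]
  clear h3 hf
  induction hu using Submodule.span_induction with
  | mem u hu =>
    obtain ⟨F, f, hF, rfl⟩ := hu
    obtain ⟨a, b, ha, hab⟩ := hF.supp
    refine tendsto_const_nhds.congr' ?_
    filter_upwards [eventually_cutoff_eq_one ha b] with n hn
    rw [← energyCalc_mul hT hc (isTest_cutoff n) hF]
    congr 2
    ext x
    by_cases hx : x ∈ Icc a b
    · simp [hn x hx]
    · simp [hab x hx]
  | zero => simp
  | add x y _ _ hx hy => simpa only [map_add] using hx.add hy
  | smul a x _ hx => simpa only [map_smul] using hx.const_smul a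

theorem nonposSpace_invariant (hT : T.IsPositive) (hc : 0 < c) {v : E}
    (hv : v ∈ nonposSpace T c) : T v ∈ nonposSpace T c := by
  rw [mem_nonposSpace] at hv ⊢
  intro F hF
  rw [← energyCalc_comm hT hc hF, hv F hF, map_zero]

/-- On the nonpositive spectral subspace `T ≥ 1/c`: the part of `T` below `1/c` vanishes there. -/
theorem fcalc_max_eq_zero (hT : T.IsPositive) (hinj : Function.Injective T) (hc : 0 < c) {v : E}
    (hv : v ∈ nonposSpace T c) : fcalc T (fun r => ((max 0 (c⁻¹ - r) : ℝ) : ℂ)) v = 0 := by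
  have hq : ContinuousOn (fun r : ℝ => ((max 0 (c⁻¹ - r) : ℝ) : ℂ)) (Ici 0) := by fun_prop
  have hrq : ContinuousOn (fun r : ℝ => (r : ℂ) * ((max 0 (c⁻¹ - r) : ℝ) : ℂ)) (Ici 0) := by
    fun_prop
  apply hinj
  rw [map_zero]
  have h1 := fcalc_mul_apply hT continuousOn_ofReal_Ici hq v
  rw [fcalc_ofReal hT] at h1
  rw [← h1]
  -- The symbol vanishes at both ends of `[0, 1/c]`, so cutting off costs only `O(1/n)`.
  have hbound : ∀ n : ℕ, ‖fcalc T (fun r : ℝ => (r : ℂ) * ((max 0 (c⁻¹ - r) : ℝ) : ℂ)) v‖ ≤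
      (2 / c ^ 3 + 1 / c) * (1 / ((n : ℝ) + 1)) * ‖v‖ := by
    intro n
    have hcut := (isTest_cutoff n).continuousOn_comp hc
    have h2 : fcalc T (fun r : ℝ => ((r : ℂ) * ((max 0 (c⁻¹ - r) : ℝ) : ℂ)) *
        (cutoff n (r⁻¹ - c) : ℂ)) v = 0 := by
      rw [fcalc_mul_apply hT hrq hcut]
      have := mem_nonposSpace.1 hv _ (isTest_cutoff n)
      rw [energyCalc] at this
      rw [this, map_zero]
    rw [← sub_zero (fcalc T _ v), ← h2, ← sub_apply, ← fcalc_sub hT hrq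
      (G := fun r : ℝ => ((r : ℂ) * ((max 0 (c⁻¹ - r) : ℝ) : ℂ)) * (cutoff n (r⁻¹ - c) : ℂ))
      (hrq.mul hcut)]
    refine (ContinuousLinearMap.le_opNorm _ _).trans ?_
    gcongr
    refine norm_fcalc_le hT (by positivity) fun r hr => ?_
    have hn : (0 : ℝ) < n + 1 := by positivity
    rw [show (r : ℂ) * ((max 0 (c⁻¹ - r) : ℝ) : ℂ) - (r : ℂ) * ((max 0 (c⁻¹ - r) : ℝ) : ℂ) *
      (cutoff n (r⁻¹ - c) : ℂ) = ((r * max 0 (c⁻¹ - r) * (1 - cutoff n (r⁻¹ - c)) : ℝ) : ℂ) by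
        push_cast; ring, Complex.norm_real, Real.norm_of_nonneg (mul_nonneg (mul_nonneg hr
        (le_max_left _ _)) (by linarith [cutoff_le_one n (r⁻¹ - c)]))]
    by_cases hr0 : r = 0
    · subst hr0; simp; positivity
    have hr' : 0 < r := lt_of_le_of_ne hr (Ne.symm hr0)
    by_cases hrc : c⁻¹ ≤ r
    · rw [max_eq_left (by linarith)]; simp; positivity
    push Not at hrc
    rw [max_eq_right (by linarith)]
    by_cases h3 : cutoff n (r⁻¹ - c) = 1
    · rw [h3]; simp; positivity
    have h4 : r * (c⁻¹ - r) * (1 - cutoff n (r⁻¹ - c)) ≤ r * (c⁻¹ - r) :=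
      mul_le_of_le_one_right (mul_nonneg hr (by linarith)) (by linarith [cutoff_nonneg n (r⁻¹ - c)])
    refine h4.trans ?_
    have h5 : (n + 1) * (r⁻¹ - c) < 2 ∨ n + 1 < r⁻¹ - c := by
      by_contra! h5
      exact h3 (cutoff_eq_one h5.1 h5.2)
    have h6 : r * (c⁻¹ - r) = r ^ 2 / c * (r⁻¹ - c) := by field_simp
    have h9 : r ≤ 1 / c := by rw [one_div]; exact hrc.le
    rcases h5 with h5 | h5
    · have h7 : r⁻¹ - c ≤ 2 * (1 / ((n : ℝ) + 1)) := by
        rw [mul_one_div, le_div_iff₀ hn]; linarith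
      calc r * (c⁻¹ - r) = r ^ 2 / c * (r⁻¹ - c) := h6
        _ ≤ (1 / c) ^ 2 / c * (2 * (1 / ((n : ℝ) + 1))) := by
            have : 0 < r⁻¹ - c := by
              rw [sub_pos]; exact (lt_inv_comm₀ hc hr').2 hrc
            gcongr
        _ = 2 / c ^ 3 * (1 / ((n : ℝ) + 1)) := by field_simp
        _ ≤ _ := by gcongr; exact le_add_of_nonneg_right (by positivity)
    · have h7 : r ≤ 1 / ((n : ℝ) + 1) := by
        rw [one_div, le_inv_comm₀ hr' hn]; linarith
      calc r * (c⁻¹ - r) ≤ 1 / ((n : ℝ) + 1) * (1 / c) := by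
            have h8 : c⁻¹ - r ≤ 1 / c := by rw [one_div]; linarith
            have : 0 ≤ c⁻¹ - r := by linarith
            gcongr
        _ ≤ _ := by
            rw [mul_comm]; gcongr; exact le_add_of_nonneg_left (by positivity)
  have hlim : Tendsto (fun n : ℕ => (2 / c ^ 3 + 1 / c) * (1 / ((n : ℝ) + 1)) * ‖v‖) atTop (𝓝 0) := by
    have := (tendsto_one_div_add_atTop_nhds_zero_nat (𝕜 := ℝ)).const_mul (2 / c ^ 3 + 1 / c)
    simpa using this.mul_const ‖v‖
  exact norm_le_zero_iff.1 (ge_of_tendsto' hlim hbound)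

/-- `H ≤ 0` on its nonpositive spectral subspace, as a bound on the form of `T = (H + c)⁻¹`. -/
theorem le_re_inner_of_mem_nonposSpace (hT : T.IsPositive) (hinj : Function.Injective T)
    (hc : 0 < c) {v : E} (hv : v ∈ nonposSpace T c) :
    c⁻¹ * ‖v‖ ^ 2 ≤ (inner ℂ v (T v)).re := by
  have hm : ContinuousOn (fun r : ℝ => r - c⁻¹ + max 0 (c⁻¹ - r)) (Ici 0) := by fun_prop
  have h := re_inner_fcalc_nonneg hT hm (fun r _ => by
    rcases le_total 0 (c⁻¹ - r) with h | h
    · rw [max_eq_right h]; linarith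
    · rw [max_eq_left h]; linarith) v
  have e : fcalc T (fun r : ℝ => ((r - c⁻¹ + max 0 (c⁻¹ - r) : ℝ) : ℂ)) v =
      T v - ((c⁻¹ : ℝ) : ℂ) • v := by
    have : (fun r : ℝ => ((r - c⁻¹ + max 0 (c⁻¹ - r) : ℝ) : ℂ)) = fun r : ℝ =>
      ((r : ℂ) - ((c⁻¹ : ℝ) : ℂ)) + ((max 0 (c⁻¹ - r) : ℝ) : ℂ) := by ext r; push_cast; ring
    rw [this, fcalc_add hT (F := fun r : ℝ => (r : ℂ) - ((c⁻¹ : ℝ) : ℂ)) (by fun_prop) (by fun_prop),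
      fcalc_sub hT continuousOn_ofReal_Ici continuousOn_const, fcalc_ofReal hT, fcalc_const hT,
      add_apply, fcalc_max_eq_zero hT hinj hc hv]
    simp
  rw [e, inner_sub_right, inner_smul_right, inner_self_eq_norm_sq_to_K] at h
  have h2 : (((c⁻¹ : ℝ) : ℂ) * ((‖v‖ : ℂ) ^ 2)).re = c⁻¹ * ‖v‖ ^ 2 := by
    rw [← Complex.ofReal_pow, ← Complex.ofReal_mul, Complex.ofReal_re]
  rw [Complex.sub_re] at h
  have h3 : (((c⁻¹ : ℝ) : ℂ) * ((RCLike.ofReal ‖v‖ : ℂ) ^ 2)).re = c⁻¹ * ‖v‖ ^ 2 := h2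
  rw [h3] at h
  linarith

/-- If the quadratic form of `T` is `< 1/c` off a finite-dimensional space, the spectral subspace of
`H = T⁻¹ - c` for `(-∞, 0]` is finite-dimensional. -/
theorem finiteDimensional_nonposSpace (hT : T.IsPositive) (hinj : Function.Injective T)
    (hc : 0 < c) {W : Submodule ℂ E} [FiniteDimensional ℂ W]
    (hW : ∀ v ∈ Wᗮ, v ≠ 0 → (inner ℂ v (T v)).re < c⁻¹ * ‖v‖ ^ 2) :
    FiniteDimensional ℂ (nonposSpace T c) := by
  let L : nonposSpace T c →ₗ[ℂ] W :=
    (W.orthogonalProjectionOnto : E →ₗ[ℂ] W).comp (nonposSpace T c).subtype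
  refine FiniteDimensional.of_injective L ?_
  rw [← LinearMap.ker_eq_bot, Submodule.eq_bot_iff]
  intro v hv
  have h1 : (v : E) ∈ Wᗮ := by
    have : W.orthogonalProjectionOnto (v : E) = 0 := hv
    rwa [← Submodule.ker_orthogonalProjectionOnto]
  by_contra hne
  have h2 := hW v h1 (by simpa using hne)
  exact absurd (le_re_inner_of_mem_nonposSpace hT hinj hc v.2) (not_le.2 h2)

/-- A vector orthogonal to all eigenvectors of `H` with eigenvalue in `(-∞, 0]` is orthogonal to the
corresponding spectral subspace, when the latter is finite-dimensional. -/
theorem mem_orthogonal_nonposSpace (hT : T.IsPositive) (hinj : Function.Injective T) (hc : 0 < c)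
    [FiniteDimensional ℂ (nonposSpace T c)] {f : E}
    (hf : ∀ v : E, v ≠ 0 → v ∈ nonposSpace T c → ∀ m : ℝ, c⁻¹ ≤ m → T v = (m : ℂ) • v →
      inner ℂ v f = 0) : f ∈ (nonposSpace T c)ᗮ := by
  set V := nonposSpace T c with hV
  have hinv : ∀ v ∈ V, (T : E →ₗ[ℂ] E) v ∈ V := fun v hv => nonposSpace_invariant hT hc hv
  have hsym := (hT.isSelfAdjoint.isSymmetric).restrict_invariant hinv
  have hbot := hsym.orthogonalComplement_iSup_eigenspaces_eq_bot
  have hmem : V.orthogonalProjectionOnto f ∈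
      (⨆ μ, Module.End.eigenspace ((T : E →ₗ[ℂ] E).restrict hinv) μ)ᗮ := by
    rw [Submodule.mem_orthogonal]
    intro u hu
    refine Submodule.iSup_induction _ (motive := fun u => inner ℂ u (V.orthogonalProjectionOnto f) = 0)
      hu ?_ ?_ ?_
    · intro μ v hv
      by_cases hv0 : v = 0
      · simp [hv0]
      have hv0' : (v : E) ≠ 0 := by simpa using hv0
      have h1 : T v = μ • (v : E) := by
        have := congrArg Subtype.val (Module.End.mem_eigenspace_iff.1 hv)
        exact this
      have hreal : (μ.re : ℂ) = μ := by
        have h2 : inner ℂ (T (v : E)) (v : E) = inner ℂ (v : E) (T v) :=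
          hT.isSelfAdjoint.isSymmetric v v
        rw [h1, inner_smul_left, inner_smul_right] at h2
        have h3 := mul_right_cancel₀ (inner_self_ne_zero.2 hv0') h2
        exact Complex.conj_eq_iff_re.1 h3
      have hge : c⁻¹ ≤ μ.re := by
        have h2 := le_re_inner_of_mem_nonposSpace hT hinj hc v.2
        rw [h1, inner_smul_right, inner_self_eq_norm_sq_to_K, ← hreal] at h2
        have h3 : ((μ.re : ℂ) * (RCLike.ofReal ‖(v : E)‖ : ℂ) ^ 2).re = μ.re * ‖(v : E)‖ ^ 2 := by
          show ((μ.re : ℂ) * ((‖(v : E)‖ : ℝ) : ℂ) ^ 2).re = _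
          rw [← Complex.ofReal_pow, ← Complex.ofReal_mul, Complex.ofReal_re]
        rw [h3] at h2
        exact le_of_mul_le_mul_right h2 (by positivity)
      have h4 := hf v hv0' v.2 μ.re hge (by rw [h1, hreal])
      rw [Submodule.coe_inner, ← V.starProjection_apply,
        ← V.inner_starProjection_left_eq_right, V.starProjection_eq_self_iff.2 v.2]
      exact h4
    · simp
    · intro x y hx hy; rw [inner_add_left, hx, hy, add_zero]
  rw [hbot, Submodule.mem_bot] at hmem
  rwa [← Submodule.ker_orthogonalProjectionOnto, LinearMap.mem_ker]

theorem inner_fcalc_nonneg (hT : T.IsPositive) {F : ℝ → ℝ} (hF : ContinuousOn F (Ici 0))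
    (h : ∀ r, 0 ≤ r → 0 ≤ F r) (f : E) : 0 ≤ inner ℂ f (fcalc T (fun r => (F r : ℂ)) f) := by
  have him : (inner ℂ f (fcalc T (fun r => (F r : ℂ)) f)).im = 0 := by
    have h2 := inner_fcalc_left (T := T) (fun r => (F r : ℂ)) f f
    simp only [Complex.conj_ofReal] at h2
    rw [← inner_conj_symm] at h2
    exact Complex.conj_eq_iff_im.1 h2
  rw [Complex.le_def]
  exact ⟨re_inner_fcalc_nonneg hT hF h f, him.symm⟩

end Singular

section Density

variable {E : Type*} [NormedAddCommGroup E] [InnerProductSpace ℂ E] [CompleteSpace E]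
  {T : E →L[ℂ] E} {c : ℝ} {F : ℝ → ℂ} {f g : E} {ρ : ℝ → ℂ}

/-- The jump of the resolvent matrix element `⟪g, (H - w)⁻¹ f⟫`, `H = T⁻¹ - c`, across `(0, ∞)` is
the continuous function `2πi ρ`, with locally uniform bounds. -/
structure IsDensity (T : E →L[ℂ] E) (c : ℝ) (g f : E) (ρ : ℝ → ℂ) : Prop where
  cont : ContinuousOn ρ (Ioi 0)
  lim : ∀ x : ℝ, 0 < x → Tendsto (fun ε : ℝ => (resElem T c g f (x + Complex.I * ε) -
      resElem T c g f (x + Complex.I * (-ε : ℝ))) / (2 * Real.pi * Complex.I))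
      (𝓝[>] 0) (𝓝 (ρ x))
  bound : ∀ a b : ℝ, 0 < a → ∃ B : ℝ, ∀ x ∈ Icc a b, ∀ ε ∈ Ioo (0 : ℝ) 1,
      ‖(resElem T c g f (x + Complex.I * ε) -
        resElem T c g f (x + Complex.I * (-ε : ℝ))) / (2 * Real.pi * Complex.I)‖ ≤ B

theorem IsDensity.inner_eq (h : IsDensity T c g f ρ) (hT : T.IsPositive) (hc : 0 < c)
    (hF : IsTest F) : inner ℂ g (energyCalc T c F f) = ∫ x, F x * ρ x :=
  inner_energyCalc_eq_integral hT hc f g h.lim h.bound hF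

/-- Diagonal densities are nonnegative, since the Poisson symbol is. -/
theorem IsDensity.nonneg (h : IsDensity T c f f ρ) (hT : T.IsPositive) {x : ℝ} (hx : 0 < x) :
    0 ≤ ρ x := by
  refine ge_of_tendsto (h.lim x hx) ?_
  filter_upwards [self_mem_nhdsWithin] with ε hε
  have hε' : 0 < ε := hε
  have h1 := inner_fcalc_poissonSymbol (F := fun _ => 1) (c := c) hT hε' x f f
  simp only [one_mul] at h1
  rw [← h1]
  have hcont : ContinuousOn (fun r => (poissonSymbol c ε x r).re) (Ici 0) :=
    (Complex.continuous_re.comp ((continuous_poissonSymbol_uncurry hε').comp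
      (continuous_const.prodMk continuous_id : Continuous fun r : ℝ => (x, r)))).continuousOn
  have h2 : ∀ r, ((poissonSymbol c ε x r).re : ℂ) = poissonSymbol c ε x r ∧
      0 ≤ (poissonSymbol c ε x r).re := by
    intro r
    by_cases hr : r = 0
    · subst hr; simp [poissonSymbol, resSymbol]
    · rw [poissonSymbol_eq hε' hr, Complex.ofReal_re]
      exact ⟨rfl, by positivity⟩
  rw [← fcalc_congr hT fun r _ => (h2 r).1]
  exact inner_fcalc_nonneg hT hcont (fun r _ => (h2 r).2) f

/-- Spectral densities have total variation at most `‖g‖ ‖f‖`. -/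
theorem IsDensity.integrableOn (h : IsDensity T c g f ρ) (hT : T.IsPositive) (hc : 0 < c) :
    IntegrableOn ρ (Ioi 0) := by
  -- Testing against `cutoff n * conj ρ / (|ρ| + δ)` gives the bound on the total variation.
  have key : ∀ n : ℕ, ∫⁻ x in Ioi (0 : ℝ), ENNReal.ofReal (cutoff n x * (‖ρ x‖ ^ 2 /
      (‖ρ x‖ + 1 / ((n : ℝ) + 1)))) ≤ ENNReal.ofReal (‖g‖ * ‖f‖) := by
    intro n
    have hpos : ∀ x, 0 < ‖ρ x‖ + 1 / ((n : ℝ) + 1) := fun x => by positivity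
    set G : ℝ → ℂ := fun x => starRingEnd ℂ (ρ x) / ((‖ρ x‖ + 1 / ((n : ℝ) + 1) : ℝ) : ℂ) with hG
    have hGc : ContinuousOn G (Ioi 0) := by
      refine (Complex.continuous_conj.comp_continuousOn h.cont).div
        (Complex.continuous_ofReal.comp_continuousOn (h.cont.norm.add continuousOn_const)) ?_
      intro x _
      exact_mod_cast (hpos x).ne'
    have hG1 : ∀ x, ‖G x‖ ≤ 1 := by
      intro x
      rw [hG]
      simp only [norm_div, RCLike.norm_conj, Complex.norm_real, Real.norm_of_nonneg (hpos x).le]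
      rw [div_le_one (hpos x)]
      exact le_add_of_nonneg_right (by positivity)
    have hF := isTest_cutoff_mul n hGc
    have h1 := h.inner_eq hT hc hF
    have e : ∀ x, (cutoff n x : ℂ) * G x * ρ x = ((cutoff n x * (‖ρ x‖ ^ 2 /
      (‖ρ x‖ + 1 / ((n : ℝ) + 1))) : ℝ) : ℂ) := by
      intro x
      have : ((‖ρ x‖ ^ 2 : ℝ) : ℂ) = starRingEnd ℂ (ρ x) * ρ x := by
        rw [mul_comm, Complex.mul_conj, Complex.normSq_eq_norm_sq]
      rw [Complex.ofReal_mul, Complex.ofReal_div, this, hG]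
      ring
    simp only [e] at h1
    rw [integral_complex_ofReal] at h1
    have hint : Integrable (fun x => cutoff n x * (‖ρ x‖ ^ 2 / (‖ρ x‖ + 1 / ((n : ℝ) + 1)))) := by
      have hF2 : IsTest fun x => (cutoff n x : ℂ) * (G x * ρ x) :=
        isTest_cutoff_mul n (hGc.mul h.cont)
      have := (hF2.cont.integrable_of_hasCompactSupport (μ := volume) hF2.hasCompactSupport).re
      refine this.congr (Eventually.of_forall fun x => ?_)
      show ((cutoff n x : ℂ) * (G x * ρ x)).re = _
      rw [← mul_assoc, e, Complex.ofReal_re]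
    have hnn : ∀ x, 0 ≤ cutoff n x * (‖ρ x‖ ^ 2 / (‖ρ x‖ + 1 / ((n : ℝ) + 1))) := fun x =>
      mul_nonneg (cutoff_nonneg n x) (div_nonneg (by positivity) (hpos x).le)
    calc _ ≤ ∫⁻ x, ENNReal.ofReal (cutoff n x * (‖ρ x‖ ^ 2 / (‖ρ x‖ + 1 / ((n : ℝ) + 1)))) :=
          setLIntegral_le_lintegral _ _
      _ = ENNReal.ofReal (∫ x, cutoff n x * (‖ρ x‖ ^ 2 / (‖ρ x‖ + 1 / ((n : ℝ) + 1)))) :=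
          (ofReal_integral_eq_lintegral_ofReal hint (Eventually.of_forall hnn)).symm
      _ ≤ _ := by
          refine ENNReal.ofReal_le_ofReal ?_
          have h2 : ‖inner ℂ g (energyCalc T c (fun x => (cutoff n x : ℂ) * G x) f)‖ ≤
              ‖g‖ * ‖f‖ := by
            refine (norm_inner_le_norm _ _).trans ?_
            gcongr
            refine (ContinuousLinearMap.le_of_opNorm_le _ (norm_energyCalc_le hT zero_le_one
              fun x => ?_) f).trans (by rw [one_mul])
            rw [norm_mul, Complex.norm_real, Real.norm_of_nonneg (cutoff_nonneg n x)]
            exact mul_le_one₀ (cutoff_le_one n x) (norm_nonneg _) (hG1 x)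
          rw [h1, Complex.norm_real] at h2
          exact (le_abs_self _).trans h2
  have hm : AEStronglyMeasurable ρ (volume.restrict (Ioi 0)) :=
    h.cont.aestronglyMeasurable measurableSet_Ioi
  refine ⟨hm, ?_⟩
  have hlim : ∀ x ∈ Ioi (0 : ℝ), Tendsto (fun n : ℕ => ENNReal.ofReal (cutoff n x * (‖ρ x‖ ^ 2 /
      (‖ρ x‖ + 1 / ((n : ℝ) + 1))))) atTop (𝓝 ‖ρ x‖ₑ) := by
    intro x hx
    rw [← ofReal_norm]
    refine (ENNReal.continuous_ofReal.tendsto _).comp ?_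
    have h1 : Tendsto (fun n : ℕ => cutoff n x) atTop (𝓝 1) :=
      tendsto_const_nhds.congr' ((eventually_cutoff_eq_one hx x).mono fun n hn =>
        (hn x ⟨le_rfl, le_rfl⟩).symm)
    by_cases h0 : ‖ρ x‖ = 0
    · simp [h0]
    have h2 : Tendsto (fun n : ℕ => ‖ρ x‖ ^ 2 / (‖ρ x‖ + 1 / ((n : ℝ) + 1))) atTop
        (𝓝 (‖ρ x‖ ^ 2 / (‖ρ x‖ + 0))) :=
      tendsto_const_nhds.div (tendsto_const_nhds.add tendsto_one_div_add_atTop_nhds_zero_nat)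
        (by simpa using h0)
    have h3 := h1.mul h2
    have h4 : ‖ρ x‖ ^ 2 / (‖ρ x‖ + 0) = ‖ρ x‖ := by
      rw [add_zero, sq, mul_div_assoc, div_self h0, mul_one]
    rwa [one_mul, h4] at h3
  have hmn : ∀ n : ℕ, AEMeasurable (fun x => ENNReal.ofReal (cutoff n x * (‖ρ x‖ ^ 2 /
      (‖ρ x‖ + 1 / ((n : ℝ) + 1))))) (volume.restrict (Ioi (0 : ℝ))) := fun n => by
    have := hm.norm.aemeasurable
    exact (((continuous_cutoff n).measurable.aemeasurable).mul
      ((this.pow_const 2).div (this.add_const _))).ennreal_ofReal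
  have hfatou := lintegral_liminf_le' (u := atTop) hmn
  rw [HasFiniteIntegral]
  calc ∫⁻ x in Ioi (0 : ℝ), ‖ρ x‖ₑ = ∫⁻ x in Ioi (0 : ℝ), liminf (fun n : ℕ =>
        ENNReal.ofReal (cutoff n x * (‖ρ x‖ ^ 2 / (‖ρ x‖ + 1 / ((n : ℝ) + 1))))) atTop :=
        setLIntegral_congr_fun measurableSet_Ioi fun x hx => (hlim x hx).liminf_eq.symm
    _ ≤ _ := hfatou
    _ ≤ ENNReal.ofReal (‖g‖ * ‖f‖) := by
        have := liminf_le_liminf (f := atTop) (Eventually.of_forall key)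
        exact this.trans (by simp)
    _ < ∞ := ENNReal.ofReal_lt_top

/-- The spectral representation of the group on the positive spectral subspace. -/
theorem IsDensity.inner_invGroup (h : IsDensity T c g f ρ) (hT : T.IsPositive)
    (hinj : Function.Injective T) (hc : 0 < c) (t : ℝ) :
    inner ℂ g (invGroup T c t ((nonposSpace T c)ᗮ.starProjection f)) =
      ∫ x in Ioi (0 : ℝ), Complex.exp (Complex.I * (t : ℂ) * (x : ℂ)) * ρ x := by
  have hexp : Continuous fun x : ℝ => Complex.exp (Complex.I * (t : ℂ) * (x : ℂ)) := by fun_prop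
  have h1 : Tendsto (fun n : ℕ => inner ℂ g (invGroup T c t
      (energyCalc T c (fun x => (cutoff n x : ℂ)) f))) atTop
      (𝓝 (inner ℂ g (invGroup T c t ((nonposSpace T c)ᗮ.starProjection f)))) := by
    have : Continuous fun u => inner ℂ g (invGroup T c t u) := by fun_prop
    exact (this.tendsto _).comp (tendsto_energyCalc_cutoff hT hc f)
  have h2 : ∀ n : ℕ, inner ℂ g (invGroup T c t (energyCalc T c (fun x => (cutoff n x : ℂ)) f)) =
      ∫ x in Ioi (0 : ℝ), Complex.exp (Complex.I * (t : ℂ) * (x : ℂ)) * cutoff n x * ρ x := by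
    intro n
    rw [invGroup_energyCalc hT hinj hc (isTest_cutoff n),
      h.inner_eq hT hc ((isTest_cutoff n).mul hexp)]
    refine (setIntegral_eq_integral_of_forall_compl_eq_zero fun x hx => ?_).symm
    rw [(isTest_cutoff n).eq_zero_of_nonpos (not_lt.1 hx)]; simp
  simp only [h2] at h1
  refine tendsto_nhds_unique h1 ?_
  have hi := h.integrableOn hT hc
  have hn : ∀ x : ℝ, ‖Complex.exp (Complex.I * (t : ℂ) * (x : ℂ))‖ = 1 := fun x => by
    rw [mul_assoc, mul_comm, ← Complex.ofReal_mul, Complex.norm_exp_ofReal_mul_I]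
  refine tendsto_integral_of_dominated_convergence (fun x => ‖ρ x‖) ?_ hi.norm ?_ ?_
  · intro n
    exact (hexp.mul (Complex.continuous_ofReal.comp
      (continuous_cutoff n))).aestronglyMeasurable.mul hi.aestronglyMeasurable
  · intro n
    refine Eventually.of_forall fun x => ?_
    rw [norm_mul, norm_mul, hn, one_mul, Complex.norm_real,
      Real.norm_of_nonneg (cutoff_nonneg n x)]
    exact mul_le_of_le_one_left (norm_nonneg _) (cutoff_le_one n x)
  · refine (ae_restrict_iff' measurableSet_Ioi).2 (Eventually.of_forall fun x hx => ?_)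
    refine tendsto_const_nhds.congr' ((eventually_cutoff_eq_one hx x).mono fun n hn' => ?_)
    simp only [hn' x ⟨le_rfl, le_rfl⟩, Complex.ofReal_one, mul_one]

end Density

/-! ### The absolutely continuous subspace -/

theorem IsUnitaryGroupOf.inner_map {A : Set (L2 × L2)} {U : ℝ → L2 →L[ℂ] L2}
    (hU : IsUnitaryGroupOf A U) (t : ℝ) (f g : L2) : inner ℂ (U t f) (U t g) = inner ℂ f g :=
  (⟨(U t : L2 →ₗ[ℂ] L2), hU.norm_map t⟩ : L2 →ₗᵢ[ℂ] L2).inner_map_map f g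

/-- Riemann–Lebesgue: the autocorrelation of an absolutely continuous vector decays. -/
theorem tendsto_inner_of_isSpectralMeasure {U : ℝ → L2 →L[ℂ] L2} {f : L2} {μ : Measure ℝ}
    (h : IsSpectralMeasure U f μ) (hμ : μ ≪ volume) :
    Tendsto (fun t => inner ℂ f (U t f)) atTop (𝓝 0) := by
  have hfin := h.1
  have h1 : Tendsto (fun t : ℝ => -(2 * Real.pi)⁻¹ * t) atTop (cocompact ℝ) := by
    refine Tendsto.mono_right ?_ (atBot_le_cocompact (α := ℝ))
    exact tendsto_id.const_mul_atTop_of_neg (by simp [Real.pi_pos])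
  refine ((Real.tendsto_integral_exp_smul_cocompact
    (fun x => ((μ.rnDeriv volume x).toReal : ℂ))).comp h1).congr fun t => ?_
  rw [h.2 t, ← integral_rnDeriv_smul hμ]
  refine integral_congr_ae (Eventually.of_forall fun x => ?_)
  simp only [Circle.smul_def, Real.fourierChar_apply]
  rw [smul_eq_mul, Complex.real_smul, mul_comm]
  congr 2
  have : (Real.pi : ℂ) ≠ 0 := by exact_mod_cast Real.pi_ne_zero
  push_cast
  field_simp

/-- A vector with decaying autocorrelation converges weakly to zero along the group. -/
theorem IsUnitaryGroupOf.tendsto_inner {A : Set (L2 × L2)} {U : ℝ → L2 →L[ℂ] L2}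
    (hU : IsUnitaryGroupOf A U) {f : L2} (hf : Tendsto (fun t => inner ℂ f (U t f)) atTop (𝓝 0))
    (h : L2) : Tendsto (fun t => inner ℂ (U t f) h) atTop (𝓝 0) := by
  set S : Submodule ℂ L2 := Submodule.span ℂ (range fun s => U s f) with hS
  have hd : Dense ((S ⊔ Sᗮ : Submodule ℂ L2) : Set L2) := by
    rw [Submodule.dense_iff_topologicalClosure_eq_top, Submodule.topologicalClosure_eq_top_iff,
      ← Submodule.inf_orthogonal, Submodule.inf_orthogonal_eq_bot]
  have key := tendsto_apply_of_dense (l := (atTop : Filter ℝ)) (A := fun t => innerSL ℂ (U t f))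
    (B := 0) (C := ‖f‖) (fun t => by rw [innerSL_apply_norm, hU.norm_map]) hd (fun u hu => ?_) h
  · simpa using key
  obtain ⟨v, hv, w, hw, rfl⟩ := Submodule.mem_sup.1 hu
  have hw0 : ∀ t, inner ℂ (U t f) w = 0 := fun t =>
    (Submodule.mem_orthogonal _ _).1 hw _ (Submodule.subset_span ⟨t, rfl⟩)
  simp only [innerSL_apply_apply, zero_apply, inner_add_right, hw0, add_zero]
  clear hu hw
  induction hv using Submodule.span_induction with
  | mem v hv =>
    obtain ⟨s, rfl⟩ := hv
    have h1 := (hf.comp (tendsto_atTop_add_const_right atTop (-s) tendsto_id)).star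
    rw [star_zero] at h1
    refine h1.congr fun t => ?_
    have h2 := hU.inner_map s f (U (t + -s) f)
    rw [← ContinuousLinearMap.comp_apply, ← hU.map_add, add_comm s, neg_add_cancel_right] at h2
    simp only [Function.comp_apply, id]
    rw [← h2]
    exact inner_conj_symm _ _
  | zero => simp
  | add x y _ _ hx hy => simpa only [inner_add_right, add_zero] using hx.add hy
  | smul a x _ hx => simpa only [inner_smul_right, mul_zero] using hx.const_mul a

theorem IsUnitaryGroupOf.apply_of_eigenvector {A : Set (L2 × L2)} {U : ℝ → L2 →L[ℂ] L2}
    (hU : IsUnitaryGroupOf A U) {v : L2} {l : ℝ} (hv : (v, (l : ℂ) • v) ∈ A) (t : ℝ) :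
    U t v = Complex.exp (Complex.I * l * t) • v := by
  have hd : ∀ s : ℝ, HasDerivAt (fun s : ℝ => Complex.exp (-(Complex.I * l * s)) • U s v) 0 s := by
    intro s
    have h1 := (hU.hasDerivAt hv s).1
    have h2 : HasDerivAt (fun s : ℝ => Complex.exp (-(Complex.I * l * s)))
        (Complex.exp (-(Complex.I * l * s)) * (-(Complex.I * l))) s := by
      have h3 : HasDerivAt (fun s : ℝ => -(Complex.I * l * (s : ℂ))) (-(Complex.I * l)) s := by
        simpa [Pi.neg_def] using ((Complex.ofRealCLM.hasDerivAt (x := s)).const_mul (Complex.I * l)).neg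
      exact h3.cexp
    have h3 := h2.smul h1
    rw [map_smul, smul_smul, smul_smul, ← add_smul] at h3
    have e : Complex.exp (-(Complex.I * l * s)) * (Complex.I * l) +
      Complex.exp (-(Complex.I * l * s)) * (-(Complex.I * l)) = 0 := by ring
    rw [← mul_assoc] at e
    rw [e, zero_smul] at h3
    exact h3
  have hc := is_const_of_deriv_eq_zero (fun s => (hd s).differentiableAt)
      (fun s => (hd s).deriv) t 0
  simp only [hU.map_zero, Complex.ofReal_zero, mul_zero, neg_zero, Complex.exp_zero,
    one_smul, ContinuousLinearMap.id_apply] at hc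
  conv_rhs => rw [← hc, smul_smul, ← Complex.exp_add, add_neg_cancel, Complex.exp_zero, one_smul]

variable {T : L2 →L[ℂ] L2} {c : ℝ}

/-- Absolutely continuous vectors are orthogonal to eigenvectors: `⟪U t f, v⟫` has constant modulus
for an eigenvector `v`, but tends to zero. When the nonpositive spectral subspace is
finite-dimensional it is spanned by eigenvectors. -/
theorem acSubspace_le (hT : T.IsPositive) (hinj : Function.Injective T) (hc : 0 < c)
    [FiniteDimensional ℂ (nonposSpace T c)] :
    acSubspace (invGroup T c) ≤ (nonposSpace T c)ᗮ := by
  refine Submodule.topologicalClosure_minimal _ ?_ (Submodule.isClosed_orthogonal _)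
  rw [Submodule.span_le]
  rintro f ⟨μ, hμ, hac⟩
  have hU := isUnitaryGroupOf_invGroup hT hinj c
  refine mem_orthogonal_nonposSpace hT hinj hc fun v hv0 hv m hm hTv => ?_
  have hm0 : m ≠ 0 := (lt_of_lt_of_le (inv_pos.2 hc) hm).ne'
  have hmem : (v, ((m⁻¹ - c : ℝ) : ℂ) • v) ∈ {p : L2 × L2 | p.1 = T (p.2 + (c : ℂ) • p.1)} := by
    show v = T (((m⁻¹ - c : ℝ) : ℂ) • v + (c : ℂ) • v)
    rw [← add_smul, map_smul, hTv, smul_smul]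
    have : (((m⁻¹ - c : ℝ) : ℂ) + (c : ℂ)) * (m : ℂ) = 1 := by
      rw [← Complex.ofReal_add, sub_add_cancel, ← Complex.ofReal_mul, inv_mul_cancel₀ hm0,
        Complex.ofReal_one]
    rw [this, one_smul]
  have hlim := (hU.tendsto_inner (tendsto_inner_of_isSpectralMeasure hμ hac) v).norm
  have hconst : ∀ t, ‖inner ℂ (invGroup T c t f) v‖ = ‖inner ℂ f v‖ := by
    intro t
    have h1 := hU.inner_map t f v
    rw [hU.apply_of_eigenvector hmem t, inner_smul_right] at h1
    have h2 := congrArg norm h1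
    rw [norm_mul] at h2
    have h3 : ‖Complex.exp (Complex.I * ((m⁻¹ - c : ℝ) : ℂ) * (t : ℂ))‖ = 1 := by
      rw [mul_assoc, mul_comm, ← Complex.ofReal_mul, Complex.norm_exp_ofReal_mul_I]
    rwa [h3, one_mul] at h2
  simp only [hconst, norm_zero] at hlim
  have h0 : ‖inner ℂ f v‖ = 0 := tendsto_nhds_unique tendsto_const_nhds hlim
  rw [← inner_conj_symm, norm_eq_zero.1 h0, map_zero]

/-- If a dense set of vectors has a spectral density on `(0, ∞)`, then that part of the spectrum is
absolutely continuous: the spectral measure of `F(H) f` is `|F|² ρ dx`. -/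
theorem le_acSubspace (hT : T.IsPositive) (hinj : Function.Injective T) (hc : 0 < c) {D : Set L2}
    (hD : Dense D) (hρ : ∀ f ∈ D, ∃ ρ, IsDensity T c f f ρ) :
    (nonposSpace T c)ᗮ ≤ acSubspace (invGroup T c) := by
  rw [orthogonal_nonposSpace]
  have hclosed : IsClosed (acSubspace (invGroup T c) : Set L2) :=
    Submodule.isClosed_topologicalClosure _
  refine Submodule.topologicalClosure_minimal _ ?_ hclosed
  rw [posRange, Submodule.span_le]
  rintro _ ⟨F, f, hF, rfl⟩
  have hsub : closure D ⊆ (energyCalc T c F) ⁻¹' (acSubspace (invGroup T c) : Set L2) := by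
    refine closure_minimal (fun f hf => ?_) (hclosed.preimage (energyCalc T c F).continuous)
    obtain ⟨ρ, h⟩ := hρ f hf
    refine Submodule.le_topologicalClosure _ (Submodule.subset_span ?_)
    set d : ℝ → ℝ := fun x => ‖F x‖ ^ 2 * (ρ x).re with hd
    have hd0 : ∀ x, 0 ≤ d x := by
      intro x
      by_cases hx : 0 < x
      · have := h.nonneg hT hx
        rw [Complex.le_def] at this
        exact mul_nonneg (by positivity) this.1
      · simp [hd, hF.eq_zero_of_nonpos (not_lt.1 hx)]
    have hdρ : ∀ x, (d x : ℂ) = starRingEnd ℂ (F x) * F x * ρ x := by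
      intro x
      by_cases hx : 0 < x
      · have := h.nonneg hT hx
        rw [Complex.le_def] at this
        have h2 : ((ρ x).re : ℂ) = ρ x := Complex.ext (by simp) (by simpa using this.2)
        rw [hd, Complex.ofReal_mul, h2, mul_comm (starRingEnd ℂ (F x)), Complex.mul_conj,
          Complex.normSq_eq_norm_sq]
      · simp [hd, hF.eq_zero_of_nonpos (not_lt.1 hx)]
    have hdi : Integrable d := by
      have h2 : IsTest fun x => F x * (starRingEnd ℂ (F x) * ρ x) :=
        hF.mul_continuousOn ((Complex.continuous_conj.comp hF.cont).continuousOn.mul h.cont)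
      have := (h2.cont.integrable_of_hasCompactSupport (μ := volume) h2.hasCompactSupport).re
      refine this.congr (Eventually.of_forall fun x => ?_)
      show (F x * (starRingEnd ℂ (F x) * ρ x)).re = d x
      rw [← Complex.ofReal_re (d x), hdρ]
      ring_nf
    refine ⟨volume.withDensity fun x => ENNReal.ofReal (d x), ⟨?_, fun t => ?_⟩,
      withDensity_absolutelyContinuous _ _⟩
    · exact isFiniteMeasure_withDensity_ofReal hdi.2
    · have hexp : Continuous fun x : ℝ => Complex.exp (Complex.I * (t : ℂ) * (x : ℂ)) := by fun_prop
      rw [invGroup_energyCalc hT hinj hc hF, inner_energyCalc_left,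
        ← energyCalc_mul hT hc hF.conj (hF.mul hexp),
        h.inner_eq hT hc (F := fun x => starRingEnd ℂ (F x) *
          (Complex.exp (Complex.I * (t : ℂ) * (x : ℂ)) * F x))
          ((hF.mul hexp).mul (Complex.continuous_conj.comp hF.cont))]
      have hdm : AEMeasurable (fun x => ENNReal.ofReal (d x)) volume :=
        hdi.aestronglyMeasurable.aemeasurable.ennreal_ofReal
      rw [integral_withDensity_eq_integral_toReal_smul₀ hdm
        (Eventually.of_forall fun _ => ENNReal.ofReal_lt_top)]
      refine integral_congr_ae (Eventually.of_forall fun x => ?_)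
      simp only [ENNReal.toReal_ofReal (hd0 x), Complex.real_smul, hdρ]
      ring
  exact hsub (hD f)

theorem acProjection_invGroup (hT : T.IsPositive) (hinj : Function.Injective T) (hc : 0 < c)
    [FiniteDimensional ℂ (nonposSpace T c)] {D : Set L2}
    (hD : Dense D) (hρ : ∀ f ∈ D, ∃ ρ, IsDensity T c f f ρ) :
    acProjection (invGroup T c) = (nonposSpace T c)ᗮ.starProjection := by
  have h : acSubspace (invGroup T c) = (nonposSpace T c)ᗮ :=
    le_antisymm (acSubspace_le hT hinj hc) (le_acSubspace hT hinj hc hD hρ)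
  unfold acProjection
  congr 1

/-! ### The Fourier transform of the free Green function -/

/-- The Fourier transform on `L²`, defined by extension from Schwartz functions, is given by the
usual integral on `L¹ ∩ L²`. -/
lemma fourier_toLp_ae {f : R3 → ℂ} (h1 : Integrable f) (h2 : MemLp f 2 volume) :
    ((𝓕 (h2.toLp f) : L2) : R3 → ℂ) =ᵐ[volume] 𝓕 f := by
  have hc : Continuous (𝓕 f) :=
    VectorFourier.fourierIntegral_continuous Real.continuous_fourierChar
      (by exact continuous_inner) h1
  refine ae_eq_of_integral_contDiff_smul_eq
    ((Lp.memLp _).locallyIntegrable (by norm_num)) hc.locallyIntegrable ?_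
  intro g hg hgs
  have hcs : HasCompactSupport (fun x => (g x : ℂ)) := hgs.comp_left (g := fun r : ℝ => (r : ℂ)) rfl
  have hcd : ContDiff ℝ (⊤ : ℕ∞) (fun x => (g x : ℂ)) := Complex.ofRealCLM.contDiff.comp hg
  let s : 𝓢(R3, ℂ) := hcs.toSchwartzMap hcd
  have hs : ∀ x, s x = (g x : ℂ) := fun x => rfl
  have e1 : ∫ x, g x • ((𝓕 (h2.toLp f) : L2) : R3 → ℂ) x
      = ((𝓕 (h2.toLp f) : L2) : 𝓢'(R3, ℂ)) s := by
    rw [Lp.toTemperedDistribution_apply]; simp [hs]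
  rw [e1, ← Lp.fourier_toTemperedDistribution_eq, TemperedDistribution.fourier_apply,
    Lp.toTemperedDistribution_apply]
  have e2 : ∫ x, (𝓕 s) x • (h2.toLp f) x = ∫ x, (𝓕 (fun x => (g x : ℂ))) x • f x := by
    refine integral_congr_ae ?_
    filter_upwards [h2.coeFn_toLp] with x hx
    rw [hx]; rfl
  rw [e2]
  have e3 := VectorFourier.integral_fourierIntegral_smul_eq_flip (L := innerₗ R3) (μ := volume)
      (ν := volume)
      Real.continuous_fourierChar continuous_inner s.integrable h1
  simpa using! e3

lemma fourierInv_toLp_ae {f : R3 → ℂ} (h1 : Integrable f) (h2 : MemLp f 2 volume) :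
    ((𝓕⁻ (h2.toLp f) : L2) : R3 → ℂ) =ᵐ[volume] 𝓕⁻ f := by
  have hc : Continuous (𝓕 f) :=
    VectorFourier.fourierIntegral_continuous Real.continuous_fourierChar
      (by exact continuous_inner) h1
  have hc' : Continuous (𝓕⁻ f) := by
    have : 𝓕⁻ f = fun x => 𝓕 f (-x) := by ext x; exact Real.fourierInv_eq_fourier_neg f x
    rw [this]; exact hc.comp continuous_neg
  refine ae_eq_of_integral_contDiff_smul_eq
    ((Lp.memLp _).locallyIntegrable (by norm_num)) hc'.locallyIntegrable ?_
  intro g hg hgs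
  have hcs : HasCompactSupport (fun x => (g x : ℂ)) := hgs.comp_left (g := fun r : ℝ => (r : ℂ)) rfl
  have hcd : ContDiff ℝ (⊤ : ℕ∞) (fun x => (g x : ℂ)) := Complex.ofRealCLM.contDiff.comp hg
  let s : 𝓢(R3, ℂ) := hcs.toSchwartzMap hcd
  have hs : ∀ x, s x = (g x : ℂ) := fun x => rfl
  have e1 : ∫ x, g x • ((𝓕⁻ (h2.toLp f) : L2) : R3 → ℂ) x
      = ((𝓕⁻ (h2.toLp f) : L2) : 𝓢'(R3, ℂ)) s := by
    rw [Lp.toTemperedDistribution_apply]; simp [hs]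
  rw [e1, ← Lp.fourierInv_toTemperedDistribution_eq, TemperedDistribution.fourierInv_apply,
    Lp.toTemperedDistribution_apply]
  have e2 : ∫ x, (𝓕⁻ s) x • (h2.toLp f) x = ∫ x, (𝓕⁻ (fun x => (g x : ℂ))) x • f x := by
    refine integral_congr_ae ?_
    filter_upwards [h2.coeFn_toLp] with x hx
    rw [hx, SchwartzMap.fourierInv_coe]; rfl
  rw [e2]
  have e3 := VectorFourier.integral_fourierIntegral_smul_eq_flip (L := -innerₗ R3) (μ := volume)
      (ν := volume)
      Real.continuous_fourierChar (by exact continuous_inner.neg) s.integrable h1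
  have e4 : (-innerₗ R3).flip = -innerₗ R3 := by ext x y; simp [real_inner_comm]
  rw [e4] at e3
  simpa using! e3

lemma norm_exp_I_mul (z : ℂ) (r : ℝ) : ‖Complex.exp (Complex.I * z * r)‖ = Real.exp (-z.im * r) := by
  rw [Complex.norm_exp]; simp

lemma green_eq (z : ℂ) (x : R3) :
    green z x = Complex.exp (Complex.I * z * (‖x‖ : ℂ)) / (4 * (Real.pi : ℂ) * (‖x‖ : ℂ)) := by
  unfold green
  split_ifs with h
  · simp [h]
  · rfl

lemma norm_green (z : ℂ) (x : R3) :
    ‖green z x‖ = Real.exp (-z.im * ‖x‖) / (4 * Real.pi * ‖x‖) := by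
  rw [green_eq, norm_div, norm_exp_I_mul]; simp [abs_of_pos Real.pi_pos]

lemma measurable_green (z : ℂ) : Measurable (green z) := by
  have : green z = fun x => Complex.exp (Complex.I * z * (‖x‖ : ℂ)) / (4 * (Real.pi : ℂ) * (‖x‖ : ℂ)) :=
    funext (green_eq z)
  rw [this]; fun_prop

lemma continuousOn_green (z : ℂ) : ContinuousOn (green z) {0}ᶜ := by
  have : green z = fun x => Complex.exp (Complex.I * z * (‖x‖ : ℂ)) / (4 * (Real.pi : ℂ) * (‖x‖ : ℂ)) :=
    funext (green_eq z)
  rw [this]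
  refine ContinuousOn.div (by fun_prop) (by fun_prop) ?_
  intro x hx
  simpa [Real.pi_ne_zero] using hx

lemma integrable_green {z : ℂ} (hz : 0 < z.im) : Integrable (green z) := by
  have h : Integrable (fun x : R3 => (fun r : ℝ => Real.exp (-z.im * r) / (4 * Real.pi * r)) ‖x‖) := by
    rw [integrable_fun_norm_addHaar volume (f := fun r : ℝ => Real.exp (-z.im * r) / (4 * Real.pi * r))]
    simp only [finrank_euclideanSpace, Fintype.card_fin, smul_eq_mul]
    have := (integrableOn_rpow_mul_exp_neg_mul_rpow (s := 1) (p := 1) (b := z.im) (by norm_num)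
      (by norm_num) hz).const_mul (1 / (4 * Real.pi))
    refine IntegrableOn.congr_fun this (fun y hy => ?_) measurableSet_Ioi
    have hy' : (0:ℝ) < y := hy
    simp only [Real.rpow_one]; field_simp
  refine Integrable.mono' h (measurable_green z).aestronglyMeasurable (ae_of_all _ fun x => ?_)
  rw [norm_green]

/-- In polar coordinates the integral is `(4π)⁻¹ ∫ e^{-2 (Im z) r} dr`. -/
lemma integral_norm_green_sq {z : ℂ} (hz : 0 < z.im) :
    Integrable (fun x => ‖green z x‖ ^ 2) ∧ ∫ x, ‖green z x‖ ^ 2 = 1 / (8 * Real.pi * z.im) := by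
  have e : (fun x : R3 => ‖green z x‖ ^ 2) =
      fun x => (fun r : ℝ => (Real.exp (-z.im * r) / (4 * Real.pi * r)) ^ 2) ‖x‖ := by
    ext x; rw [norm_green]
  have e2 : EqOn (fun y : ℝ => 1 / (16 * Real.pi ^ 2) * Real.exp ((-2 * z.im) * y))
      (fun y : ℝ => y ^ 2 * (Real.exp (-z.im * y) / (4 * Real.pi * y)) ^ 2) (Ioi 0) := by
    intro y hy
    have hy' : (0:ℝ) < y := hy
    have : Real.exp ((-2 * z.im) * y) = Real.exp (-z.im * y) ^ 2 := by
      rw [← Real.exp_nat_mul]; congr 1; push_cast; ring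
    simp only [this]; field_simp; ring
  have h1 : IntegrableOn (fun y : ℝ => Real.exp ((-2 * z.im) * y)) (Ioi 0) :=
    integrableOn_exp_mul_Ioi (by linarith) 0
  rw [e, integrable_fun_norm_addHaar volume
      (f := fun r : ℝ => (Real.exp (-z.im * r) / (4 * Real.pi * r)) ^ 2),
    integral_fun_norm_addHaar volume
      (fun r : ℝ => (Real.exp (-z.im * r) / (4 * Real.pi * r)) ^ 2)]
  simp only [finrank_euclideanSpace, Fintype.card_fin, smul_eq_mul]
  refine ⟨IntegrableOn.congr_fun (h1.const_mul _) e2 measurableSet_Ioi, ?_⟩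
  rw [← setIntegral_congr_fun measurableSet_Ioi e2, integral_const_mul,
    integral_exp_mul_Ioi (by linarith), Measure.real, EuclideanSpace.volume_ball_fin_three]
  simp only [ENNReal.ofReal_one, one_pow, one_mul, mul_zero, Real.exp_zero, nsmul_eq_mul]
  rw [ENNReal.toReal_ofReal (by positivity)]
  have := hz.ne'
  field_simp; norm_num

lemma memLp_green {z : ℂ} (hz : 0 < z.im) : MemLp (green z) 2 volume :=
  (memLp_two_iff_integrable_sq_norm (measurable_green z).aestronglyMeasurable).2
    (integral_norm_green_sq hz).1

/-- Euclidean three-space as the product of a line and a plane. -/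
def splitFirst (x : R3) : ℝ × EuclideanSpace ℝ (Fin 2) := (x 0, WithLp.toLp 2 fun i => x i.succ)

lemma measurePreserving_splitFirst : MeasurePreserving splitFirst := by
  have h1 : MeasurePreserving (WithLp.ofLp : R3 → (Fin 3 → ℝ)) :=
    PiLp.volume_preserving_ofLp (Fin 3)
  have h2 := volume_preserving_piFinSuccAbove (fun _ : Fin 3 => ℝ) 0
  have h3 : MeasurePreserving (WithLp.toLp 2 : (Fin 2 → ℝ) → EuclideanSpace ℝ (Fin 2)) :=
    PiLp.volume_preserving_toLp (Fin 2)
  exact ((MeasurePreserving.id volume).prod h3).comp (h2.comp h1)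

lemma norm_sq_eq_splitFirst (x : R3) :
    ‖x‖ = Real.sqrt ((splitFirst x).1 ^ 2 + ‖(splitFirst x).2‖ ^ 2) := by
  rw [EuclideanSpace.norm_sq_eq, EuclideanSpace.norm_eq]
  simp [splitFirst, Fin.sum_univ_succ]

/-- The integral of the free Green function over a plane at distance `|s|` from the singularity. -/
lemma integral_green_plane {z : ℂ} (hz : 0 < z.im) {s : ℝ} (hs : s ≠ 0) :
    ∫ q : EuclideanSpace ℝ (Fin 2), Complex.exp (Complex.I * z * (Real.sqrt (s ^ 2 + ‖q‖ ^ 2) : ℝ)) /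
      (4 * (Real.pi : ℂ) * (Real.sqrt (s ^ 2 + ‖q‖ ^ 2) : ℝ))
      = Complex.I / (2 * z) * Complex.exp (Complex.I * z * (|s| : ℝ)) := by
  have hz0 : z ≠ 0 := by rintro rfl; simp at hz
  have hpos : ∀ r : ℝ, 0 < s ^ 2 + r ^ 2 := fun r => by positivity
  have hsq : ∀ r : ℝ, 0 < Real.sqrt (s ^ 2 + r ^ 2) := fun r => Real.sqrt_pos.2 (hpos r)
  have hder : ∀ r ∈ Ici (0:ℝ), HasDerivAt
      (fun r : ℝ => Complex.exp (Complex.I * z * (Real.sqrt (s ^ 2 + r ^ 2) : ℝ)) /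
        (4 * (Real.pi : ℂ) * (Complex.I * z)))
      ((r ^ 1) • (Complex.exp (Complex.I * z * (Real.sqrt (s ^ 2 + r ^ 2) : ℝ)) /
      (4 * (Real.pi : ℂ) * (Real.sqrt (s ^ 2 + r ^ 2) : ℝ)))) r := by
    intro r _
    have h1 : HasDerivAt (fun r : ℝ => Real.sqrt (s ^ 2 + r ^ 2)) (r / Real.sqrt (s ^ 2 + r ^ 2)) r := by
      have := (((hasDerivAt_pow 2 r).const_add (s ^ 2)).sqrt (hpos r).ne')
      convert this using 1
      have := (hsq r).ne'
      field_simp; simp; ring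
    have h2 := ((h1.ofReal_comp.const_mul (Complex.I * z)).cexp).div_const
      (4 * (Real.pi : ℂ) * (Complex.I * z))
    refine h2.congr_deriv ?_
    have h3 : ((Real.sqrt (s ^ 2 + r ^ 2) : ℝ) : ℂ) ≠ 0 := by exact_mod_cast (hsq r).ne'
    have h4 : (Real.pi : ℂ) ≠ 0 := by exact_mod_cast Real.pi_ne_zero
    rw [pow_one, Complex.real_smul]
    push_cast
    field_simp
  have hint : IntegrableOn (fun r : ℝ => (r ^ 1) •
      (Complex.exp (Complex.I * z * (Real.sqrt (s ^ 2 + r ^ 2) : ℝ)) /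
      (4 * (Real.pi : ℂ) * (Real.sqrt (s ^ 2 + r ^ 2) : ℝ)))) (Ioi 0) := by
    have h1 : IntegrableOn (fun y : ℝ => Real.exp ((-z.im) * y)) (Ioi 0) :=
      integrableOn_exp_mul_Ioi (by linarith) 0
    refine Integrable.mono' h1 (by fun_prop) ?_
    refine (ae_restrict_iff' measurableSet_Ioi).2 (ae_of_all _ fun r hr => ?_)
    have hr' : (0:ℝ) < r := hr
    have hle : r ≤ Real.sqrt (s ^ 2 + r ^ 2) := Real.le_sqrt_of_sq_le (by nlinarith [sq_nonneg s])
    rw [norm_smul, norm_div, norm_exp_I_mul]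
    simp only [pow_one, norm_mul, Complex.norm_real, Complex.norm_ofNat, Real.norm_eq_abs,
      abs_of_pos Real.pi_pos, abs_of_pos hr', abs_of_pos (hsq r)]
    have h5 : Real.exp (-z.im * Real.sqrt (s ^ 2 + r ^ 2)) ≤ Real.exp (-z.im * r) :=
      Real.exp_le_exp.2 (by nlinarith)
    rw [← mul_div_assoc, div_le_iff₀ (by have := hsq r; positivity)]
    have h6 : r ≤ 4 * Real.pi * Real.sqrt (s ^ 2 + r ^ 2) := by
      nlinarith [Real.pi_gt_three, hsq r]
    calc r * Real.exp (-z.im * Real.sqrt (s ^ 2 + r ^ 2))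
        ≤ (4 * Real.pi * Real.sqrt (s ^ 2 + r ^ 2)) * Real.exp (-z.im * r) :=
          mul_le_mul h6 h5 (Real.exp_pos _).le (by have := hsq r; positivity)
      _ = _ := by ring
  have hlim : Tendsto (fun r : ℝ => Complex.exp (Complex.I * z * (Real.sqrt (s ^ 2 + r ^ 2) : ℝ)) /
        (4 * (Real.pi : ℂ) * (Complex.I * z))) atTop (𝓝 0) := by
    rw [← zero_div (4 * (Real.pi : ℂ) * (Complex.I * z))]
    refine Tendsto.div_const ?_ _
    rw [tendsto_zero_iff_norm_tendsto_zero]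
    have h0 : Tendsto (fun r : ℝ => Real.exp (-z.im * r)) atTop (𝓝 0) := by
      refine Real.tendsto_exp_atBot.comp ?_
      exact tendsto_id.const_mul_atTop_of_neg (by linarith)
    refine squeeze_zero' (Eventually.of_forall fun r => norm_nonneg _) ?_ h0
    filter_upwards [eventually_gt_atTop 0] with r hr
    have hle : r ≤ Real.sqrt (s ^ 2 + r ^ 2) := Real.le_sqrt_of_sq_le (by nlinarith [sq_nonneg s])
    rw [norm_exp_I_mul]
    exact Real.exp_le_exp.2 (by nlinarith)
  have key := integral_Ioi_of_hasDerivAt_of_tendsto' hder hint hlim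
  have := integral_fun_norm_addHaar (volume : Measure (EuclideanSpace ℝ (Fin 2)))
    (fun r : ℝ => Complex.exp (Complex.I * z * (Real.sqrt (s ^ 2 + r ^ 2) : ℝ)) /
      (4 * (Real.pi : ℂ) * (Real.sqrt (s ^ 2 + r ^ 2) : ℝ)))
  rw [this]
  simp only [finrank_euclideanSpace, Fintype.card_fin, Nat.add_one_sub_one]
  rw [key, Measure.real, EuclideanSpace.volume_ball_fin_two]
  have h4 : (Real.pi : ℂ) ≠ 0 := by exact_mod_cast Real.pi_ne_zero
  have hI : Complex.I ^ 2 = -1 := Complex.I_sq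
  simp [Real.sqrt_sq_eq_abs]
  field_simp
  rw [hI]; simp [Real.pi_pos.le]; norm_num

/-- The Fourier transform of the one-dimensional Green function `i e^{iz|s|}/(2z)`. -/
lemma integral_exp_abs {z : ℂ} (hz : 0 < z.im) (P : ℝ) :
    ∫ s : ℝ, Complex.exp (-2 * Real.pi * Complex.I * P * s) *
      (Complex.I / (2 * z) * Complex.exp (Complex.I * z * (|s| : ℝ)))
      = (4 * (Real.pi : ℂ) ^ 2 * P ^ 2 - z ^ 2)⁻¹ := by
  have hz0 : z ≠ 0 := by rintro rfl; simp at hz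
  have hne : ∀ r : ℝ, z - r ≠ 0 := by
    intro r h
    have := congrArg Complex.im h
    simp at this; linarith
  set u : ℝ := 2 * Real.pi * P with hu
  have hI : Complex.I ≠ 0 := Complex.I_ne_zero
  have e1 : EqOn (fun s : ℝ => Complex.exp (-2 * Real.pi * Complex.I * P * s) *
      (Complex.I / (2 * z) * Complex.exp (Complex.I * z * (|s| : ℝ))))
      (fun s : ℝ => Complex.I / (2 * z) * Complex.exp ((-Complex.I * (z + u)) * s)) (Iic 0) := by
    intro s hs
    simp only [abs_of_nonpos (show s ≤ 0 from hs), hu]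
    rw [mul_left_comm, ← Complex.exp_add]
    congr 2; push_cast; ring
  have e2 : EqOn (fun s : ℝ => Complex.exp (-2 * Real.pi * Complex.I * P * s) *
      (Complex.I / (2 * z) * Complex.exp (Complex.I * z * (|s| : ℝ))))
      (fun s : ℝ => Complex.I / (2 * z) * Complex.exp ((Complex.I * (z - u)) * s)) (Ioi 0) := by
    intro s hs
    simp only [abs_of_pos (show 0 < s from hs), hu]
    rw [mul_left_comm, ← Complex.exp_add]
    congr 2; push_cast; ring
  have r1 : 0 < (-Complex.I * (z + u)).re := by simpa using hz
  have r2 : (Complex.I * (z - u)).re < 0 := by simpa using hz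
  have i1 := (integrableOn_exp_mul_complex_Iic r1 0).const_mul (Complex.I / (2 * z))
  have i2 := (integrableOn_exp_mul_complex_Ioi r2 0).const_mul (Complex.I / (2 * z))
  rw [← setIntegral_univ, ← Iic_union_Ioi (a := (0:ℝ)),
    setIntegral_union (Iic_disjoint_Ioi le_rfl) measurableSet_Ioi
      (IntegrableOn.congr_fun i1 e1.symm measurableSet_Iic)
      (IntegrableOn.congr_fun i2 e2.symm measurableSet_Ioi),
    setIntegral_congr_fun measurableSet_Iic e1, setIntegral_congr_fun measurableSet_Ioi e2,
    integral_const_mul, integral_const_mul, integral_exp_mul_complex_Iic r1,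
    integral_exp_mul_complex_Ioi r2]
  have hp : z + u ≠ 0 := by have := hne (-u); simpa using this
  have hm := hne u
  have hd : 4 * (Real.pi : ℂ) ^ 2 * P ^ 2 - z ^ 2 = -((z - u) * (z + u)) := by
    rw [hu]; push_cast; ring
  rw [hd]
  simp only [Complex.ofReal_zero, mul_zero, Complex.exp_zero]
  field_simp
  ring

/-- For `Im z > 0` the free Green function is the inverse Fourier transform of the symbol of
`(-Δ - z²)⁻¹`. -/
lemma fourier_green {z : ℂ} (hz : 0 < z.im) (p : R3) :
    𝓕 (green z) p = (4 * (Real.pi : ℂ) ^ 2 * (‖p‖ : ℂ) ^ 2 - z ^ 2)⁻¹ := by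
  have hrad : ∀ A : R3 ≃ₗᵢ[ℝ] R3, green z ∘ A = green z := by
    intro A; ext x; simp [green_eq]
  -- by rotation invariance, `p` may be taken on the first coordinate axis
  let e : R3 := EuclideanSpace.single 0 ‖p‖
  have he : ‖e‖ = ‖p‖ := by simp [e]
  have hrot : 𝓕 (green z) p = 𝓕 (green z) e := by
    let A := (ℝ ∙ (p - e))ᗮ.reflection
    have hA : A p = e := Submodule.reflection_sub he.symm
    have := Real.fourier_comp_linearIsometry A (green z) p
    rw [hrad, hA] at this
    exact this
  rw [hrot, Real.fourier_eq']
  let K : ℝ × EuclideanSpace ℝ (Fin 2) → ℂ := fun u =>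
    Complex.exp (-2 * Real.pi * Complex.I * ‖p‖ * u.1) *
      (Complex.exp (Complex.I * z * (Real.sqrt (u.1 ^ 2 + ‖u.2‖ ^ 2) : ℝ)) /
      (4 * (Real.pi : ℂ) * (Real.sqrt (u.1 ^ 2 + ‖u.2‖ ^ 2) : ℝ)))
  have hKm : Measurable K := by fun_prop
  have hK : ∀ x : R3, Complex.exp (((-2 * Real.pi * inner ℝ x e : ℝ) : ℂ) * Complex.I) • green z x
      = K (splitFirst x) := by
    intro x
    have : inner ℝ x e = ‖p‖ * x 0 := by
      simp [e, EuclideanSpace.inner_single_right]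
    simp only [K, ← norm_sq_eq_splitFirst, this, smul_eq_mul, green_eq]
    congr 2
    simp only [splitFirst]; push_cast; ring
  simp_rw [hK]
  have hmp := measurePreserving_splitFirst
  have hKint : Integrable K (volume.prod volume) := by
    rw [← Measure.volume_eq_prod, ← hmp.integrable_comp hKm.aestronglyMeasurable]
    refine Integrable.mono' (integrable_green hz).norm
      (hKm.comp hmp.measurable).aestronglyMeasurable (ae_of_all _ fun x => ?_)
    simp only [Function.comp_apply, ← hK, norm_smul, Complex.norm_exp_ofReal_mul_I, one_mul, le_refl]
  have hI : ∫ x, K (splitFirst x) = ∫ u, K u ∂(volume.prod volume) := by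
    rw [← Measure.volume_eq_prod, ← hmp.map_eq,
      integral_map hmp.measurable.aemeasurable hKm.aestronglyMeasurable]
  -- Integrating over the planes orthogonal to `p` leaves a one-dimensional Fourier transform.
  rw [hI, integral_prod _ hKint, ← integral_exp_abs hz ‖p‖]
  refine integral_congr_ae ?_
  filter_upwards [Measure.ae_ne volume (0:ℝ)] with s hs
  simp only [K]
  rw [integral_const_mul, integral_green_plane hz hs]

/-! ### The free resolvent -/

/-- The symbol of the free resolvent `(-Δ - z²)⁻¹`. -/
noncomputable def symb (z : ℂ) (p : R3) : ℂ := (4 * (Real.pi : ℂ) ^ 2 * (‖p‖ : ℂ) ^ 2 - z ^ 2)⁻¹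

/-- The distance of `z²` from `[0, ∞)` is at least `(Im z)²`. -/
lemma norm_symb_denom_ge {z : ℂ} (hz : 0 < z.im) (p : R3) :
    z.im ^ 2 ≤ ‖4 * (Real.pi : ℂ) ^ 2 * (‖p‖ : ℂ) ^ 2 - z ^ 2‖ := by
  have e : 4 * (Real.pi : ℂ) ^ 2 * (‖p‖ : ℂ) ^ 2 - z ^ 2
      = (((2 * Real.pi * ‖p‖ : ℝ) : ℂ) - z) * (((2 * Real.pi * ‖p‖ : ℝ) : ℂ) + z) := by
    push_cast; ring
  have h1 : z.im ≤ ‖((2 * Real.pi * ‖p‖ : ℝ) : ℂ) - z‖ := by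
    refine le_trans ?_ (Complex.abs_im_le_norm _)
    rw [Complex.sub_im, Complex.ofReal_im, zero_sub, abs_neg]; exact le_abs_self _
  have h2 : z.im ≤ ‖((2 * Real.pi * ‖p‖ : ℝ) : ℂ) + z‖ := by
    refine le_trans ?_ (Complex.abs_im_le_norm _)
    rw [Complex.add_im, Complex.ofReal_im, zero_add]; exact le_abs_self _
  rw [e, norm_mul, sq]
  exact mul_le_mul h1 h2 hz.le (norm_nonneg _)

lemma symb_denom_ne {z : ℂ} (hz : 0 < z.im) (p : R3) :
    4 * (Real.pi : ℂ) ^ 2 * (‖p‖ : ℂ) ^ 2 - z ^ 2 ≠ 0 := by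
  intro h
  have := norm_symb_denom_ge hz p
  rw [h, norm_zero] at this
  nlinarith

lemma symb_ne_zero {z : ℂ} (hz : 0 < z.im) (p : R3) : symb z p ≠ 0 :=
  inv_ne_zero (symb_denom_ne hz p)

lemma measurable_symb (z : ℂ) : Measurable (symb z) := by unfold symb; fun_prop

lemma norm_symb_le {z : ℂ} (hz : 0 < z.im) (p : R3) : ‖symb z p‖ ≤ (z.im ^ 2)⁻¹ := by
  rw [symb, norm_inv]
  exact inv_anti₀ (by positivity) (norm_symb_denom_ge hz p)

lemma memLp_top_symb {z : ℂ} (hz : 0 < z.im) : MemLp (symb z) ∞ (volume : Measure R3) :=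
  memLp_top_of_bound (measurable_symb z).aestronglyMeasurable _ (ae_of_all _ (norm_symb_le hz))

lemma symb_sub {z z' : ℂ} (hz : 0 < z.im) (hz' : 0 < z'.im) (p : R3) :
    symb z p - symb z' p = (z ^ 2 - z' ^ 2) * (symb z' p * symb z p) := by
  have h1 := symb_denom_ne hz p
  have h2 := symb_denom_ne hz' p
  unfold symb
  field_simp
  ring

lemma conj_symb (z : ℂ) (p : R3) : starRingEnd ℂ (symb (-starRingEnd ℂ z) p) = symb z p := by
  simp [symb, show (starRingEnd ℂ) 4 = 4 from map_ofNat _ 4]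

/-- The free resolvent `(-Δ - z²)⁻¹` for `Im z > 0` (and `0` for other `z`). -/
noncomputable def freeRes (z : ℂ) : L2 →L[ℂ] L2 :=
  open Classical in
  if hz : 0 < z.im then
    ((Lp.fourierTransformₗᵢ R3 ℂ).symm.toContinuousLinearEquiv : L2 →L[ℂ] L2) ∘L
      ((ContinuousLinearMap.mul ℂ ℂ).holderL volume ∞ 2 2 ((memLp_top_symb hz).toLp _)) ∘L
      ((Lp.fourierTransformₗᵢ R3 ℂ).toContinuousLinearEquiv : L2 →L[ℂ] L2)
  else 0

lemma fourier_freeRes {z : ℂ} (hz : 0 < z.im) (f : L2) :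
    ((𝓕 (freeRes z f) : L2) : R3 → ℂ) =ᵐ[volume] fun p => symb z p * (𝓕 f : L2) p := by
  have e : 𝓕 (freeRes z f) = (ContinuousLinearMap.mul ℂ ℂ).holderL volume ∞ 2 2
      ((memLp_top_symb hz).toLp _) (𝓕 f : L2) := by
    rw [freeRes, dif_pos hz]
    exact (Lp.fourierTransformₗᵢ R3 ℂ).apply_symm_apply _
  rw [e, ContinuousLinearMap.holderL_apply_apply]
  filter_upwards [(ContinuousLinearMap.mul ℂ ℂ).coeFn_holder (r := 2)
    ((memLp_top_symb hz).toLp _) (𝓕 f : L2), (memLp_top_symb hz).coeFn_toLp] with p h1 h2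
  rw [h1, h2]; rfl

lemma fourier_injective {f g : L2} (h : (𝓕 f : L2) = 𝓕 g) : f = g :=
  (Lp.fourierTransformₗᵢ R3 ℂ).injective h

lemma fourier_sub' (f g : L2) : (𝓕 (f - g) : L2) = 𝓕 f - 𝓕 g := (Lp.fourierTransformₗᵢ R3 ℂ).map_sub f g
lemma fourier_smul' (c : ℂ) (f : L2) : (𝓕 (c • f) : L2) = c • (𝓕 f : L2) :=
  (Lp.fourierTransformₗᵢ R3 ℂ).map_smul c f

/-- The resolvent identity for the free resolvent. -/
lemma freeRes_sub {z z' : ℂ} (hz : 0 < z.im) (hz' : 0 < z'.im) (f : L2) :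
    freeRes z f - freeRes z' f = (z ^ 2 - z' ^ 2) • freeRes z' (freeRes z f) := by
  refine fourier_injective (Lp.ext ?_)
  rw [fourier_sub', fourier_smul']
  filter_upwards [Lp.coeFn_sub (𝓕 (freeRes z f) : L2) (𝓕 (freeRes z' f)),
    Lp.coeFn_smul (z ^ 2 - z' ^ 2) (𝓕 (freeRes z' (freeRes z f)) : L2),
    fourier_freeRes hz f, fourier_freeRes hz' f, fourier_freeRes hz' (freeRes z f)]
    with p h1 h2 h3 h4 h5
  rw [h1, h2, Pi.sub_apply, Pi.smul_apply, h3, h4, h5, h3, ← sub_mul, symb_sub hz hz', smul_eq_mul]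
  ring

lemma freeRes_injective {z : ℂ} (hz : 0 < z.im) {f : L2} (h : freeRes z f = 0) : f = 0 := by
  refine fourier_injective (Lp.ext ?_)
  have h0 : (𝓕 (0 : L2) : L2) = 0 := (Lp.fourierTransformₗᵢ R3 ℂ).map_zero
  have h1 := fourier_freeRes hz f
  rw [h, h0] at h1
  rw [h0]
  filter_upwards [h1, Lp.coeFn_zero ℂ 2 (volume : Measure R3)] with p h2 h3
  rw [h3] at h2 ⊢
  simpa [symb_ne_zero hz p] using h2.symm

/-! ### The free Green functions as elements of `L²` -/

lemma memLp_green_sub {z : ℂ} (hz : 0 < z.im) (y : R3) :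
    MemLp (fun x => green z (x - y)) 2 volume :=
  (memLp_green hz).comp_measurePreserving (measurePreserving_sub_right volume y)

/-- The free Green function with pole `y`, as an element of `L²` (`0` unless `Im z > 0`). -/
noncomputable def greenL (z : ℂ) (y : R3) : L2 :=
  open Classical in
  if hz : 0 < z.im then (memLp_green_sub hz y).toLp _ else 0

lemma coeFn_greenL {z : ℂ} (hz : 0 < z.im) (y : R3) :
    (greenL z y : R3 → ℂ) =ᵐ[volume] fun x => green z (x - y) := by
  rw [greenL, dif_pos hz]; exact MemLp.coeFn_toLp _

lemma fourier_greenL {z : ℂ} (hz : 0 < z.im) (y : R3) :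
    ((𝓕 (greenL z y) : L2) : R3 → ℂ) =ᵐ[volume]
      fun p => Complex.exp (((-2 * Real.pi * inner ℝ y p : ℝ) : ℂ) * Complex.I) * symb z p := by
  rw [greenL, dif_pos hz]
  refine (fourier_toLp_ae ((integrable_green hz).comp_sub_right y) _).trans (ae_of_all _ fun p => ?_)
  have := congrFun (VectorFourier.fourierIntegral_comp_add_right Real.fourierChar volume (innerₗ R3)
    (green z) (-y)) p
  have e : (green z ∘ fun v => v + -y) = fun x => green z (x - y) := by
    ext x; simp [sub_eq_add_neg]
  rw [e] at this
  have e2 : 𝓕 (green z) p = symb z p := fourier_green hz p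
  rw [show 𝓕 (fun x => green z (x - y)) p = _ from this,
    show VectorFourier.fourierIntegral Real.fourierChar volume (innerₗ R3) (green z) p = symb z p from e2,
    Circle.smul_def, Real.fourierChar_apply, smul_eq_mul]
  congr 3
  simp

/-- The resolvent identity, applied to a point source. -/
lemma greenL_sub {z z' : ℂ} (hz : 0 < z.im) (hz' : 0 < z'.im) (y : R3) :
    greenL z y - greenL z' y = (z ^ 2 - z' ^ 2) • freeRes z' (greenL z y) := by
  refine fourier_injective (Lp.ext ?_)
  rw [fourier_sub', fourier_smul']
  filter_upwards [Lp.coeFn_sub (𝓕 (greenL z y) : L2) (𝓕 (greenL z' y)),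
    Lp.coeFn_smul (z ^ 2 - z' ^ 2) (𝓕 (freeRes z' (greenL z y)) : L2),
    fourier_greenL hz y, fourier_greenL hz' y, fourier_freeRes hz' (greenL z y)]
    with p h1 h2 h3 h4 h5
  rw [h1, h2, Pi.sub_apply, Pi.smul_apply, h3, h4, h5, h3, ← mul_sub, symb_sub hz hz', smul_eq_mul]
  ring

/-- The value at `y` of the continuous representative of `freeRes z f`. -/
noncomputable def evalRes (z : ℂ) (f : L2) (y : R3) : ℂ :=
  inner ℂ (greenL (-starRingEnd ℂ z) y) f

lemma neg_conj_im (z : ℂ) : (-starRingEnd ℂ z).im = z.im := by simp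

lemma conj_green (z : ℂ) (x : R3) :
    starRingEnd ℂ (green (-starRingEnd ℂ z) x) = green z x := by
  simp only [green_eq, map_div₀, ← Complex.exp_conj, map_mul, map_neg, Complex.conj_I,
    Complex.conj_conj, Complex.conj_ofReal, map_ofNat]
  congr 2; ring

lemma evalRes_eq_integral {z : ℂ} (hz : 0 < z.im) (f : L2) (y : R3) :
    evalRes z f y = ∫ x, green z (x - y) * f x := by
  rw [evalRes, L2.inner_def]
  refine integral_congr_ae ?_
  filter_upwards [coeFn_greenL (by rwa [neg_conj_im]) y (z := -starRingEnd ℂ z)] with x hx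
  rw [hx, RCLike.inner_apply, conj_green, mul_comm]

lemma memLp_two_symb {z : ℂ} (hz : 0 < z.im) : MemLp (symb z) 2 (volume : Measure R3) := by
  refine (Lp.memLp (𝓕 (greenL z 0) : L2)).ae_eq ?_
  filter_upwards [fourier_greenL hz 0] with p hp
  rw [hp]; simp

lemma integrable_symb_mul {z : ℂ} (hz : 0 < z.im) (f : L2) :
    Integrable (fun p => symb z p * (𝓕 f : L2) p) :=
  (memLp_two_symb hz).integrable_mul (Lp.memLp _)

lemma evalRes_eq_fourierInv {z : ℂ} (hz : 0 < z.im) (f : L2) :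
    evalRes z f = 𝓕⁻ (fun p => symb z p * (𝓕 f : L2) p) := by
  ext y
  rw [evalRes, ← Lp.inner_fourier_eq, L2.inner_def, Real.fourierInv_eq']
  refine integral_congr_ae ?_
  filter_upwards [fourier_greenL (by rwa [neg_conj_im]) y (z := -starRingEnd ℂ z)] with p hp
  rw [hp, RCLike.inner_apply, map_mul, conj_symb, ← Complex.exp_conj, map_mul, Complex.conj_I,
    Complex.conj_ofReal, real_inner_comm, smul_eq_mul]
  push_cast
  ring_nf

lemma continuous_evalRes {z : ℂ} (hz : 0 < z.im) (f : L2) : Continuous (evalRes z f) := by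
  rw [evalRes_eq_fourierInv hz]
  have hc := VectorFourier.fourierIntegral_continuous Real.continuous_fourierChar
      (L := innerₗ R3) (by exact continuous_inner) (integrable_symb_mul hz f)
  have : 𝓕⁻ (fun p => symb z p * (𝓕 f : L2) p)
      = fun x => 𝓕 (fun p => symb z p * (𝓕 f : L2) p) (-x) := by
    ext x; exact Real.fourierInv_eq_fourier_neg _ x
  rw [this]; exact hc.comp continuous_neg

/-- `evalRes z f` is the continuous representative of `freeRes z f`: the Fourier transform of the
latter is a product of two `L²` functions, hence integrable. -/
lemma freeRes_ae_eq {z : ℂ} (hz : 0 < z.im) (f : L2) :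
    (freeRes z f : R3 → ℂ) =ᵐ[volume] evalRes z f := by
  have h2 : MemLp (fun p => symb z p * (𝓕 f : L2) p) 2 volume :=
    (Lp.memLp (𝓕 (freeRes z f) : L2)).ae_eq (fourier_freeRes hz f)
  have e : (𝓕 (freeRes z f) : L2) = h2.toLp _ :=
    Lp.ext ((fourier_freeRes hz f).trans h2.coeFn_toLp.symm)
  have e2 : freeRes z f = 𝓕⁻ (h2.toLp _) := by
    rw [← e]; exact ((Lp.fourierTransformₗᵢ R3 ℂ).symm_apply_apply _).symm
  rw [e2, evalRes_eq_fourierInv hz]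
  exact fourierInv_toLp_ae (integrable_symb_mul hz f) h2

lemma evalRes_add (z : ℂ) (f g : L2) (y : R3) : evalRes z (f + g) y = evalRes z f y + evalRes z g y :=
  inner_add_right _ _ _
lemma evalRes_smul (z c : ℂ) (f : L2) (y : R3) : evalRes z (c • f) y = c * evalRes z f y :=
  inner_smul_right _ _ _

lemma evalRes_sub {z z' : ℂ} (hz : 0 < z.im) (hz' : 0 < z'.im) (f : L2) (y : R3) :
    evalRes z f y - evalRes z' f y = (z ^ 2 - z' ^ 2) * evalRes z' (freeRes z f) y := by
  have h1 : Continuous fun y => evalRes z f y - evalRes z' f y :=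
    (continuous_evalRes hz f).sub (continuous_evalRes hz' f)
  have h2 : Continuous fun y => (z ^ 2 - z' ^ 2) * evalRes z' (freeRes z f) y :=
    continuous_const.mul (continuous_evalRes hz' _)
  refine congrFun ((h1.ae_eq_iff_eq volume h2).1 ?_) y
  have h3 := congrArg (fun u : L2 => (u : R3 → ℂ)) (freeRes_sub hz hz' f)
  filter_upwards [Lp.coeFn_sub (freeRes z f) (freeRes z' f),
    Lp.coeFn_smul (z ^ 2 - z' ^ 2) (freeRes z' (freeRes z f)), freeRes_ae_eq hz f,
    freeRes_ae_eq hz' f, freeRes_ae_eq hz' (freeRes z f)] with x e1 e2 e3 e4 e5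
  rw [← e3, ← e4, ← e5]
  have := congrFun h3 x
  simp only [e1, e2, Pi.sub_apply, Pi.smul_apply, smul_eq_mul] at this
  exact this

/-- The difference of two free Green functions, continuously extended to the pole. -/
noncomputable def greenDiff (z z' : ℂ) (x : R3) : ℂ :=
  if x = 0 then Complex.I * (z - z') / (4 * (Real.pi : ℂ)) else green z x - green z' x

lemma continuous_greenDiff (z z' : ℂ) : Continuous (greenDiff z z') := by
  let F : ℝ → ℂ := fun r => Complex.exp (Complex.I * z * r) - Complex.exp (Complex.I * z' * r)
  have hF : HasDerivAt F (Complex.I * (z - z')) 0 := by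
    have h1 := ((Complex.ofRealCLM.hasDerivAt (x := 0)).const_mul (Complex.I * z)).cexp
    have h2 := ((Complex.ofRealCLM.hasDerivAt (x := 0)).const_mul (Complex.I * z')).cexp
    refine (h1.sub h2).congr_deriv ?_
    simp; ring
  have e : greenDiff z z' = fun x => dslope F 0 ‖x‖ / (4 * (Real.pi : ℂ)) := by
    ext x
    by_cases hx : x = 0
    · simp [greenDiff, hx, hF.deriv]
    · have hn : ‖x‖ ≠ 0 := by simpa using hx
      rw [greenDiff, if_neg hx, green_eq, green_eq, dslope_of_ne _ hn, slope_def_module]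
      have : (‖x‖ : ℂ) ≠ 0 := by exact_mod_cast hn
      have h4 : (Real.pi : ℂ) ≠ 0 := by exact_mod_cast Real.pi_ne_zero
      simp [F]
      field_simp
  have hc : Continuous (dslope F 0) := by
    rw [continuous_iff_continuousAt]
    intro r
    by_cases hr : r = 0
    · rw [hr, continuousAt_dslope_same]; exact hF.differentiableAt
    · rw [continuousAt_dslope_of_ne hr]; fun_prop
  rw [e]
  exact (hc.comp continuous_norm).div_const _

/-- The value at a point of the resolvent applied to a Green function, by continuity also at the pole. -/
lemma evalRes_greenL {z z' : ℂ} (hz : 0 < z.im) (hz' : 0 < z'.im) (y y' : R3) :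
    (z ^ 2 - z' ^ 2) * evalRes z' (greenL z y) y' = greenDiff z z' (y' - y) := by
  have h1 : Continuous fun x => (z ^ 2 - z' ^ 2) * evalRes z' (greenL z y) x :=
    continuous_const.mul (continuous_evalRes hz' _)
  have h2 : Continuous fun x => greenDiff z z' (x - y) :=
    (continuous_greenDiff z z').comp (continuous_id.sub continuous_const)
  refine congrFun ((h1.ae_eq_iff_eq volume h2).1 ?_) y'
  have h3 := congrArg (fun u : L2 => (u : R3 → ℂ)) (greenL_sub hz hz' y)
  filter_upwards [Lp.coeFn_sub (greenL z y) (greenL z' y),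
    Lp.coeFn_smul (z ^ 2 - z' ^ 2) (freeRes z' (greenL z y)), coeFn_greenL hz y,
    coeFn_greenL hz' y, freeRes_ae_eq hz' (greenL z y), Measure.ae_ne volume y]
    with x e1 e2 e3 e4 e5 e6
  have := congrFun h3 x
  simp only [e1, e2, Pi.sub_apply, Pi.smul_apply, e3, e4, e5, smul_eq_mul] at this
  rw [← this, greenDiff, if_neg (sub_ne_zero.2 e6)]

/-- The two terms of `Γ` combine so that its variation in `z` is the regularized Green function; on the
diagonal this is the value of `greenDiff` at the pole. -/
lemma Gam_sub_Gam {N : ℕ} (α : Fin N → ℝ) {Y : Fin N → R3} (hY : Function.Injective Y) (z z' : ℂ)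
    (j l : Fin N) :
    Gam α Y z' j l - Gam α Y z j l = greenDiff z z' (Y j - Y l) := by
  have hg : ∀ w, green w 0 = 0 := fun w => by simp [green]
  by_cases h : j = l
  · subst h
    simp [Gam, greenDiff, hg]; ring
  · have : Y j - Y l ≠ 0 := sub_ne_zero.2 (hY.ne h)
    simp [Gam, greenDiff, h, this]; ring

lemma sum_greenL_apply {N : ℕ} {z : ℂ} (hz : 0 < z.im) (Y : Fin N → R3) (a : Fin N → ℂ) :
    ((∑ j, a j • greenL z (Y j) : L2) : R3 → ℂ) =ᵐ[volume] fun x => ∑ j, a j * green z (x - Y j) := by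
  have h1 := Lp.coeFn_finsetSum (Finset.univ) (fun j => a j • greenL z (Y j))
  have h2 : ∀ᵐ x, ∀ j, (a j • greenL z (Y j) : L2) x = a j * green z (x - Y j) := by
    rw [ae_all_iff]; intro j
    filter_upwards [Lp.coeFn_smul (a j) (greenL z (Y j)), coeFn_greenL hz (Y j)] with x e1 e2
    rw [e1, Pi.smul_apply, e2, smul_eq_mul]
  filter_upwards [h1, h2] with x e1 e2
  rw [e1, Finset.sum_apply]
  exact Finset.sum_congr rfl fun j _ => e2 j

/-- The singularities of the free Green functions with poles in `Y` are independent modulo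
continuous functions. -/
lemma coeff_eq_zero_of_sum_green_continuous {N : ℕ} (z : ℂ) {Y : Fin N → R3}
    (hY : Function.Injective Y) (a : Fin N → ℂ) {h : R3 → ℂ} (hh : Continuous h)
    (hae : (fun x => ∑ j, a j * green z (x - Y j)) =ᵐ[volume] h) : a = 0 := by
  funext k
  let U : Set R3 := (range Y)ᶜ
  have hUo : IsOpen U := (finite_range Y).isClosed.isOpen_compl
  have hcont : ContinuousOn (fun x => ∑ j, a j * green z (x - Y j)) U := by
    refine continuousOn_finsetSum _ fun j _ => continuousOn_const.mul ?_
    refine (continuousOn_green z).comp (by fun_prop) ?_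
    intro x hx
    simp only [mem_compl_iff, mem_singleton_iff, sub_eq_zero]
    rintro rfl; exact hx (mem_range_self j)
  have heq := Measure.eqOn_open_of_ae_eq (ae_restrict_of_ae hae) hUo hcont hh.continuousOn
  have hU : U ∈ 𝓝[≠] (Y k) := by
    have : ((Y '' {k}ᶜ)ᶜ : Set R3) ∈ 𝓝 (Y k) := by
      refine ((finite_range Y).subset (image_subset_range _ _)).isClosed.isOpen_compl.mem_nhds ?_
      rintro ⟨j, hj, e⟩; exact hj (hY e)
    filter_upwards [mem_nhdsWithin_of_mem_nhds this, self_mem_nhdsWithin] with x hx1 hx2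
    rintro ⟨j, rfl⟩
    by_cases hjk : j = k
    · exact hx2 (by rw [hjk]; rfl)
    · exact hx1 ⟨j, hjk, rfl⟩
  have hn : Tendsto (fun x => ((‖x - Y k‖ : ℝ) : ℂ)) (𝓝[≠] (Y k)) (𝓝 0) := by
    have : Continuous fun x => ((‖x - Y k‖ : ℝ) : ℂ) := by fun_prop
    have h2 := this.tendsto (Y k)
    simp only [sub_self, norm_zero, Complex.ofReal_zero] at h2
    exact h2.mono_left nhdsWithin_le_nhds
  -- The coefficient `a k` is read off from the limit of `‖x - y_k‖` times the sum, which is zero for a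
  -- continuous function.
  have hlim1 : Tendsto (fun x => ((‖x - Y k‖ : ℝ) : ℂ) * h x) (𝓝[≠] (Y k)) (𝓝 0) := by
    have := hn.mul ((hh.tendsto (Y k)).mono_left nhdsWithin_le_nhds)
    simpa using this
  have hterm : ∀ j, Tendsto (fun x => ((‖x - Y k‖ : ℝ) : ℂ) * (a j * green z (x - Y j)))
      (𝓝[≠] (Y k)) (𝓝 (if j = k then a k / (4 * Real.pi) else 0)) := by
    intro j
    by_cases hjk : j = k
    · subst hjk
      rw [if_pos rfl]
      have hc : Continuous fun x : R3 => a j * Complex.exp (Complex.I * z * (‖x - Y j‖ : ℂ)) / (4 * Real.pi) := by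
        fun_prop
      have h2 := (hc.tendsto (Y j)).mono_left (nhdsWithin_le_nhds (s := {Y j}ᶜ))
      simp only [sub_self, norm_zero, Complex.ofReal_zero, mul_zero, Complex.exp_zero, mul_one] at h2
      refine h2.congr' ?_
      filter_upwards [self_mem_nhdsWithin] with x hx
      have hx' : ((‖x - Y j‖ : ℝ) : ℂ) ≠ 0 := by
        have : ‖x - Y j‖ ≠ 0 := norm_ne_zero_iff.2 (sub_ne_zero.2 hx)
        exact_mod_cast this
      have h4 : (Real.pi : ℂ) ≠ 0 := by exact_mod_cast Real.pi_ne_zero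
      rw [green_eq]; field_simp
    · rw [if_neg hjk]
      have hc : ContinuousAt (fun x => green z (x - Y j)) (Y k) := by
        have h0 : Y k - Y j ∈ ({0}ᶜ : Set R3) := by
          simpa [sub_eq_zero] using fun e => hjk (hY e).symm
        have := (continuousOn_green z).continuousAt (isOpen_compl_singleton.mem_nhds h0)
        exact ContinuousAt.comp (f := fun x => x - Y j) this (by fun_prop)
      have := hn.mul ((hc.tendsto.mono_left (nhdsWithin_le_nhds (s := {Y k}ᶜ))).const_mul (a j))
      simpa using this
  have hlim2 : Tendsto (fun x => ((‖x - Y k‖ : ℝ) : ℂ) * h x) (𝓝[≠] (Y k)) (𝓝 (a k / (4 * Real.pi))) := by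
    have := tendsto_finsetSum Finset.univ fun j (_ : j ∈ Finset.univ) => hterm j
    simp only [Finset.sum_ite_eq', Finset.mem_univ, if_true] at this
    refine this.congr' ?_
    filter_upwards [hU] with x hx
    rw [← heq hx, Finset.mul_sum]
  have := tendsto_nhds_unique hlim1 hlim2
  have h4 : (Real.pi : ℂ) ≠ 0 := by exact_mod_cast Real.pi_ne_zero
  have h5 : a k / (4 * (Real.pi : ℂ)) = 0 := this.symm
  simpa [h4] using h5

lemma greenL_linearIndependent {N : ℕ} {z : ℂ} (hz : 0 < z.im) {Y : Fin N → R3}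
    (hY : Function.Injective Y) {a : Fin N → ℂ} (h : ∑ j, a j • greenL z (Y j) = 0) : a = 0 := by
  refine coeff_eq_zero_of_sum_green_continuous z hY a (h := 0) continuous_zero ?_
  have := sum_greenL_apply hz Y a
  rw [h] at this
  exact this.symm.trans (Lp.coeFn_zero _ _ _)

/-! ### The Helmholtz equation in `H²` -/

/-- Multiplication of the tempered distribution of an `L²` function by a function of temperate growth
is the tempered distribution of the pointwise product, as soon as the latter is in `L²`. -/
lemma smulLeftCLM_coe_eq_iff {g : R3 → ℂ} (hg : g.HasTemperateGrowth) (u v : L2) :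
    TemperedDistribution.smulLeftCLM ℂ g (u : 𝓢'(R3, ℂ)) = (v : 𝓢'(R3, ℂ)) ↔
      (fun x => g x * u x) =ᵐ[volume] (v : R3 → ℂ) := by
  constructor
  · intro h
    have hgc : Continuous g := hg.1.continuous
    have hloc : LocallyIntegrable (fun x => g x * u x) := by
      have hu : LocallyIntegrable (u : R3 → ℂ) := (Lp.memLp u).locallyIntegrable (by norm_num)
      have := (locallyIntegrableOn_univ.2 hu).continuousOn_smul isOpen_univ.isLocallyClosed
        hgc.continuousOn
      exact locallyIntegrableOn_univ.1 this
    refine ae_eq_of_integral_contDiff_smul_eq hloc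
      ((Lp.memLp v).locallyIntegrable (by norm_num)) ?_
    intro φ hφ hφs
    have hcs : HasCompactSupport (fun x => (φ x : ℂ)) :=
      hφs.comp_left (g := fun r : ℝ => (r : ℂ)) rfl
    have hcd : ContDiff ℝ (⊤ : ℕ∞) (fun x => (φ x : ℂ)) := Complex.ofRealCLM.contDiff.comp hφ
    let s : 𝓢(R3, ℂ) := hcs.toSchwartzMap hcd
    have hs : ∀ x, s x = (φ x : ℂ) := fun x => rfl
    have h1 := congrArg (fun d : 𝓢'(R3, ℂ) => d s) h
    simp only [TemperedDistribution.smulLeftCLM_apply_apply, Lp.toTemperedDistribution_apply,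
      SchwartzMap.smulLeftCLM_apply_apply hg, hs, smul_eq_mul] at h1
    simp only [Complex.real_smul]
    rw [← h1]
    refine integral_congr_ae (ae_of_all _ fun x => ?_)
    simp only; ring
  · intro h
    ext s
    simp only [TemperedDistribution.smulLeftCLM_apply_apply, Lp.toTemperedDistribution_apply,
      SchwartzMap.smulLeftCLM_apply_apply hg, smul_eq_mul]
    refine integral_congr_ae ?_
    filter_upwards [h] with x hx
    rw [← hx]; ring

lemma toTempered_smul (c : ℂ) (u : L2) : ((c • u : L2) : 𝓢'(R3, ℂ)) = c • (u : 𝓢'(R3, ℂ)) :=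
  (Lp.toTemperedDistributionCLM ℂ (volume : Measure R3) 2).map_smul c u

lemma toTempered_add (u v : L2) : ((u + v : L2) : 𝓢'(R3, ℂ)) = (u : 𝓢'(R3, ℂ)) + (v : 𝓢'(R3, ℂ)) :=
  (Lp.toTemperedDistributionCLM ℂ (volume : Measure R3) 2).map_add u v

lemma hasTemperateGrowth_norm_sq : (fun x : R3 => Complex.ofReal (‖x‖ ^ 2)).HasTemperateGrowth := by
  fun_prop

/-- The Helmholtz equation `(-Δ - z²) φ = f` in `L²` is solved by the free resolvent only. -/
lemma helmholtz_iff {z : ℂ} (hz : 0 < z.im) (φ f : L2) :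
    (f : 𝓢'(R3, ℂ)) = -Δ (φ : 𝓢'(R3, ℂ)) - z ^ 2 • (φ : 𝓢'(R3, ℂ)) ↔ φ = freeRes z f := by
  have hpi : (Real.pi : ℂ) ≠ 0 := by exact_mod_cast Real.pi_ne_zero
  set S := TemperedDistribution.smulLeftCLM ℂ (fun x : R3 => Complex.ofReal (‖x‖ ^ 2))
    (𝓕 (φ : 𝓢'(R3, ℂ))) with hS
  have hFinj : ∀ a b : 𝓢'(R3, ℂ), 𝓕 a = 𝓕 b ↔ a = b := fun a b =>
    ⟨fun h => by
      have := congrArg (fun u : 𝓢'(R3, ℂ) => 𝓕⁻ u) h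
      simpa using this, fun h => by rw [h]⟩
  have hLap : 𝓕 (Δ (φ : 𝓢'(R3, ℂ))) = (-(2 * (Real.pi : ℂ)) ^ 2) • S := by
    rw [TemperedDistribution.laplacian_eq_fourierMultiplierCLM,
      TemperedDistribution.fourierMultiplierCLM_apply, ← hS]
    have : ((-(2 * Real.pi) ^ 2 : ℝ) • 𝓕⁻ S : 𝓢'(R3, ℂ)) = (-(2 * (Real.pi : ℂ)) ^ 2) • 𝓕⁻ S := by
      ext s
      simp only [smul_apply, Complex.real_smul, smul_eq_mul]
      push_cast; rfl
    rw [this, FourierTransform.fourier_smul, FourierTransform.fourier_fourierInv_eq]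
  have key : (f : 𝓢'(R3, ℂ)) = -Δ (φ : 𝓢'(R3, ℂ)) - z ^ 2 • (φ : 𝓢'(R3, ℂ)) ↔
      S = (((2 * (Real.pi : ℂ)) ^ 2)⁻¹ • ((𝓕 f : L2) + z ^ 2 • (𝓕 φ : L2)) : L2) := by
    rw [← hFinj, toTempered_smul, toTempered_add, toTempered_smul,
      ← Lp.fourier_toTemperedDistribution_eq f, ← Lp.fourier_toTemperedDistribution_eq φ]
    have e : 𝓕 (-Δ (φ : 𝓢'(R3, ℂ)) - z ^ 2 • (φ : 𝓢'(R3, ℂ)))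
        = (2 * (Real.pi : ℂ)) ^ 2 • S - z ^ 2 • 𝓕 (φ : 𝓢'(R3, ℂ)) := by
      have e1 : -Δ (φ : 𝓢'(R3, ℂ)) - z ^ 2 • (φ : 𝓢'(R3, ℂ))
          = (-1 : ℂ) • Δ (φ : 𝓢'(R3, ℂ)) + (-z ^ 2) • (φ : 𝓢'(R3, ℂ)) := by
        rw [neg_smul, neg_smul, one_smul, sub_eq_add_neg]
      rw [e1, FourierTransform.fourier_add, FourierTransform.fourier_smul,
        FourierTransform.fourier_smul, hLap, smul_smul, neg_smul, ← sub_eq_add_neg]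
      congr 2; ring
    rw [e]
    constructor
    · intro h
      rw [h, sub_add_cancel, smul_smul, inv_mul_cancel₀ (by simp [hpi]), one_smul]
    · intro h
      rw [h, smul_smul, mul_inv_cancel₀ (by simp [hpi]), one_smul, add_sub_cancel_right]
  rw [key, hS, Lp.fourier_toTemperedDistribution_eq φ,
    smulLeftCLM_coe_eq_iff hasTemperateGrowth_norm_sq]
  have hcoe : ((((2 * (Real.pi : ℂ)) ^ 2)⁻¹ • ((𝓕 f : L2) + z ^ 2 • (𝓕 φ : L2)) : L2) : R3 → ℂ)
      =ᵐ[volume] fun p => ((2 * (Real.pi : ℂ)) ^ 2)⁻¹ * ((𝓕 f : L2) p + z ^ 2 * (𝓕 φ : L2) p) := by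
    filter_upwards [Lp.coeFn_smul ((2 * (Real.pi : ℂ)) ^ 2)⁻¹ ((𝓕 f : L2) + z ^ 2 • (𝓕 φ : L2)),
      Lp.coeFn_add (𝓕 f : L2) (z ^ 2 • (𝓕 φ : L2)), Lp.coeFn_smul (z ^ 2) (𝓕 φ : L2)] with p h1 h2 h3
    rw [h1, Pi.smul_apply, h2, Pi.add_apply, h3, Pi.smul_apply, smul_eq_mul, smul_eq_mul]
  have hpt : ∀ (p : R3) (a b : ℂ), Complex.ofReal (‖p‖ ^ 2) * a =
      ((2 * (Real.pi : ℂ)) ^ 2)⁻¹ * (b + z ^ 2 * a) ↔ a = symb z p * b := by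
    intro p a b
    have h1 := symb_denom_ne hz p
    rw [symb, eq_inv_mul_iff_mul_eq₀ h1, eq_inv_mul_iff_mul_eq₀ (by simp [hpi])]
    push_cast
    constructor <;> intro h <;> linear_combination h
  constructor
  · intro h
    refine fourier_injective (Lp.ext ?_)
    filter_upwards [h, hcoe, fourier_freeRes hz f] with p h1 h2 h3
    rw [h3]
    exact (hpt p _ _).1 (h1.trans h2)
  · intro h
    have h' := fourier_freeRes hz f
    rw [← h] at h'
    filter_upwards [hcoe, h'] with p h2 h3
    rw [h2]
    exact (hpt p _ _).2 h3

/-- `(1 + |p|²) φ̂` is a combination of `f̂` and `φ̂` for `φ = freeRes z f`. -/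
lemma memSobolev_freeRes {z : ℂ} (hz : 0 < z.im) (f : L2) :
    TemperedDistribution.MemSobolev 2 2 (freeRes z f : 𝓢'(R3, ℂ)) := by
  have hpi : (Real.pi : ℂ) ≠ 0 := by exact_mod_cast Real.pi_ne_zero
  rw [TemperedDistribution.memSobolev_iff_exists_smulLeftCLM_fourier]
  refine ⟨(4 * (Real.pi : ℂ) ^ 2)⁻¹ •
    ((𝓕 f : L2) + (z ^ 2 + 4 * (Real.pi : ℂ) ^ 2) • (𝓕 (freeRes z f) : L2)), ?_⟩
  rw [Lp.fourier_toTemperedDistribution_eq]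
  have hg : (fun x : R3 => (((1 + ‖x‖ ^ 2) ^ ((2 : ℝ) / 2) : ℝ) : ℂ)) =
      fun x : R3 => Complex.ofReal (1 + ‖x‖ ^ 2) := by ext x; simp
  rw [hg, smulLeftCLM_coe_eq_iff (by fun_prop)]
  filter_upwards [Lp.coeFn_smul (4 * (Real.pi : ℂ) ^ 2)⁻¹ ((𝓕 f : L2) +
      (z ^ 2 + 4 * (Real.pi : ℂ) ^ 2) • (𝓕 (freeRes z f) : L2)),
    Lp.coeFn_add (𝓕 f : L2) ((z ^ 2 + 4 * (Real.pi : ℂ) ^ 2) • (𝓕 (freeRes z f) : L2)),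
    Lp.coeFn_smul (z ^ 2 + 4 * (Real.pi : ℂ) ^ 2) (𝓕 (freeRes z f) : L2),
    fourier_freeRes hz f] with p h1 h2 h3 h4
  rw [h1, Pi.smul_apply, h2, Pi.add_apply, h3, Pi.smul_apply, smul_eq_mul, smul_eq_mul, h4, symb]
  have h5 := mul_inv_cancel₀ (symb_denom_ne hz p)
  rw [eq_inv_mul_iff_mul_eq₀ (by simp [hpi])]
  push_cast
  linear_combination ((𝓕 f : L2) p) * h5

/-! ### Krein's formula -/

variable {N : ℕ}

/-- The resolvent `(H_{α,Y} - z²)⁻¹`, by Krein's formula. -/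
noncomputable def kreinRes (α : Fin N → ℝ) (Y : Fin N → R3) (z : ℂ) : L2 →L[ℂ] L2 :=
  freeRes z + ∑ j, ∑ l, ((Gam α Y z)⁻¹ j l) •
    (innerSL ℂ (greenL (-starRingEnd ℂ z) (Y l))).smulRight (greenL z (Y j))

lemma kreinRes_apply (α : Fin N → ℝ) (Y : Fin N → R3) (z : ℂ) (f : L2) :
    kreinRes α Y z f = freeRes z f +
      ∑ j, ((Gam α Y z)⁻¹.mulVec fun l => evalRes z f (Y l)) j • greenL z (Y j) := by
  simp only [kreinRes, add_apply, sum_apply, smul_apply, ContinuousLinearMap.smulRight_apply,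
    innerSL_apply_apply, Matrix.mulVec, dotProduct, Finset.sum_smul, smul_smul]
  rfl

lemma kreinRes_apply_of_mulVec_eq {α : Fin N → ℝ} {Y : Fin N → R3} {z : ℂ}
    (hG : IsUnit (Gam α Y z)) {f : L2} {a : Fin N → ℂ}
    (ha : (Gam α Y z).mulVec a = fun l => evalRes z f (Y l)) :
    kreinRes α Y z f = freeRes z f + ∑ j, a j • greenL z (Y j) := by
  rw [kreinRes_apply, ← ha, Matrix.mulVec_mulVec,
    Matrix.nonsing_inv_mul _ ((Matrix.isUnit_iff_isUnit_det _).1 hG), Matrix.one_mulVec]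

lemma Gam_mulVec_inv_mulVec {α : Fin N → ℝ} {Y : Fin N → R3} {z : ℂ}
    (hG : IsUnit (Gam α Y z)) (v : Fin N → ℂ) :
    (Gam α Y z).mulVec ((Gam α Y z)⁻¹.mulVec v) = v := by
  rw [Matrix.mulVec_mulVec, Matrix.mul_nonsing_inv _ ((Matrix.isUnit_iff_isUnit_det _).1 hG),
    Matrix.one_mulVec]

/-- The domain condition of the Hamiltonian says that `ψ` is in the range of a Krein resolvent. -/
lemma mem_hamiltonian_iff (α : Fin N → ℝ) (Y : Fin N → R3) (ψ g : L2) :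
    (ψ, g) ∈ hamiltonian α Y ↔ ∃ z : ℂ, 0 < z.im ∧ IsUnit (Gam α Y z) ∧
      ψ = kreinRes α Y z (g - z ^ 2 • ψ) := by
  constructor
  · rintro ⟨z, φ, φc, hz, hG, -, hφc, hae, hψ, heq⟩
    refine ⟨z, hz, hG, ?_⟩
    have hφ := (helmholtz_iff hz φ (g - z ^ 2 • ψ)).1 heq
    have hval : φc = evalRes z (g - z ^ 2 • ψ) := by
      refine (hφc.ae_eq_iff_eq volume (continuous_evalRes hz _)).1 ?_
      have := freeRes_ae_eq hz (g - z ^ 2 • ψ)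
      rw [← hφ] at this
      exact hae.symm.trans this
    rw [kreinRes_apply, ← hφ, ← hval]
    refine Lp.ext ?_
    filter_upwards [hψ, hae, sum_greenL_apply hz Y ((Gam α Y z)⁻¹.mulVec fun l => φc (Y l)),
      Lp.coeFn_add φ (∑ j, ((Gam α Y z)⁻¹.mulVec fun l => φc (Y l)) j • greenL z (Y j))]
      with x h1 h2 h3 h4
    rw [h1, h4, Pi.add_apply, h2, h3]
  · rintro ⟨z, hz, hG, hψ⟩
    refine ⟨z, freeRes z (g - z ^ 2 • ψ), evalRes z (g - z ^ 2 • ψ), hz, hG,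
      memSobolev_freeRes hz _, continuous_evalRes hz _, freeRes_ae_eq hz _, ?_,
      (helmholtz_iff hz _ _).2 rfl⟩
    rw [kreinRes_apply] at hψ
    simp only
    set f := g - z ^ 2 • ψ with hf
    set a := ((Gam α Y z)⁻¹.mulVec fun l => evalRes z f (Y l)) with ha
    have e : (ψ : R3 → ℂ) = ((freeRes z f + ∑ j, a j • greenL z (Y j) : L2) : R3 → ℂ) :=
      congrArg (fun u : L2 => (u : R3 → ℂ)) hψ
    rw [e]
    filter_upwards [freeRes_ae_eq hz f, sum_greenL_apply hz Y a,
      Lp.coeFn_add (freeRes z f) (∑ j, a j • greenL z (Y j))] with x h2 h3 h4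
    rw [h4, Pi.add_apply, h2, h3]

lemma evalRes_sum (z : ℂ) (a : Fin N → ℂ) (u : Fin N → L2) (y : R3) :
    evalRes z (∑ j, a j • u j) y = ∑ j, a j * evalRes z (u j) y := by
  simp only [evalRes, inner_sum, inner_smul_right]

/-- The first resolvent identity, in a form that does not presuppose that `Γ(z)` is invertible. -/
lemma kreinRes_resolvent_identity {α : Fin N → ℝ} {Y : Fin N → R3} (hY : Function.Injective Y)
    {z z' : ℂ} (hz : 0 < z.im) (hz' : 0 < z'.im) (hG : IsUnit (Gam α Y z')) {f ψ : L2}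
    {a : Fin N → ℂ} (ha : (Gam α Y z).mulVec a = fun l => evalRes z f (Y l))
    (hψ : ψ = freeRes z f + ∑ j, a j • greenL z (Y j)) :
    kreinRes α Y z' (f + (z ^ 2 - z' ^ 2) • ψ) = ψ := by
  set d := z ^ 2 - z' ^ 2 with hd
  have h1 : freeRes z' (f + d • ψ) = freeRes z f +
      ∑ j, a j • (greenL z (Y j) - greenL z' (Y j)) := by
    have e1 := freeRes_sub hz hz' f
    have e2 : ∀ j, a j • (greenL z (Y j) - greenL z' (Y j)) =
        d • freeRes z' (a j • greenL z (Y j)) := by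
      intro j; rw [greenL_sub hz hz', map_smul, smul_comm]
    simp only [e2, ← Finset.smul_sum, ← map_sum]
    rw [map_add, map_smul, hψ, map_add, smul_add, ← e1]
    abel
  have h2 : (Gam α Y z').mulVec a = fun l => evalRes z' (f + d • ψ) (Y l) := by
    funext l
    have e1 := evalRes_sub hz hz' f (Y l)
    rw [evalRes_add, evalRes_smul, hψ, evalRes_add, mul_add, ← e1, evalRes_sum, Finset.mul_sum]
    have e2 : ∀ j, d * (a j * evalRes z' (greenL z (Y j)) (Y l)) =
        (Gam α Y z' l j - Gam α Y z l j) * a j := by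
      intro j
      rw [Gam_sub_Gam α hY, ← evalRes_greenL hz hz']; ring
    simp only [e2, sub_mul, Finset.sum_sub_distrib]
    have e3 := congrFun ha l
    simp only [Matrix.mulVec, dotProduct] at e3 ⊢
    rw [e3]; ring
  rw [kreinRes_apply_of_mulVec_eq hG h2, h1, hψ, add_assoc, ← Finset.sum_add_distrib]
  congr 1
  refine Finset.sum_congr rfl fun j _ => ?_
  rw [smul_sub, sub_add_cancel]

lemma kreinRes_eq_of_unit {α : Fin N → ℝ} {Y : Fin N → R3} (hY : Function.Injective Y)
    {z z' : ℂ} (hz : 0 < z.im) (hz' : 0 < z'.im) (hG : IsUnit (Gam α Y z)) (hG' : IsUnit (Gam α Y z'))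
    (f : L2) : kreinRes α Y z' (f + (z ^ 2 - z' ^ 2) • kreinRes α Y z f) = kreinRes α Y z f :=
  kreinRes_resolvent_identity hY hz hz' hG' (Gam_mulVec_inv_mulVec hG _) (kreinRes_apply α Y z f)

/-- The graph of the Hamiltonian in terms of a single resolvent. -/
lemma mem_hamiltonian_iff_of_unit {α : Fin N → ℝ} {Y : Fin N → R3} (hY : Function.Injective Y)
    {z : ℂ} (hz : 0 < z.im) (hG : IsUnit (Gam α Y z)) (ψ g : L2) :
    (ψ, g) ∈ hamiltonian α Y ↔ ψ = kreinRes α Y z (g - z ^ 2 • ψ) := by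
  rw [mem_hamiltonian_iff]
  refine ⟨?_, fun h => ⟨z, hz, hG, h⟩⟩
  rintro ⟨z', hz', hG', h⟩
  have := kreinRes_eq_of_unit hY hz' hz hG' hG (g - z' ^ 2 • ψ)
  rw [← h] at this
  rw [← this]
  congr 1
  rw [this, sub_smul]; abel

/-- The pole part of `R(z) f` is discontinuous, so if `R(z) f = 0` its coefficients vanish. -/
lemma kreinRes_injective {α : Fin N → ℝ} {Y : Fin N → R3} (hY : Function.Injective Y)
    {z : ℂ} (hz : 0 < z.im) {f : L2} (h : kreinRes α Y z f = 0) :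
    f = 0 := by
  rw [kreinRes_apply] at h
  set a := ((Gam α Y z)⁻¹.mulVec fun l => evalRes z f (Y l)) with ha
  have h0 : a = 0 := by
    refine coeff_eq_zero_of_sum_green_continuous z hY a (continuous_evalRes hz f).neg ?_
    have e : ((∑ j, a j • greenL z (Y j) : L2) : R3 → ℂ) = ((-freeRes z f : L2) : R3 → ℂ) :=
      congrArg (fun u : L2 => (u : R3 → ℂ)) (eq_neg_of_add_eq_zero_right h)
    refine (sum_greenL_apply hz Y a).symm.trans ?_
    rw [e]
    filter_upwards [Lp.coeFn_neg (freeRes z f), freeRes_ae_eq hz f] with x h1 h2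
    rw [h1, Pi.neg_apply, h2, Pi.neg_apply]
  have : freeRes z f = 0 := by simpa [h0] using h
  exact freeRes_injective hz this

/-! ### Positivity of the resolvent far to the left of the spectrum -/

/-- The points `z` and `-conj z` have conjugate squares, so this is the symmetry that makes the
resolvent at the conjugate energy the adjoint one. -/
lemma conjTranspose_Gam (α : Fin N → ℝ) (Y : Fin N → R3) (z : ℂ) :
    (Gam α Y z)ᴴ = Gam α Y (-starRingEnd ℂ z) := by
  ext j l
  have h1 : starRingEnd ℂ (green z (Y l - Y j)) = green (-starRingEnd ℂ z) (Y j - Y l) := by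
    rw [← conj_green, Complex.conj_conj, green_eq, green_eq, norm_sub_rev]
  simp only [Matrix.conjTranspose_apply, Gam, Matrix.of_apply, RCLike.star_def, map_sub, h1]
  congr 1
  by_cases h : j = l
  · subst h
    simp only [if_true, map_sub, map_div₀, map_mul, Complex.conj_I, Complex.conj_ofReal, map_ofNat]
    ring
  · rw [if_neg h, if_neg (Ne.symm h), map_zero]

lemma neg_conj_I_mul (κ : ℝ) : -starRingEnd ℂ (Complex.I * κ) = Complex.I * κ := by simp

lemma isHermitian_Gam (α : Fin N → ℝ) (Y : Fin N → R3) (κ : ℝ) :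
    (Gam α Y (Complex.I * κ)).IsHermitian := by
  rw [Matrix.IsHermitian, conjTranspose_Gam, neg_conj_I_mul]

lemma norm_green_le (z : ℂ) (hz : 0 ≤ z.im) (x : R3) : ‖green z x‖ ≤ 1 / (4 * Real.pi * ‖x‖) := by
  rw [norm_green]
  have : Real.exp (-z.im * ‖x‖) ≤ 1 := Real.exp_le_one_iff.2 (by nlinarith [norm_nonneg x])
  gcongr

/-- For large `κ` the diagonal part `κ/4π` of `Γ(iκ)` dominates. -/
lemma exists_posDef_Gam (α : Fin N → ℝ) (Y : Fin N → R3) :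
    ∃ K : ℝ, 0 < K ∧ ∀ κ : ℝ, K ≤ κ → (Gam α Y (Complex.I * κ)).PosDef := by
  let b : Fin N → Fin N → ℝ := fun j l => |α j| + 1 / (4 * Real.pi * ‖Y j - Y l‖)
  have hb : ∀ j l, 0 ≤ b j l := fun j l => by positivity
  let m : ℝ := ∑ j, ∑ l, b j l
  have hm0 : 0 ≤ m := Finset.sum_nonneg fun j _ => Finset.sum_nonneg fun l _ => hb j l
  have hm : ∀ j l, b j l ≤ m := fun j l =>
    (Finset.single_le_sum (f := fun l => b j l) (fun l _ => hb j l) (Finset.mem_univ l)).trans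
      (Finset.single_le_sum (f := fun j => ∑ l, b j l)
        (fun j _ => Finset.sum_nonneg fun l _ => hb j l) (Finset.mem_univ j))
  refine ⟨4 * Real.pi * (m * N + 1), by positivity, fun κ hκ => ?_⟩
  have hκ0 : 0 ≤ κ := le_trans (by positivity) hκ
  have hκ1 : m * N + 1 ≤ κ / (4 * Real.pi) := by
    rw [le_div_iff₀ (by positivity)]; linarith
  refine Matrix.PosDef.of_dotProduct_mulVec_pos (isHermitian_Gam α Y κ) fun x hx => ?_
  rw [Complex.pos_iff]
  refine ⟨?_, ((isHermitian_Gam α Y κ).im_star_dotProduct_mulVec_self x).symm⟩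
  let B : Fin N → Fin N → ℂ := fun j l =>
    (if j = l then (α j : ℂ) else 0) - green (Complex.I * κ) (Y j - Y l)
  have hB : ∀ j l, ‖B j l‖ ≤ m := by
    intro j l
    refine (norm_sub_le _ _).trans (le_trans (add_le_add ?_ (norm_green_le _ (by simpa using hκ0) _)) (hm j l))
    split_ifs
    · simp
    · simp
  have hG : ∀ j l, Gam α Y (Complex.I * κ) j l = (if j = l then ((κ / (4 * Real.pi) : ℝ) : ℂ) else 0) + B j l := by
    intro j l
    simp only [Gam, B, Matrix.of_apply]
    split_ifs with h
    · push_cast; linear_combination (-(κ : ℂ) / (4 * Real.pi)) * Complex.I_sq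
    · ring
  have hsum : star x ⬝ᵥ (Gam α Y (Complex.I * κ)) *ᵥ x =
      ((κ / (4 * Real.pi) * ∑ j, ‖x j‖ ^ 2 : ℝ) : ℂ) + ∑ j, ∑ l, starRingEnd ℂ (x j) * (B j l * x l) := by
    simp only [dotProduct, Matrix.mulVec, hG, add_mul, Finset.sum_add_distrib, ite_mul, zero_mul,
      Finset.sum_ite_eq, Finset.mem_univ, if_true, mul_add, Finset.mul_sum, Pi.star_apply,
      RCLike.star_def]
    congr 1
    push_cast
    refine Finset.sum_congr rfl fun j _ => ?_
    rw [← Complex.conj_mul']; ring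
  have hlow : ‖∑ j, ∑ l, starRingEnd ℂ (x j) * (B j l * x l)‖ ≤ m * (N * ∑ j, ‖x j‖ ^ 2) := by
    have h1 : ‖∑ j, ∑ l, starRingEnd ℂ (x j) * (B j l * x l)‖ ≤ ∑ j, ∑ l, m * (‖x j‖ * ‖x l‖) := by
      refine (norm_sum_le _ _).trans (Finset.sum_le_sum fun j _ => (norm_sum_le _ _).trans
        (Finset.sum_le_sum fun l _ => ?_))
      rw [norm_mul, norm_mul, RCLike.norm_conj]
      have := mul_le_mul_of_nonneg_right (hB j l) (mul_nonneg (norm_nonneg (x j)) (norm_nonneg (x l)))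
      linarith
    refine h1.trans ?_
    simp only [← Finset.mul_sum, ← Finset.sum_mul]
    refine mul_le_mul_of_nonneg_left ?_ hm0
    have := sq_sum_le_card_mul_sum_sq (s := Finset.univ) (f := fun j => ‖x j‖)
    simpa [sq] using this
  have hpos : 0 < ∑ j, ‖x j‖ ^ 2 := by
    obtain ⟨j, hj⟩ := Function.ne_iff.1 hx
    exact Finset.sum_pos' (fun j _ => by positivity) ⟨j, Finset.mem_univ j, by
      have := norm_pos_iff.2 (show x j ≠ 0 from hj); positivity⟩
  rw [hsum, Complex.add_re, Complex.ofReal_re]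
  have h3 := (Complex.abs_re_le_norm (∑ j, ∑ l, starRingEnd ℂ (x j) * (B j l * x l))).trans hlow
  have h4 := neg_le_of_abs_le h3
  have h5 := mul_le_mul_of_nonneg_right hκ1 hpos.le
  nlinarith

lemma symb_I_mul (κ : ℝ) (p : R3) :
    symb (Complex.I * κ) p = (((4 * Real.pi ^ 2 * ‖p‖ ^ 2 + κ ^ 2)⁻¹ : ℝ) : ℂ) := by
  rw [symb, mul_pow, Complex.I_sq]; push_cast; ring_nf

lemma I_mul_im_pos {κ : ℝ} (hκ : 0 < κ) : 0 < (Complex.I * κ).im := by simpa using hκ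

lemma inner_freeRes_I_mul {κ : ℝ} (hκ : 0 < κ) (f : L2) :
    inner ℂ f (freeRes (Complex.I * κ) f) =
      ((∫ p, (4 * Real.pi ^ 2 * ‖p‖ ^ 2 + κ ^ 2)⁻¹ * ‖(𝓕 f : L2) p‖ ^ 2 : ℝ) : ℂ) := by
  rw [← Lp.inner_fourier_eq, L2.inner_def, ← integral_complex_ofReal]
  refine integral_congr_ae ?_
  filter_upwards [fourier_freeRes (I_mul_im_pos hκ) f] with p hp
  rw [hp, symb_I_mul, RCLike.inner_apply]
  push_cast
  rw [← Complex.mul_conj']; ring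

lemma integrable_symb_norm_sq {κ : ℝ} (hκ : 0 < κ) (f : L2) :
    Integrable (fun p => (4 * Real.pi ^ 2 * ‖p‖ ^ 2 + κ ^ 2)⁻¹ * ‖(𝓕 f : L2) p‖ ^ 2) := by
  have h1 : Integrable (fun p => ‖(𝓕 f : L2) p‖ ^ 2) :=
    (memLp_two_iff_integrable_sq_norm (Lp.aestronglyMeasurable _)).1 (Lp.memLp _)
  refine h1.bdd_mul (c := (κ ^ 2)⁻¹) (Measurable.aestronglyMeasurable (by fun_prop)) (ae_of_all _ fun p => ?_)
  rw [Real.norm_eq_abs, abs_of_nonneg (by positivity)]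
  exact inv_anti₀ (by positivity) (by nlinarith [Real.pi_pos, sq_nonneg (Real.pi * ‖p‖)])

/-- `-Δ` is positive with trivial kernel. -/
lemma re_inner_freeRes_lt {κ : ℝ} (hκ : 0 < κ) {f : L2} (hf : f ≠ 0) :
    (inner ℂ f (freeRes (Complex.I * κ) f)).re < (κ ^ 2)⁻¹ * ‖f‖ ^ 2 := by
  rw [inner_freeRes_I_mul hκ, Complex.ofReal_re]
  have h1 : Integrable (fun p => ‖(𝓕 f : L2) p‖ ^ 2) :=
    (memLp_two_iff_integrable_sq_norm (Lp.aestronglyMeasurable _)).1 (Lp.memLp _)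
  have hn : ‖f‖ ^ 2 = ∫ p, ‖(𝓕 f : L2) p‖ ^ 2 := by
    have h := inner_self_eq_norm_sq_to_K (𝕜 := ℂ) (𝓕 f : L2)
    rw [L2.inner_def, Lp.norm_fourier_eq] at h
    have h' : ∫ p, inner ℂ ((𝓕 f : L2) p) ((𝓕 f : L2) p) = ((∫ p, ‖(𝓕 f : L2) p‖ ^ 2 : ℝ) : ℂ) := by
      rw [← integral_complex_ofReal]
      refine integral_congr_ae (ae_of_all _ fun p => ?_)
      simp only [inner_self_eq_norm_sq_to_K]; push_cast; rfl
    rw [h'] at h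
    have h'' : ((∫ p, ‖(𝓕 f : L2) p‖ ^ 2 : ℝ) : ℂ) = ((‖f‖ ^ 2 : ℝ) : ℂ) := by
      rw [h]; push_cast; rfl
    exact_mod_cast h''.symm
  rw [hn, ← integral_const_mul, ← sub_pos, ← integral_sub (h1.const_mul _) (integrable_symb_norm_sq hκ f)]
  have hle : ∀ p : R3, (4 * Real.pi ^ 2 * ‖p‖ ^ 2 + κ ^ 2)⁻¹ ≤ (κ ^ 2)⁻¹ := fun p =>
    inv_anti₀ (by positivity) (by nlinarith [sq_nonneg (Real.pi * ‖p‖)])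
  have hnn : ∀ p : R3, 0 ≤ (κ ^ 2)⁻¹ * ‖(𝓕 f : L2) p‖ ^ 2 -
      (4 * Real.pi ^ 2 * ‖p‖ ^ 2 + κ ^ 2)⁻¹ * ‖(𝓕 f : L2) p‖ ^ 2 := fun p => by
    rw [← sub_mul]; exact mul_nonneg (sub_nonneg.2 (hle p)) (by positivity)
  refine lt_of_le_of_ne (integral_nonneg hnn) fun h0 => hf ?_
  have h2 := (integral_eq_zero_iff_of_nonneg hnn
    ((h1.const_mul _).sub (integrable_symb_norm_sq hκ f))).1 h0.symm
  refine fourier_injective (Lp.ext ?_)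
  have hz0 : (𝓕 (0 : L2) : L2) = 0 := (Lp.fourierTransformₗᵢ R3 ℂ).map_zero
  rw [hz0]
  filter_upwards [h2, Lp.coeFn_zero ℂ 2 (volume : Measure R3), Measure.ae_ne volume (0 : R3)] with p e1 e2 e3
  rw [e2]
  have hp : 0 < ‖p‖ := norm_pos_iff.2 e3
  simp only [Pi.zero_apply, ← sub_mul] at e1
  have hlt : (4 * Real.pi ^ 2 * ‖p‖ ^ 2 + κ ^ 2)⁻¹ < (κ ^ 2)⁻¹ :=
    inv_strictAnti₀ (by positivity) (by have := Real.pi_pos; have : 0 < 4 * Real.pi ^ 2 * ‖p‖ ^ 2 := by positivity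
                                        linarith)
  rcases mul_eq_zero.1 e1 with h | h
  · exact absurd h (sub_pos.2 hlt).ne'
  · simpa using h

/-- The quadratic form of `R(iκ)` is that of the free resolvent plus that of `Γ(iκ)⁻¹`, here written as
the form of `Γ(iκ)` at `a = Γ(iκ)⁻¹ ev`. -/
lemma inner_kreinRes_I_mul (α : Fin N → ℝ) (Y : Fin N → R3) (κ : ℝ)
    (hG : IsUnit (Gam α Y (Complex.I * κ))) (f : L2) :
    ∃ a : Fin N → ℂ,
      (Gam α Y (Complex.I * κ)) *ᵥ a = (fun l => evalRes (Complex.I * κ) f (Y l)) ∧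
      inner ℂ f (kreinRes α Y (Complex.I * κ) f) = inner ℂ f (freeRes (Complex.I * κ) f) +
      starRingEnd ℂ (star a ⬝ᵥ (Gam α Y (Complex.I * κ)) *ᵥ a) := by
  refine ⟨_, Gam_mulVec_inv_mulVec hG _, ?_⟩
  rw [kreinRes_apply, inner_add_right, inner_sum, Gam_mulVec_inv_mulVec hG]
  congr 1
  simp only [dotProduct, map_sum, map_mul, inner_smul_right, Pi.star_apply, RCLike.star_def,
    Complex.conj_conj]
  refine Finset.sum_congr rfl fun j _ => ?_
  rw [evalRes, neg_conj_I_mul, inner_conj_symm]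

lemma isPositive_kreinRes {α : Fin N → ℝ} {Y : Fin N → R3} {κ : ℝ} (hκ : 0 < κ)
    (hP : (Gam α Y (Complex.I * κ)).PosDef) : (kreinRes α Y (Complex.I * κ)).IsPositive := by
  have h : ∀ f, ∃ r : ℝ, 0 ≤ r ∧ inner ℂ f (kreinRes α Y (Complex.I * κ) f) = (r : ℂ) := by
    intro f
    obtain ⟨a, -, ha⟩ := inner_kreinRes_I_mul α Y κ hP.isUnit f
    have h1 := Complex.nonneg_iff.1 (hP.posSemidef.dotProduct_mulVec_nonneg a)
    have e : star a ⬝ᵥ (Gam α Y (Complex.I * κ)) *ᵥ a =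
        ((star a ⬝ᵥ (Gam α Y (Complex.I * κ)) *ᵥ a).re : ℂ) := by
      apply Complex.ext
      · simp
      · simpa using h1.2.symm
    refine ⟨(∫ p, (4 * Real.pi ^ 2 * ‖p‖ ^ 2 + κ ^ 2)⁻¹ * ‖(𝓕 f : L2) p‖ ^ 2) +
      (star a ⬝ᵥ (Gam α Y (Complex.I * κ)) *ᵥ a).re, add_nonneg (integral_nonneg fun p => by positivity) h1.1, ?_⟩
    rw [ha, inner_freeRes_I_mul hκ, Complex.ofReal_add, ← Complex.conj_ofReal (Complex.re _), ← e]
  rw [← ContinuousLinearMap.isPositive_toLinearMap_iff, LinearMap.isPositive_iff_complex]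
  intro f
  obtain ⟨r, hr, e⟩ := h f
  have e' : inner ℂ ((kreinRes α Y (Complex.I * κ) : L2 →ₗ[ℂ] L2) f) f = (r : ℂ) := by
    rw [← inner_conj_symm, ContinuousLinearMap.coe_coe, e, Complex.conj_ofReal]
  rw [e']
  simp [hr]

/-- Off the span of the Green functions `R(iκ)` agrees with the free resolvent. -/
lemma re_inner_kreinRes_lt {α : Fin N → ℝ} {Y : Fin N → R3} {κ : ℝ} (hκ : 0 < κ)
    {f : L2}
    (hf : f ∈ (Submodule.span ℂ (range fun j => greenL (Complex.I * κ) (Y j)))ᗮ) (hf0 : f ≠ 0) :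
    (inner ℂ f (kreinRes α Y (Complex.I * κ) f)).re < (κ ^ 2)⁻¹ * ‖f‖ ^ 2 := by
  have hev : (fun l => evalRes (Complex.I * κ) f (Y l)) = 0 := by
    funext l
    rw [evalRes, neg_conj_I_mul]
    exact hf _ (Submodule.subset_span (mem_range_self l))
  rw [kreinRes_apply, hev, Matrix.mulVec_zero]
  simpa using re_inner_freeRes_lt hκ hf0

/-- `Γ(z)` is invertible if `z²` is not real: otherwise the positive operator `R(iκ)` would have a
non-real eigenvalue. -/
lemma isUnit_Gam {α : Fin N → ℝ} {Y : Fin N → R3} (hY : Function.Injective Y) {z : ℂ}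
    (hz : 0 < z.im) (hre : z.re ≠ 0) : IsUnit (Gam α Y z) := by
  obtain ⟨K, hK, hP⟩ := exists_posDef_Gam α Y
  have hP := hP K le_rfl
  have hpos := isPositive_kreinRes hK hP
  rw [← Matrix.mulVec_injective_iff_isUnit, ← Matrix.coe_mulVecLin, injective_iff_map_eq_zero]
  intro a ha
  rw [Matrix.mulVecLin_apply] at ha
  have h := kreinRes_resolvent_identity (α := α) hY hz (I_mul_im_pos hK) hP.isUnit (f := 0) (a := a)
    (ψ := ∑ j, a j • greenL z (Y j))
    (by rw [ha]; funext l; simp [evalRes]) (by simp)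
  set ψ := ∑ j, a j • greenL z (Y j) with hψ
  rw [zero_add, map_smul] at h
  refine greenL_linearIndependent hz hY (hψ.symm.trans ?_)
  by_contra h0
  have h1 := hpos.inner_nonneg_right ψ
  have h2 : (z ^ 2 - (Complex.I * K) ^ 2) * inner ℂ ψ (kreinRes α Y (Complex.I * K) ψ)
      = ((‖ψ‖ ^ 2 : ℝ) : ℂ) := by
    rw [← inner_smul_right, h, inner_self_eq_norm_sq_to_K]; push_cast; rfl
  obtain ⟨h3, h4⟩ := Complex.nonneg_iff.1 h1
  have h5 := congrArg Complex.im h2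
  have h6 := congrArg Complex.re h2
  have h7 : 0 < ‖ψ‖ ^ 2 := by have := norm_pos_iff.2 h0; positivity
  simp only [Complex.mul_im, Complex.mul_re, ← h4, mul_zero, zero_add, Complex.ofReal_im,
    Complex.ofReal_re, sub_zero] at h5 h6
  have h8 : (z ^ 2 - (Complex.I * K) ^ 2).im = 2 * z.re * z.im := by
    simp [sq]; ring
  rw [h8] at h5
  have h9 : (inner ℂ ψ (kreinRes α Y (Complex.I * K) ψ)).re ≠ 0 := by
    intro e; rw [e, mul_zero] at h6; linarith
  exact (mul_ne_zero (mul_ne_zero (mul_ne_zero two_ne_zero hre) hz.ne') h9) h5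

/-- All resolvents of the Hamiltonian are functions of the resolvent at `-κ²`. -/
lemma fcalc_resSymbol_eq {α : Fin N → ℝ} {Y : Fin N → R3} (hY : Function.Injective Y) {κ : ℝ}
    (hκ : 0 < κ) (hP : (Gam α Y (Complex.I * κ)).PosDef) {z : ℂ} (hz : 0 < z.im) (hre : z.re ≠ 0)
    (f : L2) :
    fcalc (kreinRes α Y (Complex.I * κ)) (resSymbol (κ ^ 2) (z ^ 2)) f = kreinRes α Y z f := by
  set T := kreinRes α Y (Complex.I * κ) with hT
  have hpos : T.IsPositive := isPositive_kreinRes hκ hP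
  have hw : (z ^ 2).im ≠ 0 := by
    have : (z ^ 2).im = 2 * z.re * z.im := by simp [sq]; ring
    rw [this]; exact mul_ne_zero (mul_ne_zero two_ne_zero hre) hz.ne'
  have h := kreinRes_eq_of_unit hY hz (I_mul_im_pos hκ) (isUnit_Gam (α := α) hY hz hre) hP.isUnit f
  rw [← hT] at h
  set h' := kreinRes α Y z f with hh
  have e0 : z ^ 2 - (Complex.I * κ) ^ 2 = ((κ ^ 2 : ℝ) : ℂ) + z ^ 2 := by
    rw [mul_pow, Complex.I_sq]; push_cast; ring
  rw [e0] at h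
  let q : ℝ → ℂ := fun r => (1 - (((κ ^ 2 : ℝ) : ℂ) + z ^ 2) * r)⁻¹
  let d : ℝ → ℂ := fun r => 1 - (((κ ^ 2 : ℝ) : ℂ) + z ^ 2) * r
  have hd : ContinuousOn d (Ici 0) := by fun_prop
  have hq : ContinuousOn q (Ici 0) := hd.inv₀ fun r _ => resSymbol_denom_ne hw r
  have h1 : fcalc T (resSymbol (κ ^ 2) (z ^ 2)) f = fcalc T q (T f) := by
    have e : fcalc T (resSymbol (κ ^ 2) (z ^ 2)) = fcalc T (fun r => q r * (r : ℂ)) :=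
      fcalc_congr hpos fun r _ => by simp only [resSymbol, q]; rw [div_eq_inv_mul]
    rw [e, fcalc_mul_apply hpos hq continuousOn_ofReal_Ici, fcalc_ofReal hpos]
  have h2 : fcalc T d h' = T f := by
    have e : fcalc T d = 1 - (((κ ^ 2 : ℝ) : ℂ) + z ^ 2) • T := by
      rw [fcalc_sub hpos (F := fun _ => (1 : ℂ)) (G := fun r : ℝ => (((κ ^ 2 : ℝ) : ℂ) + z ^ 2) * r)
        continuousOn_const (by fun_prop), fcalc_const hpos, one_smul,
        fcalc_const_mul hpos _ continuousOn_ofReal_Ici, fcalc_ofReal hpos]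
    rw [e, sub_apply, smul_apply, one_apply_eq_self]
    rw [map_add, map_smul] at h
    nth_rewrite 1 [← h]
    abel
  have h3 : fcalc T q (fcalc T d h') = h' := by
    rw [← fcalc_mul_apply hpos hq hd]
    have e : fcalc T (fun r => q r * d r) = fcalc T (fun _ => (1 : ℂ)) :=
      fcalc_congr hpos fun r _ => inv_mul_cancel₀ (resSymbol_denom_ne hw r)
    rw [e, fcalc_const hpos, one_smul, one_apply_eq_self]
  rw [h1, ← h2, h3]

/-! ### Weighted functions -/

lemma measurable_weight (Y : Fin N → R3) : Measurable (weight Y) := by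
  unfold weight; fun_prop

lemma one_add_inv_le_weight (Y : Fin N → R3) (j : Fin N) (x : R3) :
    1 + 1 / ‖x - Y j‖ ≤ weight Y x :=
  Finset.single_le_sum (f := fun j => 1 + 1 / ‖x - Y j‖) (fun j _ => by positivity) (Finset.mem_univ j)

lemma one_le_weight (hN : 1 ≤ N) (Y : Fin N → R3) (x : R3) : 1 ≤ weight Y x := by
  refine le_trans ?_ (one_add_inv_le_weight Y ⟨0, hN⟩ x)
  have : 0 ≤ 1 / ‖x - Y ⟨0, hN⟩‖ := by positivity
  linarith

/-- The functions `f ∈ L²` with `w f ∈ L¹`. -/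
def weighted (Y : Fin N → R3) : Submodule ℂ L2 where
  carrier := {f | MemLp (fun x => weight Y x • f x) 1 volume}
  add_mem' {f g} hf hg := by
    refine (hf.add hg).ae_eq ?_
    filter_upwards [Lp.coeFn_add f g] with x hx
    rw [hx]; simp
  zero_mem' := by
    refine (MemLp.zero' (ε := ℂ)).ae_eq ?_
    filter_upwards [Lp.coeFn_zero ℂ 2 (volume : Measure R3)] with x hx
    rw [hx]; simp
  smul_mem' c f hf := by
    refine (hf.const_smul c).ae_eq ?_
    filter_upwards [Lp.coeFn_smul c f] with x hx
    rw [hx]; simp [mul_left_comm]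

lemma integrable_weight_mul {Y : Fin N → R3} {f : L2} (hf : f ∈ weighted Y) :
    Integrable (fun x => weight Y x * ‖f x‖) := by
  have h := (memLp_one_iff_integrable.1 hf).norm
  refine h.congr (ae_of_all _ fun x => ?_)
  have : 0 ≤ weight Y x := Finset.sum_nonneg fun j _ => by positivity
  simp only [norm_smul, Real.norm_eq_abs, abs_of_nonneg this]

lemma integrable_of_weighted (hN : 1 ≤ N) {Y : Fin N → R3} {f : L2} (hf : f ∈ weighted Y) :
    Integrable (f : R3 → ℂ) := by
  refine (integrable_weight_mul hf).mono' (Lp.aestronglyMeasurable f) (ae_of_all _ fun x => ?_)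
  exact le_mul_of_one_le_left (norm_nonneg _) (one_le_weight hN Y x)

/-- The weight absorbs the singularity of the Green function. -/
lemma integrable_div_pole {Y : Fin N → R3} {f : L2} (hf : f ∈ weighted Y) (j : Fin N) :
    Integrable (fun x => f x / (4 * (Real.pi : ℂ) * (‖x - Y j‖ : ℂ))) := by
  refine (integrable_weight_mul hf).mono' ?_ (ae_of_all _ fun x => ?_)
  · exact (Lp.aestronglyMeasurable f).div₀ (Measurable.aestronglyMeasurable (by fun_prop))
  · rw [norm_div]
    have h1 := one_add_inv_le_weight Y j x
    have h2 : ‖4 * (Real.pi : ℂ) * (‖x - Y j‖ : ℂ)‖ = 4 * Real.pi * ‖x - Y j‖ := by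
      simp [abs_of_pos Real.pi_pos]
    rw [h2, div_eq_mul_inv, mul_comm]
    refine mul_le_mul_of_nonneg_right ?_ (norm_nonneg _)
    refine le_trans ?_ h1
    rw [mul_inv]
    have h3 : (4 * Real.pi)⁻¹ ≤ 1 := inv_le_one_of_one_le₀ (by nlinarith [Real.pi_gt_three])
    have h4 : 0 ≤ ‖x - Y j‖⁻¹ := by positivity
    rw [one_div]; nlinarith

/-- Duality between `‖w⁻¹ h‖_∞` and `‖w g‖₁`. -/
lemma norm_le_weight_of_forall_inner {Y : Fin N → R3} {h : L2} {B : ℝ} (hB0 : 0 ≤ B)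
    (hB : ∀ g ∈ weighted Y, ‖inner ℂ g h‖ ≤ B * ∫ x, weight Y x * ‖g x‖) :
    ∀ᵐ x, ‖h x‖ ≤ B * weight Y x := by
  have hhm : Measurable (h : R3 → ℂ) := (Lp.stronglyMeasurable h).measurable
  have hwm := measurable_weight Y
  have hw0 : ∀ x, 0 ≤ weight Y x := fun x => Finset.sum_nonneg fun j _ => by positivity
  -- Test against the sign of `h` on the part of the exceptional set where everything is bounded by `n`.
  have key : ∀ n : ℕ, ∀ᵐ x, ¬ (‖x‖ ≤ n ∧ weight Y x ≤ n ∧ ‖h x‖ ≤ n ∧ B * weight Y x < ‖h x‖) := by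
    intro n
    let S : Set R3 := {x | ‖x‖ ≤ n ∧ weight Y x ≤ n ∧ ‖h x‖ ≤ n ∧ B * weight Y x < ‖h x‖}
    have hS : MeasurableSet S := by
      refine (measurableSet_le measurable_norm measurable_const).inter
        ((measurableSet_le hwm measurable_const).inter
        ((measurableSet_le hhm.norm measurable_const).inter
        (measurableSet_lt (hwm.const_mul B) hhm.norm)))
    have hSfin : volume S < ∞ := by
      refine lt_of_le_of_lt (measure_mono ?_) (measure_closedBall_lt_top (x := (0 : R3)) (r := n))
      intro x hx; simpa using hx.1
    have hfin : IsFiniteMeasure (volume.restrict S) := ⟨by simpa using hSfin⟩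
    let u : R3 → ℂ := fun x => h x / (‖h x‖ : ℂ)
    have hum : Measurable u := by fun_prop
    have hu1 : ∀ x, ‖u x‖ ≤ 1 := fun x => by
      simp only [u, norm_div, Complex.norm_real, norm_norm]; exact div_self_le_one _
    have hg2 : MemLp (S.indicator u) 2 volume := by
      rw [memLp_indicator_iff_restrict hS]
      exact MemLp.of_bound hum.aestronglyMeasurable 1 (ae_of_all _ hu1)
    let g : L2 := hg2.toLp _
    have hgc : (g : R3 → ℂ) =ᵐ[volume] S.indicator u := hg2.coeFn_toLp
    have hgw : g ∈ weighted Y := by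
      have h1 : MemLp (S.indicator fun x => weight Y x • u x) 1 volume := by
        rw [memLp_indicator_iff_restrict hS]
        refine MemLp.of_bound (C := n) ((hwm.smul hum).aestronglyMeasurable)
          ((ae_restrict_iff' hS).2 (ae_of_all _ fun x hx => ?_))
        rw [norm_smul, Real.norm_eq_abs, abs_of_nonneg (hw0 x)]
        have hx2 : weight Y x ≤ n := hx.2.1
        nlinarith [hu1 x, hw0 x, norm_nonneg (u x)]
      refine h1.ae_eq ?_
      filter_upwards [hgc] with x hx
      rw [hx]
      by_cases hxS : x ∈ S <;> simp [hxS]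
    have hi1 : IntegrableOn (fun x => ‖h x‖) S :=
      Integrable.mono' (integrable_const (n : ℝ)) hhm.norm.aestronglyMeasurable
        ((ae_restrict_iff' hS).2 (ae_of_all _ fun x hx => by simpa using hx.2.2.1))
    have hi2 : IntegrableOn (fun x => B * weight Y x) S :=
      (Integrable.mono' (integrable_const (n : ℝ)) hwm.aestronglyMeasurable
        ((ae_restrict_iff' hS).2 (ae_of_all _ fun x hx => by
          rw [Real.norm_eq_abs, abs_of_nonneg (hw0 x)]; exact hx.2.1))).const_mul B
    have e1 : inner ℂ g h = ((∫ x in S, ‖h x‖ : ℝ) : ℂ) := by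
      rw [L2.inner_def, ← integral_complex_ofReal, ← integral_indicator hS]
      refine integral_congr_ae ?_
      filter_upwards [hgc] with x hx
      rw [hx]
      by_cases hxS : x ∈ S
      · simp only [indicator_of_mem hxS, RCLike.inner_apply, u, map_div₀, Complex.conj_ofReal]
        by_cases h0 : h x = 0
        · simp [h0]
        · have : (‖h x‖ : ℂ) ≠ 0 := by exact_mod_cast norm_ne_zero_iff.2 h0
          rw [mul_div_assoc', Complex.mul_conj']; field_simp
      · simp [hxS]
    have e2 : ∫ x, weight Y x * ‖g x‖ ≤ ∫ x in S, weight Y x := by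
      rw [← integral_indicator hS]
      refine integral_mono_ae (integrable_weight_mul hgw) ?_ ?_
      · rw [integrable_indicator_iff hS]
        exact Integrable.mono' (integrable_const (n : ℝ)) hwm.aestronglyMeasurable
          ((ae_restrict_iff' hS).2 (ae_of_all _ fun x hx => by
          rw [Real.norm_eq_abs, abs_of_nonneg (hw0 x)]; exact hx.2.1))
      · filter_upwards [hgc] with x hx
        simp only [hx]
        by_cases hxS : x ∈ S
        · simp only [indicator_of_mem hxS]
          exact mul_le_of_le_one_right (hw0 x) (hu1 x)
        · simp [hxS]
    have e3 : ∫ x in S, ‖h x‖ ≤ ∫ x in S, B * weight Y x := by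
      have h1 := hB g hgw
      rw [e1, Complex.norm_real, Real.norm_eq_abs,
        abs_of_nonneg (integral_nonneg fun x => norm_nonneg _)] at h1
      rw [integral_const_mul]
      exact h1.trans (mul_le_mul_of_nonneg_left e2 hB0)
    have e4 : ∫ x in S, (‖h x‖ - B * weight Y x) ≤ 0 := by
      rw [integral_sub hi1 hi2]; linarith
    have e5 : volume S = 0 := by
      by_contra hne
      have hpos : 0 < volume S := pos_iff_ne_zero.2 hne
      have := (setIntegral_pos_iff_support_of_nonneg_ae (f := fun x => ‖h x‖ - B * weight Y x)
        ((ae_restrict_iff' hS).2 (ae_of_all _ fun x hx => by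
          simpa using hx.2.2.2.le)) (hi1.sub hi2)).2 ?_
      · linarith
      · refine lt_of_lt_of_le hpos (measure_mono fun x hx => ⟨?_, hx⟩)
        have : B * weight Y x < ‖h x‖ := hx.2.2.2
        simp only [Function.mem_support]; linarith
    exact measure_eq_zero_iff_ae_notMem.1 e5
  rw [← ae_all_iff] at key
  filter_upwards [key] with x hx
  by_contra hlt
  obtain ⟨n, hn⟩ := exists_nat_ge (max ‖x‖ (max (weight Y x) ‖h x‖))
  exact hx n ⟨(le_max_left _ _).trans hn, ((le_max_left _ _).trans (le_max_right _ _)).trans hn,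
    ((le_max_right _ _).trans (le_max_right _ _)).trans hn, not_le.1 hlt⟩

/-- A function orthogonal to all weighted functions vanishes, by duality with constant `0`. -/
lemma dense_weighted (Y : Fin N → R3) : Dense (weighted Y : Set L2) := by
  rw [Submodule.dense_iff_topologicalClosure_eq_top, Submodule.topologicalClosure_eq_top_iff,
    Submodule.eq_bot_iff]
  intro h hh
  have := norm_le_weight_of_forall_inner (Y := Y) (h := h) (B := 0) le_rfl (fun g hg => by
    rw [hh g hg]; simp)
  refine Lp.ext ?_
  filter_upwards [this, Lp.coeFn_zero ℂ 2 (volume : Measure R3)] with x h1 h2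
  rw [h2]; simpa using h1

/-! ### Boundary values of the resolvent on the real axis -/

section OscInt
variable {Q : Type*} [MeasurableSpace Q] {ν : Measure Q}

/-- The integral of the oscillating exponential `e^{izs}` against `F dν`. -/
noncomputable def oscInt (ν : Measure Q) (F : Q → ℂ) (s : Q → ℝ) (z : ℂ) : ℂ :=
  ∫ q, F q * Complex.exp (Complex.I * z * s q) ∂ν

lemma norm_exp_I_mul_le {z : ℂ} (hz : 0 ≤ z.im) {r : ℝ} (hr : 0 ≤ r) :
    ‖Complex.exp (Complex.I * z * r)‖ ≤ 1 := by
  rw [norm_exp_I_mul]; exact Real.exp_le_one_iff.2 (by nlinarith)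

lemma integrable_oscInt {F : Q → ℂ} {s : Q → ℝ} (hF : Integrable F ν) (hs : Measurable s)
    (hs0 : ∀ q, 0 ≤ s q) {z : ℂ} (hz : 0 ≤ z.im) :
    Integrable (fun q => F q * Complex.exp (Complex.I * z * s q)) ν := by
  refine hF.norm.mono' (hF.1.mul (Measurable.aestronglyMeasurable (by fun_prop))) (ae_of_all _ fun q => ?_)
  rw [norm_mul]
  exact mul_le_of_le_one_right (norm_nonneg _) (norm_exp_I_mul_le hz (hs0 q))

lemma continuousOn_oscInt {F : Q → ℂ} {s : Q → ℝ} (hF : Integrable F ν) (hs : Measurable s)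
    (hs0 : ∀ q, 0 ≤ s q) : ContinuousOn (oscInt ν F s) {z | 0 ≤ z.im} := by
  intro z hz
  refine continuousWithinAt_of_dominated (bound := fun q => ‖F q‖) ?_ ?_ hF.norm ?_
  · filter_upwards [self_mem_nhdsWithin] with w hw
    exact (integrable_oscInt hF hs hs0 hw).1
  · filter_upwards [self_mem_nhdsWithin] with w hw
    refine ae_of_all _ fun q => ?_
    rw [norm_mul]
    exact mul_le_of_le_one_right (norm_nonneg _) (norm_exp_I_mul_le hw (hs0 q))
  · refine ae_of_all _ fun q => ?_
    exact Continuous.continuousWithinAt (by fun_prop)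

/-- Integrating an oscillatory integral in the spectral parameter. -/
lemma integral_mul_oscInt [SFinite ν] {F : Q → ℂ} {s : Q → ℝ} (hF : Integrable F ν) (hs : Measurable s)
    {Φ : ℝ → ℂ} (hΦ : Integrable Φ) :
    Integrable (fun l : ℝ => Φ l * oscInt ν F s l) ∧
    ∫ l : ℝ, Φ l * oscInt ν F s l =
      ∫ q, F q * (∫ l : ℝ, Φ l * Complex.exp (Complex.I * l * s q)) ∂ν := by
  have hint : Integrable (fun u : ℝ × Q => Φ u.1 * (F u.2 * Complex.exp (Complex.I * u.1 * s u.2)))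
      (volume.prod ν) := by
    refine (hΦ.norm.mul_prod hF.norm).mono' ?_ (ae_of_all _ fun u => ?_)
    · refine hΦ.1.comp_fst.mul (hF.1.comp_snd.mul ?_)
      exact Measurable.aestronglyMeasurable (by fun_prop)
    · rw [norm_mul, norm_mul]
      have : ‖Complex.exp (Complex.I * u.1 * s u.2)‖ = 1 := by
        rw [norm_exp_I_mul]; simp
      rw [this, mul_one]
  have e : ∀ l : ℝ, Φ l * oscInt ν F s l =
      ∫ q, Φ l * (F q * Complex.exp (Complex.I * l * s q)) ∂ν := fun l => by
    rw [oscInt, integral_const_mul]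
  simp_rw [e]
  refine ⟨hint.integral_prod_left, ?_⟩
  rw [integral_integral_swap hint]
  refine integral_congr_ae (ae_of_all _ fun q => ?_)
  simp only
  rw [← integral_const_mul]
  refine integral_congr_ae (ae_of_all _ fun l => ?_)
  simp only; ring

end OscInt

/-- The product of `conj g` and `f` on `ℝ³ × ℝ³`. -/
noncomputable def pairing (g f : L2) (q : R3 × R3) : ℂ := starRingEnd ℂ (g q.1) * f q.2

/-- The amplitude of the free part of the resolvent kernel. -/
noncomputable def freeAmp (g f : L2) (q : R3 × R3) : ℂ :=
  pairing g f q / (4 * (Real.pi : ℂ) * (‖q.1 - q.2‖ : ℂ))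

/-- The amplitude of the part of the resolvent kernel that passes through the points `u`, `v`. -/
noncomputable def poleAmp (g f : L2) (u v : R3) (q : R3 × R3) : ℂ :=
  (starRingEnd ℂ (g q.1) / (4 * (Real.pi : ℂ) * (‖q.1 - u‖ : ℂ))) *
    (f q.2 / (4 * (Real.pi : ℂ) * (‖q.2 - v‖ : ℂ)))

lemma integrable_conj_div_pole {Y : Fin N → R3} {g : L2} (hg : g ∈ weighted Y) (j : Fin N) :
    Integrable (fun x => starRingEnd ℂ (g x) / (4 * (Real.pi : ℂ) * (‖x - Y j‖ : ℂ))) := by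
  refine (integrable_div_pole hg j).norm.mono' ?_ (ae_of_all _ fun x => ?_)
  · exact (continuous_star.comp_aestronglyMeasurable (Lp.aestronglyMeasurable g)).div₀
      (Measurable.aestronglyMeasurable (by fun_prop))
  · rw [norm_div, norm_div, RCLike.norm_conj]

lemma integrable_poleAmp {Y : Fin N → R3} {g f : L2} (hg : g ∈ weighted Y) (hf : f ∈ weighted Y)
    (j l : Fin N) : Integrable (poleAmp g f (Y j) (Y l)) (volume.prod volume) :=
  (integrable_conj_div_pole hg j).mul_prod (integrable_div_pole hf l)

/-- The modulus of an `L²` function. -/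
noncomputable def absL (f : L2) : L2 := (Lp.memLp f).norm.ofReal.toLp (fun x => ((‖f x‖ : ℝ) : ℂ))

lemma coeFn_absL (f : L2) : (absL f : R3 → ℂ) =ᵐ[volume] fun x => ((‖f x‖ : ℝ) : ℂ) :=
  MemLp.coeFn_toLp _

lemma aestronglyMeasurable_pairing (g f : L2) :
    AEStronglyMeasurable (pairing g f) (volume.prod volume) :=
  (continuous_star.comp_aestronglyMeasurable (Lp.aestronglyMeasurable g)).comp_fst.mul
    (Lp.aestronglyMeasurable f).comp_snd

lemma integrable_green_mul {z : ℂ} (hz : 0 < z.im) (f : L2) (y : R3) :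
    Integrable (fun x => green z (x - y) * f x) :=
  (memLp_green_sub hz y).integrable_mul (Lp.memLp f)

/-- The Green function `e^{-|x|}/(4π|x|)` is real and non-negative. -/
lemma green_I (x : R3) : green Complex.I x = ((‖green Complex.I x‖ : ℝ) : ℂ) := by
  rw [norm_green, green_eq]
  push_cast
  rw [show Complex.I * Complex.I * (‖x‖ : ℂ) = -(Complex.I.im : ℂ) * ‖x‖ by
    rw [Complex.I_mul_I, Complex.I_im]; push_cast; ring]

lemma integrable_pairing_green (g f : L2) :
    Integrable (fun q : R3 × R3 => pairing g f q * green Complex.I (q.1 - q.2)) (volume.prod volume) := by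
  have hI : 0 < Complex.I.im := by simp
  have hm : AEStronglyMeasurable (fun q : R3 × R3 => pairing g f q * green Complex.I (q.1 - q.2))
      (volume.prod volume) :=
    (aestronglyMeasurable_pairing g f).mul
      ((measurable_green _).comp (measurable_fst.sub measurable_snd)).aestronglyMeasurable
  have hsymm : ∀ x y : R3, green Complex.I (x - y) = green Complex.I (y - x) := fun x y => by
    rw [green_eq, green_eq, norm_sub_rev]
  rw [integrable_prod_iff hm]
  constructor
  · refine ae_of_all _ fun x => ?_
    refine ((integrable_green_mul hI f x).const_mul (starRingEnd ℂ (g x))).congr (ae_of_all _ fun y => ?_)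
    simp only [pairing, hsymm x y]; ring
  · have e : ∀ x, ∫ y, ‖pairing g f (x, y) * green Complex.I (x - y)‖ =
        ‖g x‖ * ‖evalRes Complex.I (absL f) x‖ := by
      intro x
      have h1 : evalRes Complex.I (absL f) x =
          ((∫ y, ‖green Complex.I (y - x)‖ * ‖f y‖ : ℝ) : ℂ) := by
        rw [evalRes_eq_integral hI, ← integral_complex_ofReal]
        refine integral_congr_ae ?_
        filter_upwards [coeFn_absL f] with y hy
        rw [hy, green_I (y - x)]; push_cast; simp
      rw [h1, Complex.norm_real, Real.norm_eq_abs, abs_of_nonneg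
        (integral_nonneg fun y => by positivity), ← integral_const_mul]
      refine integral_congr_ae (ae_of_all _ fun y => ?_)
      simp only [pairing, norm_mul, RCLike.norm_conj, hsymm x y]; ring
    simp_rw [e]
    have h2 : MemLp (evalRes Complex.I (absL f)) 2 volume :=
      (Lp.memLp _).ae_eq (freeRes_ae_eq hI (absL f))
    exact (Lp.memLp g).norm.integrable_mul h2.norm

/-- Near the diagonal the amplitude is bounded by the kernel `e^{-|x|}/(4π|x|)` of a bounded operator,
away from it by the product of two integrable functions. -/
lemma integrable_freeAmp {g f : L2} (hg : Integrable (g : R3 → ℂ)) (hf : Integrable (f : R3 → ℂ)) :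
    Integrable (freeAmp g f) (volume.prod volume) := by
  have hp : Integrable (fun q : R3 × R3 => ‖g q.1‖ * ‖f q.2‖) (volume.prod volume) :=
    hg.norm.mul_prod hf.norm
  refine Integrable.mono' (((integrable_pairing_green g f).norm.const_mul (Real.exp 1)).add hp) ?_ ?_
  · exact (aestronglyMeasurable_pairing g f).div₀ (Measurable.aestronglyMeasurable (by fun_prop))
  · refine ae_of_all _ fun q => ?_
    simp only [Pi.add_apply]
    have hn : ‖pairing g f q‖ = ‖g q.1‖ * ‖f q.2‖ := by
      rw [pairing, norm_mul, RCLike.norm_conj]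
    rw [freeAmp, norm_div, norm_mul (pairing g f q), norm_green, hn]
    set P := ‖g q.1‖ * ‖f q.2‖ with hP
    have hP0 : 0 ≤ P := by positivity
    set r := ‖q.1 - q.2‖ with hr
    have hr0 : 0 ≤ r := norm_nonneg _
    have h2 : ‖4 * (Real.pi : ℂ) * (r : ℂ)‖ = 4 * Real.pi * r := by
      simp [abs_of_pos Real.pi_pos, abs_of_nonneg hr0]
    rw [h2, Complex.I_im]
    rcases le_total r 1 with h | h
    · have h3 : 1 ≤ Real.exp 1 * Real.exp (-1 * r) := by
        rw [← Real.exp_add]; exact Real.one_le_exp (by linarith)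
      have h4 : P / (4 * Real.pi * r) ≤ Real.exp 1 * (P * (Real.exp (-1 * r) / (4 * Real.pi * r))) := by
        have h5 : 0 ≤ P / (4 * Real.pi * r) := by positivity
        calc P / (4 * Real.pi * r) ≤ (Real.exp 1 * Real.exp (-1 * r)) * (P / (4 * Real.pi * r)) :=
              le_mul_of_one_le_left h5 h3
          _ = _ := by ring
      linarith
    · have h3 : P / (4 * Real.pi * r) ≤ P :=
        div_le_self hP0 (by nlinarith [Real.pi_gt_three])
      have h5 : 0 ≤ Real.exp 1 * (P * (Real.exp (-1 * r) / (4 * Real.pi * r))) := by positivity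
      linarith

/-- The matrix element `⟪g, R(z) f⟫` of the resolvent, extended to real `z`. -/
noncomputable def resBdry (α : Fin N → ℝ) (Y : Fin N → R3) (g f : L2) (z : ℂ) : ℂ :=
  oscInt (volume.prod volume) (freeAmp g f) (fun q => ‖q.1 - q.2‖) z +
    ∑ j, ∑ l, (Gam α Y z)⁻¹ j l *
      oscInt (volume.prod volume) (poleAmp g f (Y j) (Y l)) (fun q => ‖q.1 - Y j‖ + ‖q.2 - Y l‖) z

lemma continuous_Gam (α : Fin N → ℝ) (Y : Fin N → R3) : Continuous (Gam α Y) := by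
  refine continuous_matrix fun j l => ?_
  simp only [Gam, Matrix.of_apply, green_eq]
  split_ifs <;> fun_prop

lemma Gam_inv_apply (α : Fin N → ℝ) (Y : Fin N → R3) (z : ℂ) (j l : Fin N) :
    (Gam α Y z)⁻¹ j l = (Gam α Y z).det⁻¹ * (Gam α Y z).adjugate j l := by
  rw [Matrix.inv_def, Ring.inverse_eq_inv', Matrix.smul_apply, smul_eq_mul]

lemma continuousOn_Gam_inv (α : Fin N → ℝ) (Y : Fin N → R3) (j l : Fin N) :
    ContinuousOn (fun z => (Gam α Y z)⁻¹ j l) {z | IsUnit (Gam α Y z)} := by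
  simp_rw [Gam_inv_apply]
  refine ContinuousOn.mul (ContinuousOn.inv₀ (continuous_Gam α Y).matrix_det.continuousOn ?_) ?_
  · intro z hz
    exact ((Matrix.isUnit_iff_isUnit_det _).1 hz).ne_zero
  · exact ((continuous_Gam α Y).matrix_adjugate.matrix_elem j l).continuousOn

lemma continuousOn_resBdry (hN : 1 ≤ N) {α : Fin N → ℝ} {Y : Fin N → R3} {g f : L2}
    (hg : g ∈ weighted Y) (hf : f ∈ weighted Y) :
    ContinuousOn (resBdry α Y g f) {z | 0 ≤ z.im ∧ IsUnit (Gam α Y z)} := by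
  refine ContinuousOn.add ?_ (continuousOn_finsetSum _ fun j _ => continuousOn_finsetSum _ fun l _ =>
    ContinuousOn.mul ?_ ?_)
  · exact (continuousOn_oscInt (integrable_freeAmp (integrable_of_weighted hN hg)
      (integrable_of_weighted hN hf)) (by fun_prop) fun q => norm_nonneg _).mono fun z hz => hz.1
  · exact (continuousOn_Gam_inv α Y j l).mono fun z hz => hz.2
  · exact (continuousOn_oscInt (integrable_poleAmp hg hf j l) (by fun_prop)
      fun q => by positivity).mono fun z hz => hz.1

/-- Inserting the integral kernels into Krein's formula. -/
lemma inner_kreinRes_eq_resBdry (hN : 1 ≤ N) {α : Fin N → ℝ} {Y : Fin N → R3} {g f : L2}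
    (hg : g ∈ weighted Y) (hf : f ∈ weighted Y) {z : ℂ} (hz : 0 < z.im) :
    inner ℂ g (kreinRes α Y z f) = resBdry α Y g f z := by
  rw [kreinRes_apply, inner_add_right, inner_sum, resBdry]
  congr 1
  · have hint := integrable_oscInt (integrable_freeAmp (integrable_of_weighted hN hg)
      (integrable_of_weighted hN hf)) (s := fun q : R3 × R3 => ‖q.1 - q.2‖) (by fun_prop)
      (fun q => norm_nonneg _) hz.le
    rw [oscInt, integral_prod _ hint, L2.inner_def]
    refine integral_congr_ae ?_
    filter_upwards [freeRes_ae_eq hz f] with x hx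
    rw [hx, evalRes_eq_integral hz, RCLike.inner_apply, mul_comm, ← integral_const_mul]
    refine integral_congr_ae (ae_of_all _ fun y => ?_)
    simp only [freeAmp, pairing, green_eq, norm_sub_rev x y]
    ring
  · refine Finset.sum_congr rfl fun j _ => ?_
    rw [inner_smul_right, Matrix.mulVec, dotProduct, Finset.sum_mul]
    refine Finset.sum_congr rfl fun l _ => ?_
    rw [mul_assoc]
    congr 1
    have e : oscInt (volume.prod volume) (poleAmp g f (Y j) (Y l))
        (fun q => ‖q.1 - Y j‖ + ‖q.2 - Y l‖) z =
        ∫ q : R3 × R3, (starRingEnd ℂ (g q.1) * green z (q.1 - Y j)) *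
          (green z (q.2 - Y l) * f q.2) ∂(volume.prod volume) := by
      refine integral_congr_ae (ae_of_all _ fun q => ?_)
      simp only [poleAmp, green_eq]
      rw [Complex.ofReal_add, mul_add, Complex.exp_add]
      ring
    rw [e, integral_prod_mul (fun x => starRingEnd ℂ (g x) * green z (x - Y j))
      (fun y => green z (y - Y l) * f y), ← evalRes_eq_integral hz, mul_comm]
    congr 1
    rw [L2.inner_def]
    refine integral_congr_ae ?_
    filter_upwards [coeFn_greenL hz (Y j)] with x hx
    rw [hx, RCLike.inner_apply, mul_comm]

/-! ### The spectral density of the Hamiltonian -/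

/-- The square root of `x + iε` in the closed first quadrant. -/
noncomputable def quadrantSqrt (x ε : ℝ) : ℂ :=
  ⟨Real.sqrt ((Real.sqrt (x ^ 2 + ε ^ 2) + x) / 2), Real.sqrt ((Real.sqrt (x ^ 2 + ε ^ 2) - x) / 2)⟩

lemma abs_le_sqrt_add (x ε : ℝ) : |x| ≤ Real.sqrt (x ^ 2 + ε ^ 2) :=
  Real.abs_le_sqrt (by nlinarith [sq_nonneg ε])

lemma quadrantSqrt_sq (x : ℝ) {ε : ℝ} (hε : 0 ≤ ε) : quadrantSqrt x ε ^ 2 = x + Complex.I * ε := by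
  have h := abs_le_sqrt_add x ε
  have h1 : 0 ≤ (Real.sqrt (x ^ 2 + ε ^ 2) + x) / 2 := by linarith [neg_abs_le x]
  have h2 : 0 ≤ (Real.sqrt (x ^ 2 + ε ^ 2) - x) / 2 := by linarith [le_abs_self x]
  have h3 : Real.sqrt (x ^ 2 + ε ^ 2) ^ 2 = x ^ 2 + ε ^ 2 := Real.sq_sqrt (by positivity)
  have h4 : Real.sqrt ((Real.sqrt (x ^ 2 + ε ^ 2) + x) / 2) *
      Real.sqrt ((Real.sqrt (x ^ 2 + ε ^ 2) - x) / 2) = ε / 2 := by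
    rw [← Real.sqrt_mul h1, Real.sqrt_eq_iff_mul_self_eq (mul_nonneg h1 h2) (by linarith)]
    nlinarith
  rw [sq]
  apply Complex.ext
  · rw [Complex.mul_re]
    simp only [quadrantSqrt]
    rw [Real.mul_self_sqrt h1, Real.mul_self_sqrt h2]
    simp; ring
  · rw [Complex.mul_im]
    simp only [quadrantSqrt]
    rw [mul_comm (Real.sqrt ((Real.sqrt (x ^ 2 + ε ^ 2) - x) / 2)), h4]
    simp

lemma quadrantSqrt_re_pos {x : ℝ} (hx : 0 < x) (ε : ℝ) : 0 < (quadrantSqrt x ε).re := by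
  simp only [quadrantSqrt]
  have := Real.sqrt_nonneg (x ^ 2 + ε ^ 2)
  exact Real.sqrt_pos.2 (by linarith)

lemma quadrantSqrt_im_nonneg (x ε : ℝ) : 0 ≤ (quadrantSqrt x ε).im := Real.sqrt_nonneg _

lemma quadrantSqrt_im_pos {x ε : ℝ} (hε : 0 < ε) : 0 < (quadrantSqrt x ε).im := by
  simp only [quadrantSqrt]
  have : x < Real.sqrt (x ^ 2 + ε ^ 2) := Real.lt_sqrt_of_sq_lt (by nlinarith)
  exact Real.sqrt_pos.2 (by linarith)

lemma quadrantSqrt_zero {x : ℝ} (hx : 0 ≤ x) : quadrantSqrt x 0 = (Real.sqrt x : ℂ) := by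
  apply Complex.ext <;> simp [quadrantSqrt, Real.sqrt_sq hx]

lemma continuous_quadrantSqrt : Continuous fun u : ℝ × ℝ => quadrantSqrt u.1 u.2 := by
  have e : (fun u : ℝ × ℝ => quadrantSqrt u.1 u.2) = fun u : ℝ × ℝ =>
      ((Real.sqrt ((Real.sqrt (u.1 ^ 2 + u.2 ^ 2) + u.1) / 2) : ℝ) : ℂ) +
      ((Real.sqrt ((Real.sqrt (u.1 ^ 2 + u.2 ^ 2) - u.1) / 2) : ℝ) : ℂ) * Complex.I := by
    ext u; exact Complex.mk_eq_add_mul_I _ _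
  rw [e]; fun_prop

/-- The jump of the boundary values of the resolvent across the positive half-line. -/
noncomputable def specDensity (α : Fin N → ℝ) (Y : Fin N → R3) (g f : L2) (x : ℝ) : ℂ :=
  (resBdry α Y g f (Real.sqrt x : ℂ) - resBdry α Y g f (-(Real.sqrt x : ℂ))) / (2 * Real.pi * Complex.I)

/-- Limiting absorption: approaching `x > 0` from above and below, the square roots `z` and
`-conj z` of the spectral parameter tend to `±√x`, where the resolvent kernel is continuous. -/
lemma isDensity_specDensity (hN : 1 ≤ N) {α : Fin N → ℝ} {Y : Fin N → R3}
    (hY : Function.Injective Y) {κ : ℝ} (hκ : 0 < κ) (hP : (Gam α Y (Complex.I * κ)).PosDef)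
    (hreg : ∀ l : ℝ, l ≠ 0 → IsUnit (Gam α Y (l : ℂ))) {g f : L2}
    (hg : g ∈ weighted Y) (hf : f ∈ weighted Y) :
    IsDensity (kreinRes α Y (Complex.I * κ)) (κ ^ 2) g f (specDensity α Y g f) := by
  let S : Set (ℝ × ℝ) := {u | 0 < u.1 ∧ 0 ≤ u.2}
  let J : ℝ × ℝ → ℂ := fun u => (resBdry α Y g f (quadrantSqrt u.1 u.2) -
    resBdry α Y g f (-starRingEnd ℂ (quadrantSqrt u.1 u.2))) / (2 * Real.pi * Complex.I)
  have hunit : ∀ u ∈ S, IsUnit (Gam α Y (quadrantSqrt u.1 u.2)) ∧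
      IsUnit (Gam α Y (-starRingEnd ℂ (quadrantSqrt u.1 u.2))) := by
    rintro ⟨x, ε⟩ ⟨hx, hε⟩
    simp only at hx hε ⊢
    rcases hε.eq_or_lt with rfl | hε
    · have hs : Real.sqrt x ≠ 0 := (Real.sqrt_pos.2 hx).ne'
      rw [quadrantSqrt_zero hx.le, Complex.conj_ofReal]
      refine ⟨hreg _ hs, ?_⟩
      have := hreg (-Real.sqrt x) (neg_ne_zero.2 hs)
      simpa using this
    · have h1 := (quadrantSqrt_re_pos hx ε).ne'
      refine ⟨isUnit_Gam hY (quadrantSqrt_im_pos hε) h1, isUnit_Gam hY ?_ ?_⟩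
      · rw [neg_conj_im]; exact quadrantSqrt_im_pos hε
      · simpa using h1
  have hJ : ContinuousOn J S := by
    have hk := continuousOn_resBdry hN (α := α) hg hf
    refine ContinuousOn.div_const (ContinuousOn.sub ?_ ?_) _
    · refine hk.comp continuous_quadrantSqrt.continuousOn fun u hu => ⟨?_, (hunit u hu).1⟩
      exact quadrantSqrt_im_nonneg _ _
    · refine hk.comp (f := fun u : ℝ × ℝ => -starRingEnd ℂ (quadrantSqrt u.1 u.2))
        (Complex.continuous_conj.comp continuous_quadrantSqrt).neg.continuousOn
        fun u hu => ⟨?_, (hunit u hu).2⟩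
      rw [neg_conj_im]; exact quadrantSqrt_im_nonneg _ _
  have hJ0 : ∀ x, 0 < x → J (x, 0) = specDensity α Y g f x := by
    intro x hx
    simp only [J, specDensity, quadrantSqrt_zero hx.le, Complex.conj_ofReal]
  have hJε : ∀ x : ℝ, 0 < x → ∀ ε : ℝ, 0 < ε →
      (resElem (kreinRes α Y (Complex.I * κ)) (κ ^ 2) g f (x + Complex.I * ε) -
      resElem (kreinRes α Y (Complex.I * κ)) (κ ^ 2) g f (x + Complex.I * (-ε : ℝ))) /
        (2 * Real.pi * Complex.I) = J (x, ε) := by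
    intro x hx ε hε
    have hi := quadrantSqrt_im_pos (x := x) hε
    have hr := (quadrantSqrt_re_pos hx ε).ne'
    have hsq := quadrantSqrt_sq x hε.le
    have hi' : 0 < (-starRingEnd ℂ (quadrantSqrt x ε)).im := by rwa [neg_conj_im]
    have hr' : (-starRingEnd ℂ (quadrantSqrt x ε)).re ≠ 0 := by simpa using hr
    have hsq' : (-starRingEnd ℂ (quadrantSqrt x ε)) ^ 2 = x + Complex.I * (-ε : ℝ) := by
      rw [neg_sq, ← map_pow, hsq]; simp
    simp only [J]
    rw [resElem, resElem, ← hsq, ← hsq', fcalc_resSymbol_eq hY hκ hP hi hr,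
      fcalc_resSymbol_eq hY hκ hP hi' hr', inner_kreinRes_eq_resBdry hN hg hf hi,
      inner_kreinRes_eq_resBdry hN hg hf hi']
  refine ⟨?_, ?_, ?_⟩
  · have h1 : ContinuousOn (fun x : ℝ => J (x, 0)) (Ioi 0) :=
      hJ.comp (by fun_prop) fun x hx => ⟨hx, le_rfl⟩
    exact h1.congr fun x hx => (hJ0 x hx).symm
  · intro x hx
    rw [← hJ0 x hx]
    have h1 : Tendsto (fun ε : ℝ => ((x, ε) : ℝ × ℝ)) (𝓝[>] 0) (𝓝[S] (x, 0)) := by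
      refine tendsto_nhdsWithin_iff.2 ⟨?_, ?_⟩
      · have : Continuous fun ε : ℝ => ((x, ε) : ℝ × ℝ) := by fun_prop
        exact (this.tendsto 0).mono_left nhdsWithin_le_nhds
      · filter_upwards [self_mem_nhdsWithin] with ε hε
        exact ⟨hx, le_of_lt hε⟩
    refine ((hJ (x, 0) ⟨hx, le_rfl⟩).tendsto.comp h1).congr' ?_
    filter_upwards [self_mem_nhdsWithin] with ε hε
    exact (hJε x hx ε hε).symm
  · intro a b ha
    obtain ⟨B, hB⟩ := (isCompact_Icc.prod isCompact_Icc : IsCompact (Icc a b ×ˢ Icc (0:ℝ) 1)).exists_bound_of_continuousOn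
      (hJ.mono fun u hu => ⟨lt_of_lt_of_le ha hu.1.1, hu.2.1⟩)
    refine ⟨B, fun x hx ε hε => ?_⟩
    rw [hJε x (lt_of_lt_of_le ha hx.1) ε hε.1]
    exact hB (x, ε) ⟨hx, hε.1.le, hε.2.le⟩

lemma kreinRes_I_mul_injective {α : Fin N → ℝ} {Y : Fin N → R3} (hY : Function.Injective Y)
    {κ : ℝ} (hκ : 0 < κ) : Function.Injective (kreinRes α Y (Complex.I * κ)) := by
  intro f g h
  refine sub_eq_zero.1 (kreinRes_injective (α := α) hY (I_mul_im_pos hκ) (f := f - g) ?_)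
  rw [map_sub, h, sub_self]

lemma hamiltonian_eq {α : Fin N → ℝ} {Y : Fin N → R3} (hY : Function.Injective Y) {κ : ℝ}
    (hκ : 0 < κ) (hP : (Gam α Y (Complex.I * κ)).PosDef) :
    hamiltonian α Y = {p : L2 × L2 | p.1 =
      kreinRes α Y (Complex.I * κ) (p.2 + ((κ ^ 2 : ℝ) : ℂ) • p.1)} := by
  ext ⟨ψ, g⟩
  rw [mem_hamiltonian_iff_of_unit hY (I_mul_im_pos hκ) hP.isUnit, mem_ofPred_eq]
  have : g - (Complex.I * κ) ^ 2 • ψ = g + ((κ ^ 2 : ℝ) : ℂ) • ψ := by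
    rw [mul_pow, Complex.I_sq, neg_one_mul, neg_smul, sub_neg_eq_add]; push_cast; rfl
  rw [this]

lemma expI_hamiltonian {α : Fin N → ℝ} {Y : Fin N → R3} (hY : Function.Injective Y) {κ : ℝ}
    (hκ : 0 < κ) (hP : (Gam α Y (Complex.I * κ)).PosDef) :
    expI (hamiltonian α Y) = invGroup (kreinRes α Y (Complex.I * κ)) (κ ^ 2) := by
  rw [hamiltonian_eq hY hκ hP,
    expI_eq_invGroup (isPositive_kreinRes hκ hP) (kreinRes_I_mul_injective hY hκ)]

/-- The Hamiltonian generates a strongly continuous unitary group. -/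
theorem isUnitaryGroupOf_hamiltonian (α : Fin N → ℝ) {Y : Fin N → R3} (hY : Function.Injective Y) :
    IsUnitaryGroupOf (hamiltonian α Y) (expI (hamiltonian α Y)) := by
  obtain ⟨K, hK, hP⟩ := exists_posDef_Gam α Y
  rw [expI_hamiltonian hY hK (hP K le_rfl), hamiltonian_eq hY hK (hP K le_rfl)]
  exact isUnitaryGroupOf_invGroup (isPositive_kreinRes hK (hP K le_rfl))
    (kreinRes_I_mul_injective hY hK) _

/-- Off the span of the `N` Green functions the form of the Hamiltonian is positive, which bounds the
dimension. -/
lemma finiteDimensional_nonposSpace_kreinRes {α : Fin N → ℝ} {Y : Fin N → R3}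
    (hY : Function.Injective Y) {κ : ℝ} (hκ : 0 < κ) (hP : (Gam α Y (Complex.I * κ)).PosDef) :
    FiniteDimensional ℂ (nonposSpace (kreinRes α Y (Complex.I * κ)) (κ ^ 2)) := by
  have : FiniteDimensional ℂ
      (Submodule.span ℂ (range fun j => greenL (Complex.I * κ) (Y j)) : Submodule ℂ L2) :=
    FiniteDimensional.span_of_finite ℂ (finite_range _)
  exact finiteDimensional_nonposSpace (isPositive_kreinRes hκ hP) (kreinRes_I_mul_injective hY hκ)
    (by positivity) fun v hv hv0 => re_inner_kreinRes_lt hκ hv hv0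

/-- The absolutely continuous subspace is the positive spectral subspace. -/
lemma acProjection_expI (hN : 1 ≤ N) {α : Fin N → ℝ} {Y : Fin N → R3}
    (hY : Function.Injective Y) {κ : ℝ} (hκ : 0 < κ) (hP : (Gam α Y (Complex.I * κ)).PosDef)
    (hreg : ∀ l : ℝ, l ≠ 0 → IsUnit (Gam α Y (l : ℂ))) :
    acProjection (expI (hamiltonian α Y)) =
      (nonposSpace (kreinRes α Y (Complex.I * κ)) (κ ^ 2))ᗮ.starProjection := by
  have := finiteDimensional_nonposSpace_kreinRes hY hκ hP
  rw [expI_hamiltonian hY hκ hP]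
  exact acProjection_invGroup (isPositive_kreinRes hκ hP) (kreinRes_I_mul_injective hY hκ)
    (by positivity) (dense_weighted Y)
    fun f hf => ⟨_, isDensity_specDensity hN hY hκ hP hreg hf hf⟩

/-- Matrix elements of the propagator on the absolutely continuous subspace. -/
lemma inner_expI_acProjection (hN : 1 ≤ N) {α : Fin N → ℝ} {Y : Fin N → R3}
    (hY : Function.Injective Y) (hreg : ∀ l : ℝ, l ≠ 0 → IsUnit (Gam α Y (l : ℂ))) {g f : L2}
    (hg : g ∈ weighted Y) (hf : f ∈ weighted Y) (t : ℝ) :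
    IntegrableOn (specDensity α Y g f) (Ioi 0) ∧
    inner ℂ g (expI (hamiltonian α Y) t (acProjection (expI (hamiltonian α Y)) f)) =
      ∫ x in Ioi (0 : ℝ), Complex.exp (Complex.I * (t : ℂ) * (x : ℂ)) * specDensity α Y g f x := by
  obtain ⟨K, hK, hP⟩ := exists_posDef_Gam α Y
  have hP := hP K le_rfl
  have hd := isDensity_specDensity hN hY hK hP hreg hg hf
  have hT := isPositive_kreinRes hK hP
  refine ⟨hd.integrableOn hT (by positivity), ?_⟩
  rw [acProjection_expI hN hY hK hP hreg, expI_hamiltonian hY hK hP]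
  exact hd.inner_invGroup hT (kreinRes_I_mul_injective hY hK) (by positivity) t

/-! ### From oscillatory integrals to weighted bounds -/

lemma measurable_Gam_inv (α : Fin N → ℝ) (Y : Fin N → R3) (j l : Fin N) :
    Measurable fun r : ℝ => (Gam α Y (r : ℂ))⁻¹ j l := by
  simp_rw [Gam_inv_apply]
  refine Measurable.mul ?_ ?_
  · exact (((continuous_Gam α Y).comp Complex.continuous_ofReal).matrix_det.measurable).inv
  · exact (((continuous_Gam α Y).comp Complex.continuous_ofReal).matrix_adjugate.matrix_elem j l).measurable

/-- The regularized Fresnel factor `e^{(it-ε)λ²}`. -/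
noncomputable def fresnel (t ε l : ℝ) : ℂ := Complex.exp ((Complex.I * t - ε) * (l : ℂ) ^ 2)

lemma norm_fresnel (t ε l : ℝ) : ‖fresnel t ε l‖ = Real.exp (-ε * l ^ 2) := by
  rw [fresnel, Complex.norm_exp]
  congr 1
  rw [← Complex.ofReal_pow, Complex.re_mul_ofReal]; simp

lemma continuous_fresnel (t ε : ℝ) : Continuous (fresnel t ε) := by unfold fresnel; fun_prop

lemma integrable_mul_fresnel {ε : ℝ} (hε : 0 < ε) (t : ℝ) :
    Integrable (fun l : ℝ => fresnel t ε l * l) := by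
  refine (integrable_mul_exp_neg_mul_sq hε).norm.mono'
    ((continuous_fresnel t ε).mul Complex.continuous_ofReal).aestronglyMeasurable
    (ae_of_all _ fun l => ?_)
  rw [norm_mul, norm_fresnel, norm_mul, Complex.norm_real, Real.norm_eq_abs (Real.exp _),
    abs_of_pos (Real.exp_pos _), mul_comm]

lemma integrable_fresnel_mul_bounded {ε : ℝ} (hε : 0 < ε) (t : ℝ) {h : ℝ → ℂ}
    (hm : AEStronglyMeasurable h volume) {C : ℝ} (hC : ∀ l, ‖h l‖ ≤ C) :
    Integrable (fun l : ℝ => fresnel t ε l * h l) := by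
  refine ((integrable_exp_neg_mul_sq hε).mul_const C).mono'
    ((continuous_fresnel t ε).aestronglyMeasurable.mul hm) (ae_of_all _ fun l => ?_)
  rw [norm_mul, norm_fresnel]
  exact mul_le_mul_of_nonneg_left (hC l) (Real.exp_pos _).le

/-- Regularized Fourier integrals of the spectral density, as integrals over the whole line of the
variable `λ = ±√x`. -/
lemma integral_exp_specDensity {α : Fin N → ℝ} {Y : Fin N → R3} {g f : L2} (t ε : ℝ)
    (hint : Integrable fun l : ℝ => fresnel t ε l * l * resBdry α Y g f l) :
    ∫ x in Ioi (0 : ℝ), Complex.exp ((Complex.I * t - ε) * x) * specDensity α Y g f x =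
      (Real.pi * Complex.I)⁻¹ * ∫ l : ℝ, fresnel t ε l * l * resBdry α Y g f l := by
  have hpi : (Real.pi : ℂ) ≠ 0 := by exact_mod_cast Real.pi_ne_zero
  rw [← integral_comp_rpow_Ioi_of_pos (p := 2) two_pos]
  have e1 : ∀ l ∈ Ioi (0 : ℝ), (2 * l ^ ((2 : ℝ) - 1)) • (Complex.exp ((Complex.I * t - ε) * ((l ^ (2 : ℝ) : ℝ) : ℂ)) *
      specDensity α Y g f (l ^ (2 : ℝ))) = (Real.pi * Complex.I)⁻¹ *
        ((fresnel t ε l * l * resBdry α Y g f l) +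
        (fresnel t ε (-l) * (-l : ℝ) * resBdry α Y g f (-l : ℝ))) := by
    intro l hl
    have hl' : (0 : ℝ) < l := hl
    rw [show (2 : ℝ) - 1 = 1 by norm_num, Real.rpow_one, Real.rpow_two, specDensity,
      Real.sqrt_sq hl'.le, Complex.real_smul, fresnel, fresnel]
    push_cast
    rw [neg_sq]
    field_simp
    ring
  rw [setIntegral_congr_fun measurableSet_Ioi e1, integral_const_mul]
  congr 1
  have i1 := hint.integrableOn (s := Ioi 0)
  have i2 : IntegrableOn (fun l : ℝ => fresnel t ε (-l) * (-l : ℝ) * resBdry α Y g f (-l : ℝ)) (Ioi 0) :=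
    (hint.comp_neg).integrableOn
  have e2 := setIntegral_union (Iic_disjoint_Ioi (le_refl (0:ℝ))) measurableSet_Ioi
    hint.integrableOn hint.integrableOn
  rw [Iic_union_Ioi, setIntegral_univ] at e2
  rw [integral_add i1 i2,
    integral_comp_neg_Ioi 0 (fun l : ℝ => fresnel t ε l * l * resBdry α Y g f l), neg_zero, add_comm, e2]

/-- The phase `‖x - y‖` cancels the singularity of the free amplitude. -/
lemma norm_freeAmp_mul_le (hN : 1 ≤ N) (Y : Fin N → R3) (g f : L2) (q : R3 × R3) :
    ‖freeAmp g f q‖ * ‖q.1 - q.2‖ ≤ (weight Y q.1 * ‖g q.1‖) * (weight Y q.2 * ‖f q.2‖) := by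
  have h1 := one_le_weight hN Y q.1
  have h2 := one_le_weight hN Y q.2
  have hn : ‖pairing g f q‖ = ‖g q.1‖ * ‖f q.2‖ := by
    rw [pairing, norm_mul, RCLike.norm_conj]
  have h3 : ‖4 * (Real.pi : ℂ) * (‖q.1 - q.2‖ : ℂ)‖ = 4 * Real.pi * ‖q.1 - q.2‖ := by
    simp [abs_of_pos Real.pi_pos]
  rw [freeAmp, norm_div, hn, h3]
  have h4 : ‖g q.1‖ * ‖f q.2‖ / (4 * Real.pi * ‖q.1 - q.2‖) * ‖q.1 - q.2‖ ≤ ‖g q.1‖ * ‖f q.2‖ := by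
    rcases (norm_nonneg (q.1 - q.2)).eq_or_lt with h | h
    · rw [← h, mul_zero]; positivity
    · have hp := Real.pi_pos
      rw [div_mul_eq_mul_div, div_le_iff₀ (by positivity)]
      have : 0 ≤ ‖g q.1‖ * ‖f q.2‖ * ‖q.1 - q.2‖ := by positivity
      nlinarith [Real.pi_gt_three]
  refine h4.trans (mul_le_mul (le_mul_of_one_le_left (norm_nonneg _) h1)
    (le_mul_of_one_le_left (norm_nonneg _) h2) (norm_nonneg _) (by positivity))

/-- The weight absorbs both the growth of the phase and the singularities of the pole amplitude. -/
lemma norm_poleAmp_mul_le (Y : Fin N → R3) (g f : L2) (j l : Fin N) (q : R3 × R3) :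
    ‖poleAmp g f (Y j) (Y l) q‖ * (1 + (‖q.1 - Y j‖ + ‖q.2 - Y l‖)) ≤
      (weight Y q.1 * ‖g q.1‖) * (weight Y q.2 * ‖f q.2‖) := by
  have key : ∀ (a : ℝ) (x y : R3) (w : ℝ), 0 ≤ a → 1 + 1 / ‖x - y‖ ≤ w →
      a / (4 * Real.pi * ‖x - y‖) * (1 + ‖x - y‖) ≤ w * a := by
    intro a x y w ha hw
    have h0 := norm_nonneg (x - y)
    rcases h0.eq_or_lt with h | h
    · rw [← h]; simp only [mul_zero, div_zero, zero_mul]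
      refine mul_nonneg (le_trans ?_ hw) ha
      positivity
    · have hp := Real.pi_pos
      refine le_trans ?_ (mul_le_mul_of_nonneg_right hw ha)
      rw [div_mul_eq_mul_div, div_le_iff₀ (by positivity)]
      have e : (1 + 1 / ‖x - y‖) * a * (4 * Real.pi * ‖x - y‖) = 4 * Real.pi * (a * (1 + ‖x - y‖)) := by
        field_simp; ring
      rw [e]
      have : 0 ≤ a * (1 + ‖x - y‖) := by positivity
      nlinarith [Real.pi_gt_three]
  have hp : ∀ x y : R3, ‖4 * (Real.pi : ℂ) * (‖x - y‖ : ℂ)‖ = 4 * Real.pi * ‖x - y‖ := fun x y => by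
    simp [abs_of_pos Real.pi_pos]
  rw [poleAmp, norm_mul, norm_div, norm_div, RCLike.norm_conj, hp, hp]
  set a := ‖g q.1‖ / (4 * Real.pi * ‖q.1 - Y j‖) with ha
  set b := ‖f q.2‖ / (4 * Real.pi * ‖q.2 - Y l‖) with hb
  have ha0 : 0 ≤ a := by have := Real.pi_pos; positivity
  have hb0 : 0 ≤ b := by have := Real.pi_pos; positivity
  have h1 := key _ q.1 (Y j) _ (norm_nonneg (g q.1)) (one_add_inv_le_weight Y j q.1)
  have h2 := key _ q.2 (Y l) _ (norm_nonneg (f q.2)) (one_add_inv_le_weight Y l q.2)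
  rw [← ha] at h1; rw [← hb] at h2
  have n1 := norm_nonneg (q.1 - Y j)
  have n2 := norm_nonneg (q.2 - Y l)
  calc a * b * (1 + (‖q.1 - Y j‖ + ‖q.2 - Y l‖))
      ≤ a * b * ((1 + ‖q.1 - Y j‖) * (1 + ‖q.2 - Y l‖)) := by
        refine mul_le_mul_of_nonneg_left ?_ (mul_nonneg ha0 hb0)
        nlinarith [mul_nonneg n1 n2]
    _ = (a * (1 + ‖q.1 - Y j‖)) * (b * (1 + ‖q.2 - Y l‖)) := by ring
    _ ≤ _ := mul_le_mul h1 h2 (by positivity) (le_trans (by positivity) h1)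

/-- An integral of amplitudes against a function bounded in terms of the phase. -/
lemma norm_integral_amp_le {Y : Fin N → R3} {g f : L2} (hg : g ∈ weighted Y) (hf : f ∈ weighted Y)
    {F : R3 × R3 → ℂ} {K : R3 × R3 → ℂ} {A : ℝ} {s : R3 × R3 → ℝ} (hA : 0 ≤ A)
    (hK : ∀ q, ‖K q‖ ≤ A * s q)
    (hF : ∀ q, ‖F q‖ * s q ≤ (weight Y q.1 * ‖g q.1‖) * (weight Y q.2 * ‖f q.2‖)) :
    ‖∫ q, F q * K q ∂(volume.prod volume)‖ ≤
      A * ((∫ x, weight Y x * ‖g x‖) * ∫ x, weight Y x * ‖f x‖) := by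
  rw [← integral_prod_mul, ← integral_const_mul]
  refine norm_integral_le_of_norm_le
    (((integrable_weight_mul hg).mul_prod (integrable_weight_mul hf)).const_mul A)
    (ae_of_all _ fun q => ?_)
  rw [norm_mul]
  calc ‖F q‖ * ‖K q‖ ≤ ‖F q‖ * (A * s q) := mul_le_mul_of_nonneg_left (hK q) (norm_nonneg _)
    _ = A * (‖F q‖ * s q) := by ring
    _ ≤ _ := mul_le_mul_of_nonneg_left (hF q) hA

/-- The dispersive estimate follows from bounds on one-dimensional oscillatory integrals which are
uniform in the regularization. -/
theorem norm_inner_expI_le (hN : 1 ≤ N) {α : Fin N → ℝ} {Y : Fin N → R3}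
    (hY : Function.Injective Y) (hreg : ∀ l : ℝ, l ≠ 0 → IsUnit (Gam α Y (l : ℂ)))
    {C : ℝ} (hC : ∀ (l : ℝ) j k, ‖(l : ℂ) * (Gam α Y (l : ℂ))⁻¹ j k‖ ≤ C)
    {t A₀ A₁ : ℝ} (ht : 0 < t) (hA₀ : 0 ≤ A₀) (hA₁ : 0 ≤ A₁)
    (h₀ : ∀ ε, 0 < ε → ε ≤ t → ∀ s : ℝ, 0 ≤ s →
      ‖∫ l : ℝ, fresnel t ε l * l * Complex.exp (Complex.I * l * s)‖ ≤ A₀ * s)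
    (h₁ : ∀ ε, 0 < ε → ε ≤ t → ∀ s : ℝ, 0 ≤ s → ∀ j k,
      ‖∫ l : ℝ, fresnel t ε l * (l * (Gam α Y (l : ℂ))⁻¹ j k) * Complex.exp (Complex.I * l * s)‖ ≤
        A₁ * (1 + s))
    {g f : L2} (hg : g ∈ weighted Y) (hf : f ∈ weighted Y) :
    ‖inner ℂ g (expI (hamiltonian α Y) t (acProjection (expI (hamiltonian α Y)) f))‖ ≤
      (A₀ + N ^ 2 * A₁) * ((∫ x, weight Y x * ‖g x‖) * ∫ x, weight Y x * ‖f x‖) := by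
  obtain ⟨hρ, hin⟩ := inner_expI_acProjection hN hY hreg hg hf t
  rw [hin]
  set W := (∫ x, weight Y x * ‖g x‖) * ∫ x, weight Y x * ‖f x‖ with hW
  have hW0 : 0 ≤ W := mul_nonneg
    (integral_nonneg fun x => mul_nonneg (Finset.sum_nonneg fun j _ => by positivity) (norm_nonneg _))
    (integral_nonneg fun x => mul_nonneg (Finset.sum_nonneg fun j _ => by positivity) (norm_nonneg _))
  -- The spectral density is integrable, so the factor `e^{-εx}` may be removed in the limit.
  have hlim : Tendsto (fun ε : ℝ => ∫ x in Ioi (0 : ℝ),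
      Complex.exp ((Complex.I * t - ε) * x) * specDensity α Y g f x) (𝓝[>] 0)
      (𝓝 (∫ x in Ioi (0 : ℝ), Complex.exp (Complex.I * (t : ℂ) * (x : ℂ)) * specDensity α Y g f x)) := by
    refine tendsto_integral_filter_of_dominated_convergence (fun x => ‖specDensity α Y g f x‖) ?_ ?_
      hρ.norm ?_
    · exact Eventually.of_forall fun ε => AEStronglyMeasurable.mul
        (Measurable.aestronglyMeasurable (by fun_prop)) hρ.1
    · filter_upwards [self_mem_nhdsWithin] with ε hε
      refine (ae_restrict_iff' measurableSet_Ioi).2 (ae_of_all _ fun x hx => ?_)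
      have hx' : (0 : ℝ) < x := hx
      have hε' : (0 : ℝ) < ε := hε
      rw [norm_mul, Complex.norm_exp]
      refine mul_le_of_le_one_left (norm_nonneg _) (Real.exp_le_one_iff.2 ?_)
      simp; positivity
    · refine ae_of_all _ fun x => ?_
      have : Continuous fun ε : ℝ => Complex.exp ((Complex.I * t - ε) * x) * specDensity α Y g f x := by
        fun_prop
      have := (this.tendsto 0).mono_left (nhdsWithin_le_nhds (s := Ioi 0))
      simpa using this
  refine le_of_tendsto hlim.norm ?_
  filter_upwards [Ioc_mem_nhdsGT ht] with ε hε
  obtain ⟨hε0, hεt⟩ := hε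
  have i₀ := integral_mul_oscInt (ν := volume.prod volume) (integrable_freeAmp (integrable_of_weighted hN hg)
    (integrable_of_weighted hN hf)) (s := fun q : R3 × R3 => ‖q.1 - q.2‖) (by fun_prop)
    (integrable_mul_fresnel hε0 t)
  have hΦ : ∀ j k, Integrable fun l : ℝ => fresnel t ε l * ((l : ℂ) * (Gam α Y (l : ℂ))⁻¹ j k) :=
    fun j k => integrable_fresnel_mul_bounded hε0 t
      ((Complex.measurable_ofReal.mul (measurable_Gam_inv α Y j k)).aestronglyMeasurable)
      (fun l => hC l j k)
  have i₁ := fun j k => integral_mul_oscInt (ν := volume.prod volume) (integrable_poleAmp hg hf j k)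
    (s := fun q : R3 × R3 => ‖q.1 - Y j‖ + ‖q.2 - Y k‖) (by fun_prop) (hΦ j k)
  have e : (fun l : ℝ => fresnel t ε l * l * resBdry α Y g f l) = fun l : ℝ =>
      fresnel t ε l * l * oscInt (volume.prod volume) (freeAmp g f) (fun q => ‖q.1 - q.2‖) l +
      ∑ j, ∑ k, fresnel t ε l * (l * (Gam α Y (l : ℂ))⁻¹ j k) *
        oscInt (volume.prod volume) (poleAmp g f (Y j) (Y k))
          (fun q => ‖q.1 - Y j‖ + ‖q.2 - Y k‖) l := by
    ext l
    simp only [resBdry, mul_add, Finset.mul_sum]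
    congr 1
    refine Finset.sum_congr rfl fun j _ => Finset.sum_congr rfl fun k _ => ?_
    ring
  have hsum : Integrable fun l : ℝ => ∑ j, ∑ k, fresnel t ε l * (l * (Gam α Y (l : ℂ))⁻¹ j k) *
        oscInt (volume.prod volume) (poleAmp g f (Y j) (Y k))
          (fun q => ‖q.1 - Y j‖ + ‖q.2 - Y k‖) l :=
    integrable_finsetSum _ fun j _ => integrable_finsetSum _ fun k _ => (i₁ j k).1
  -- In the variable `λ` the kernel splits, by Fubini, into one-dimensional integrals with phases
  -- `s = ‖x - y‖` and `s = ‖x - y_j‖ + ‖y - y_k‖`.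
  rw [integral_exp_specDensity t ε (by rw [e]; exact i₀.1.add hsum), e, integral_add i₀.1 hsum,
    integral_finsetSum _ fun j _ => integrable_finsetSum _ fun k _ => (i₁ j k).1]
  simp_rw [integral_finsetSum _ fun k (_ : k ∈ Finset.univ) => (i₁ _ k).1]
  rw [i₀.2]
  simp_rw [fun j k => (i₁ j k).2]
  have b₀ := norm_integral_amp_le hg hf (F := freeAmp g f)
    (K := fun q => ∫ l : ℝ, fresnel t ε l * l * Complex.exp (Complex.I * l * (‖q.1 - q.2‖ : ℝ)))
    (s := fun q => ‖q.1 - q.2‖) hA₀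
    (fun q => h₀ ε hε0 hεt _ (norm_nonneg _)) (norm_freeAmp_mul_le hN Y g f)
  have b₁ := fun j k => norm_integral_amp_le hg hf (F := poleAmp g f (Y j) (Y k))
    (K := fun q => ∫ l : ℝ, fresnel t ε l * (l * (Gam α Y (l : ℂ))⁻¹ j k) *
      Complex.exp (Complex.I * l * ((‖q.1 - Y j‖ + ‖q.2 - Y k‖ : ℝ) : ℂ)))
    (s := fun q => 1 + (‖q.1 - Y j‖ + ‖q.2 - Y k‖)) hA₁
    (fun q => h₁ ε hε0 hεt _ (by positivity) j k) (norm_poleAmp_mul_le Y g f j k)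
  rw [norm_mul]
  have hpi : ‖((Real.pi : ℂ) * Complex.I)⁻¹‖ ≤ 1 := by
    rw [norm_inv, norm_mul, Complex.norm_I, mul_one, Complex.norm_real, Real.norm_eq_abs,
      abs_of_pos Real.pi_pos]
    exact inv_le_one_of_one_le₀ (by linarith [Real.pi_gt_three])
  refine (mul_le_of_le_one_left (norm_nonneg _) hpi).trans ((norm_add_le _ _).trans ?_)
  rw [add_mul]
  refine add_le_add b₀ ((norm_sum_le _ _).trans ?_)
  calc ∑ j, ‖∑ k, ∫ q, poleAmp g f (Y j) (Y k) q * (∫ l : ℝ, fresnel t ε l * (l * (Gam α Y (l : ℂ))⁻¹ j k) *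
      Complex.exp (Complex.I * l * ((‖q.1 - Y j‖ + ‖q.2 - Y k‖ : ℝ) : ℂ))) ∂(volume.prod volume)‖
      ≤ ∑ _j : Fin N, ∑ _k : Fin N, A₁ * W := Finset.sum_le_sum fun j _ =>
        (norm_sum_le _ _).trans (Finset.sum_le_sum fun k _ => b₁ j k)
    _ = N ^ 2 * A₁ * W := by simp; ring

lemma weightedBound_of_forall_inner {Y : Fin N → R3} (hN : 1 ≤ N) {T : L2 →L[ℂ] L2} {B : ℝ} (hB : 0 ≤ B)
    (h : ∀ g ∈ weighted Y, ∀ f ∈ weighted Y,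
      ‖inner ℂ g (T f)‖ ≤ B * ((∫ x, weight Y x * ‖g x‖) * ∫ x, weight Y x * ‖f x‖)) :
    WeightedBound Y T B := by
  intro f hf
  have hf' : f ∈ weighted Y := hf
  have hw : ∀ x, 0 < weight Y x := fun x => lt_of_lt_of_le one_pos (one_le_weight hN Y x)
  set I := ∫ x, weight Y x * ‖f x‖ with hI
  have hI0 : 0 ≤ I := integral_nonneg fun x => mul_nonneg (hw x).le (norm_nonneg _)
  have h1 := norm_le_weight_of_forall_inner (Y := Y) (h := T f) (B := B * I) (mul_nonneg hB hI0)
    fun g hg => by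
      have := h g hg f hf'
      linarith
  have e : eLpNorm (fun x => weight Y x • f x) 1 volume = ENNReal.ofReal I := by
    have e1 : I = ∫ x, ‖weight Y x • f x‖ := by
      refine integral_congr_ae (ae_of_all _ fun x => ?_)
      simp only [norm_smul, Real.norm_eq_abs, abs_of_pos (hw x)]
    rw [eLpNorm_one_eq_lintegral_enorm, e1, ofReal_integral_norm_eq_lintegral_enorm
      (memLp_one_iff_integrable.1 hf)]
  rw [e, ← ENNReal.ofReal_mul hB, eLpNorm_exponent_top]
  refine eLpNormEssSup_le_of_ae_bound ?_
  filter_upwards [h1] with x hx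
  rw [norm_smul, norm_inv, Real.norm_eq_abs, abs_of_pos (hw x), inv_mul_le_iff₀ (hw x)]
  linarith

/-! ### One-dimensional oscillatory integrals -/

/-- The oscillating factor `e^{(it-ε)λ² + isλ}`. -/
noncomputable def wave (t ε s l : ℝ) : ℂ := fresnel t ε l * Complex.exp (Complex.I * l * s)

lemma wave_eq (t ε s l : ℝ) :
    wave t ε s l = Complex.exp ((Complex.I * t - ε) * (l : ℂ) ^ 2 + Complex.I * l * s) := by
  rw [wave, fresnel, Complex.exp_add]

lemma continuous_wave (t ε s : ℝ) : Continuous (wave t ε s) := by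
  unfold wave fresnel; fun_prop

lemma norm_wave (t ε s l : ℝ) : ‖wave t ε s l‖ = Real.exp (-ε * l ^ 2) := by
  rw [wave, norm_mul, norm_fresnel]
  have : ‖Complex.exp (Complex.I * l * s)‖ = 1 := by rw [norm_exp_I_mul]; simp
  rw [this, mul_one]

lemma norm_wave_le (t : ℝ) {ε : ℝ} (hε : 0 ≤ ε) (s l : ℝ) : ‖wave t ε s l‖ ≤ 1 := by
  rw [norm_wave]; exact Real.exp_le_one_iff.2 (by nlinarith [sq_nonneg l])

lemma wave_neg (t ε s l : ℝ) : wave t ε s (-l) = wave t ε (-s) l := by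
  rw [wave_eq, wave_eq]; push_cast; congr 1; ring

/-- Away from the stationary point `-s/(2t)` one integration by parts suffices. -/
lemma norm_integral_wave_tail_le {t ε : ℝ} (ht : 0 < t) (hε : 0 ≤ ε) (hεt : ε ≤ t) (s : ℝ) {x : ℝ}
    (hx : -s / (2 * t) + 1 / Real.sqrt t ≤ x) :
    ‖∫ l in (-s / (2 * t) + 1 / Real.sqrt t)..x, wave t ε s l‖ ≤ 2 * (1 / Real.sqrt t) := by
  set m := -s / (2 * t) with hm
  set δ := 1 / Real.sqrt t with hδ
  have hδ0 : 0 < δ := by positivity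
  have hδt : t * δ ^ 2 = 1 := by
    rw [hδ, div_pow, Real.sq_sqrt ht.le]; field_simp
  have hms : s = -(2 * t * m) := by rw [hm]; field_simp
  let q' : ℝ → ℂ := fun l => 2 * (Complex.I * t - ε) * l + Complex.I * s
  let q'' : ℂ := 2 * (Complex.I * t - ε)
  have hq'low : ∀ l, m < l → 2 * t * (l - m) ≤ ‖q' l‖ := by
    intro l hl
    refine le_trans (le_of_eq ?_) ((le_abs_self _).trans (Complex.abs_im_le_norm (q' l)))
    simp [q']; rw [hms]; ring
  have hq'ne : ∀ l, m < l → q' l ≠ 0 := fun l hl h0 => by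
    have := hq'low l hl
    rw [h0, norm_zero] at this
    have : 0 < 2 * t * (l - m) := mul_pos (by linarith) (by linarith)
    linarith
  have hq''n : ‖q''‖ ≤ 4 * t := by
    have : ‖Complex.I * t - ε‖ ≤ t + ε := by
      refine (norm_sub_le _ _).trans (le_of_eq ?_)
      simp [abs_of_pos ht, abs_of_nonneg hε]
    rw [norm_mul, Complex.norm_ofNat]; linarith
  have hmem : ∀ l ∈ uIcc (m + δ) x, m + δ ≤ l := fun l hl => by
    rw [uIcc_of_le hx] at hl; exact hl.1
  have hwave : ∀ l, HasDerivAt (wave t ε s) (wave t ε s l * q' l) l := by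
    intro l
    have e : wave t ε s = fun l : ℝ =>
        Complex.exp ((Complex.I * t - ε) * (l : ℂ) ^ 2 + Complex.I * l * s) := funext (wave_eq t ε s)
    have h1 : HasDerivAt (fun l : ℝ => (l : ℂ)) 1 l := Complex.ofRealCLM.hasDerivAt
    have h2 : HasDerivAt (fun l : ℝ => (Complex.I * t - ε) * (l : ℂ) ^ 2 + Complex.I * l * s) (q' l) l := by
      refine (((h1.fun_pow 2).const_mul (Complex.I * t - ε)).fun_add
        ((h1.const_mul Complex.I).mul_const (s : ℂ))).congr_deriv ?_
      simp only [q']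
      push_cast; ring
    rw [e]
    exact h2.cexp
  have hq' : ∀ l, HasDerivAt q' q'' l := by
    intro l
    have h1 : HasDerivAt (fun l : ℝ => (l : ℂ)) 1 l := Complex.ofRealCLM.hasDerivAt
    exact ((h1.const_mul (2 * (Complex.I * t - ε))).add_const (Complex.I * s)).congr_deriv (mul_one _)
  have hder : ∀ l ∈ uIcc (m + δ) x, HasDerivAt (fun l => wave t ε s l / q' l)
      (wave t ε s l - wave t ε s l * q'' / q' l ^ 2) l := by
    intro l hl
    have hne := hq'ne l (by linarith [hmem l hl])
    refine ((hwave l).div (hq' l) hne).congr_deriv ?_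
    field_simp
  have hq'c : Continuous q' := by fun_prop
  have hc2 : ContinuousOn (fun l => wave t ε s l * q'' / q' l ^ 2) (uIcc (m + δ) x) :=
    (((continuous_wave t ε s).mul continuous_const).continuousOn).div (hq'c.pow 2).continuousOn
      fun l hl => pow_ne_zero 2 (hq'ne l (by linarith [hmem l hl]))
  have hi1 : IntervalIntegrable (wave t ε s) volume (m + δ) x :=
    (continuous_wave t ε s).intervalIntegrable _ _
  have hi2 := hc2.intervalIntegrable (μ := volume)
  have hFTC := intervalIntegral.integral_eq_sub_of_hasDerivAt hder (hi1.sub hi2)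
  rw [intervalIntegral.integral_sub hi1 hi2] at hFTC
  have heq : ∫ l in (m + δ)..x, wave t ε s l = (wave t ε s x / q' x - wave t ε s (m + δ) / q' (m + δ)) +
      ∫ l in (m + δ)..x, wave t ε s l * q'' / q' l ^ 2 := by
    rw [← hFTC]; ring
  have hb : ∀ l, m + δ ≤ l → ‖wave t ε s l / q' l‖ ≤ δ / 2 := by
    intro l hl
    have h1 := hq'low l (by linarith)
    have h2 : 2 * t * δ ≤ ‖q' l‖ := by nlinarith
    have h3 : 0 < 2 * t * δ := by positivity
    rw [norm_div, div_le_iff₀ (by linarith)]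
    have := norm_wave_le t hε s l
    nlinarith
  have hrest : ‖∫ l in (m + δ)..x, wave t ε s l * q'' / q' l ^ 2‖ ≤ δ := by
    have hd : ∀ l ∈ uIcc (m + δ) x, HasDerivAt (fun l => -(1 / t) * (l - m)⁻¹) (1 / t * ((l - m) ^ 2)⁻¹) l := by
      intro l hl
      have hne : l - m ≠ 0 := by linarith [hmem l hl]
      refine ((((hasDerivAt_id l).sub_const m).inv hne).const_mul (-(1 / t))).congr_deriv ?_
      simp only [id]; field_simp
    have hcc : ContinuousOn (fun l => 1 / t * ((l - m) ^ 2)⁻¹) (uIcc (m + δ) x) := by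
      refine continuousOn_const.mul (ContinuousOn.inv₀ (by fun_prop) fun l hl => ?_)
      have : l - m ≠ 0 := by linarith [hmem l hl]
      exact pow_ne_zero 2 this
    have hi := hcc.intervalIntegrable (μ := volume)
    have hle : ‖∫ l in (m + δ)..x, wave t ε s l * q'' / q' l ^ 2‖ ≤
        ∫ l in (m + δ)..x, 1 / t * ((l - m) ^ 2)⁻¹ := by
      refine intervalIntegral.norm_integral_le_of_norm_le hx (ae_of_all _ fun l hl => ?_) hi
      have hlm : 0 < l - m := by linarith [hl.1]
      have h1 := hq'low l (by linarith)
      rw [norm_div, norm_mul, norm_pow]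
      have h2 : (2 * t * (l - m)) ^ 2 ≤ ‖q' l‖ ^ 2 := pow_le_pow_left₀ (by positivity) h1 2
      have h3 : ‖wave t ε s l‖ * ‖q''‖ ≤ 4 * t := by
        have := norm_wave_le t hε s l
        nlinarith [norm_nonneg q'', norm_nonneg (wave t ε s l)]
      calc ‖wave t ε s l‖ * ‖q''‖ / ‖q' l‖ ^ 2 ≤ 4 * t / (2 * t * (l - m)) ^ 2 :=
            div_le_div₀ (by positivity) h3 (by positivity) h2
        _ = 1 / t * ((l - m) ^ 2)⁻¹ := by field_simp; ring
    refine hle.trans ?_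
    rw [intervalIntegral.integral_eq_sub_of_hasDerivAt hd hi]
    have h4 : 0 ≤ 1 / t * (x - m)⁻¹ := by
      have : 0 < x - m := by linarith
      positivity
    have h5 : 1 / t * (m + δ - m)⁻¹ = δ := by
      rw [add_sub_cancel_left]; field_simp; linarith
    linarith
  rw [heq]
  refine (norm_add_le _ _).trans ?_
  have := (norm_sub_le (wave t ε s x / q' x) (wave t ε s (m + δ) / q' (m + δ))).trans
    (add_le_add (hb x hx) (hb (m + δ) le_rfl))
  linarith

/-- Near the stationary point, on an interval of length `1/√t`, the trivial bound is used. -/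
lemma norm_integral_wave_right_le {t ε : ℝ} (ht : 0 < t) (hε : 0 ≤ ε) (hεt : ε ≤ t) (s : ℝ) {x : ℝ}
    (hx : -s / (2 * t) ≤ x) :
    ‖∫ l in (-s / (2 * t))..x, wave t ε s l‖ ≤ 3 * (1 / Real.sqrt t) := by
  set m := -s / (2 * t) with hm
  set δ := 1 / Real.sqrt t with hδ
  have hδ0 : 0 < δ := by positivity
  have hshort : ∀ y, m ≤ y → y ≤ m + δ → ‖∫ l in m..y, wave t ε s l‖ ≤ δ := by
    intro y h1 h2
    have := intervalIntegral.norm_integral_le_of_norm_le_const (a := m) (b := y) (C := 1)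
      (f := wave t ε s) fun l _ => norm_wave_le t hε s l
    rw [one_mul, abs_of_nonneg (by linarith)] at this
    linarith
  rcases le_total x (m + δ) with h | h
  · linarith [hshort x hx h]
  · have hi : ∀ a b, IntervalIntegrable (wave t ε s) volume a b :=
      fun a b => (continuous_wave t ε s).intervalIntegrable _ _
    rw [← intervalIntegral.integral_add_adjacent_intervals (hi m (m + δ)) (hi (m + δ) x)]
    refine (norm_add_le _ _).trans ?_
    have h1 := hshort (m + δ) (by linarith) le_rfl
    have h2 := norm_integral_wave_tail_le ht hε hεt s h
    linarith

/-- Van der Corput's bound for the primitive of the oscillating factor that vanishes at the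
stationary point. -/
lemma norm_integral_wave_le {t ε : ℝ} (ht : 0 < t) (hε : 0 ≤ ε) (hεt : ε ≤ t) (s x : ℝ) :
    ‖∫ l in (-s / (2 * t))..x, wave t ε s l‖ ≤ 3 * (1 / Real.sqrt t) := by
  rcases le_total (-s / (2 * t)) x with h | h
  · exact norm_integral_wave_right_le ht hε hεt s h
  · have h1 := norm_integral_wave_right_le ht hε hεt (-s) (x := -x)
      (by rw [neg_neg]; rw [neg_div] at h; linarith)
    have h2 : ∫ l in (-s / (2 * t))..x, wave t ε s l = -∫ l in (-(-s) / (2 * t))..(-x), wave t ε (-s) l := by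
      simp_rw [← wave_neg t ε s]
      rw [intervalIntegral.integral_comp_neg (fun l => wave t ε s l), neg_neg, neg_neg,
        intervalIntegral.integral_symm, neg_div]
    rw [h2, norm_neg]; exact h1

/-- A bounded `C¹` function with integrable derivative, with a bound on its size and variation. -/
structure HasVarBound (h h' : ℝ → ℂ) (M : ℝ) : Prop where
  deriv : ∀ x, HasDerivAt h (h' x) x
  cont : Continuous h'
  integrable : Integrable h'
  bound : ∀ x, ‖h x‖ ≤ M
  variation : ∫ x, ‖h' x‖ ≤ M

lemma HasVarBound.continuous {h h' : ℝ → ℂ} {M : ℝ} (H : HasVarBound h h' M) : Continuous h :=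
  continuous_iff_continuousAt.2 fun x => (H.deriv x).continuousAt

lemma HasVarBound.nonneg {h h' : ℝ → ℂ} {M : ℝ} (H : HasVarBound h h' M) : 0 ≤ M :=
  (norm_nonneg _).trans (H.bound 0)

lemma integrable_wave_mul (t : ℝ) {ε : ℝ} (hε : 0 < ε) (s : ℝ) {h : ℝ → ℂ} (hc : Continuous h) {M : ℝ}
    (hM : ∀ x, ‖h x‖ ≤ M) : Integrable fun l => wave t ε s l * h l := by
  refine ((integrable_exp_neg_mul_sq hε).mul_const M).mono'
    ((continuous_wave t ε s).mul hc).aestronglyMeasurable (ae_of_all _ fun l => ?_)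
  rw [norm_mul, norm_wave]
  exact mul_le_mul_of_nonneg_left (hM l) (Real.exp_pos _).le

/-- Van der Corput's lemma for amplitudes of bounded variation. -/
lemma HasVarBound.norm_integral_wave_mul_le {h h' : ℝ → ℂ} {M : ℝ} (H : HasVarBound h h' M)
    {t ε : ℝ} (ht : 0 < t) (hε : 0 < ε) (hεt : ε ≤ t) (s : ℝ) :
    ‖∫ l, wave t ε s l * h l‖ ≤ 9 * M / Real.sqrt t := by
  -- Integrate by parts against the primitive `F` of the oscillating factor, which is `O(1/√t)`.
  let F : ℝ → ℂ := fun x => ∫ l in (-s / (2 * t))..x, wave t ε s l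
  have hF : ∀ x, HasDerivAt F (wave t ε s x) x := fun x =>
    (continuous_wave t ε s).integral_hasStrictDerivAt _ x |>.hasDerivAt
  have hFb : ∀ x, ‖F x‖ ≤ 3 * (1 / Real.sqrt t) := norm_integral_wave_le ht hε.le hεt s
  have hFc : Continuous F := continuous_iff_continuousAt.2 fun x => (hF x).continuousAt
  have hδ0 : 0 < 1 / Real.sqrt t := by positivity
  have hint := integrable_wave_mul t hε s H.continuous H.bound
  have hlim := intervalIntegral_tendsto_integral hint tendsto_neg_atTop_atBot tendsto_id
  refine le_of_tendsto hlim.norm ?_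
  filter_upwards [eventually_ge_atTop 0] with R hR
  have hparts := intervalIntegral.integral_deriv_mul_eq_sub (a := -R) (b := R)
    (u := F) (v := h) (u' := wave t ε s) (v' := h') (fun x _ => hF x) (fun x _ => H.deriv x)
    ((continuous_wave t ε s).intervalIntegrable _ _) (H.cont.intervalIntegrable _ _)
  have i1 : IntervalIntegrable (fun l => wave t ε s l * h l) volume (-R) R :=
    ((continuous_wave t ε s).mul H.continuous).intervalIntegrable _ _
  have i2 : IntervalIntegrable (fun l => F l * h' l) volume (-R) R :=
    (hFc.mul H.cont).intervalIntegrable _ _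
  rw [intervalIntegral.integral_add i1 i2] at hparts
  have e : ∫ l in (-R)..R, wave t ε s l * h l = (F R * h R - F (-R) * h (-R)) -
      ∫ l in (-R)..R, F l * h' l := by rw [← hparts]; ring
  have hb : ∀ x, ‖F x * h x‖ ≤ 3 * (1 / Real.sqrt t) * M := fun x => by
    rw [norm_mul]; exact mul_le_mul (hFb x) (H.bound x) (norm_nonneg _) (by positivity)
  have hr : ‖∫ l in (-R)..R, F l * h' l‖ ≤ 3 * (1 / Real.sqrt t) * M := by
    have h1 : ‖∫ l in (-R)..R, F l * h' l‖ ≤ ∫ l in (-R)..R, 3 * (1 / Real.sqrt t) * ‖h' l‖ := by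
      refine intervalIntegral.norm_integral_le_of_norm_le (by linarith) (ae_of_all _ fun l _ => ?_)
        ((H.cont.norm.const_mul _).intervalIntegrable _ _)
      rw [norm_mul]; exact mul_le_mul_of_nonneg_right (hFb l) (norm_nonneg _)
    refine h1.trans ?_
    rw [intervalIntegral.integral_const_mul]
    refine mul_le_mul_of_nonneg_left ?_ (by positivity)
    rw [intervalIntegral.integral_of_le (by linarith)]
    exact (setIntegral_le_integral H.integrable.norm (ae_of_all _ fun x => norm_nonneg _)).trans H.variation
  simp only [id]
  rw [e]
  refine (norm_sub_le _ _).trans ?_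
  have h3 := (norm_sub_le (F R * h R) (F (-R) * h (-R))).trans (add_le_add (hb R) (hb (-R)))
  have h4 : 9 * M / Real.sqrt t = 9 * (1 / Real.sqrt t) * M := by ring
  rw [h4]; linarith

/-- With an additional factor `λ`, an integration by parts gains a factor `1/t`. -/
lemma HasVarBound.norm_integral_wave_mul_id_le {h h' h'' : ℝ → ℂ} {M M' : ℝ} (H : HasVarBound h h' M)
    (H' : HasVarBound h' h'' M') {t ε : ℝ} (ht : 0 < t) (hε : 0 < ε) (hεt : ε ≤ t) {s : ℝ} (hs : 0 ≤ s) :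
    ‖∫ l : ℝ, fresnel t ε l * (l * h l) * Complex.exp (Complex.I * l * s)‖ ≤
      5 / (t * Real.sqrt t) * (M' + s * M) := by
  set p : ℂ := Complex.I * t - ε with hp
  have hpn : t ≤ ‖p‖ := by
    refine le_trans (le_of_eq ?_) ((le_abs_self _).trans (Complex.abs_im_le_norm p))
    simp [hp]
  have hp0 : p ≠ 0 := fun h => by rw [h, norm_zero] at hpn; linarith
  let u : ℝ → ℂ := fun l => h l * Complex.exp (Complex.I * l * s)
  let u' : ℝ → ℂ := fun l => (h' l + Complex.I * s * h l) * Complex.exp (Complex.I * l * s)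
  let v : ℝ → ℂ := fun l => fresnel t ε l / (2 * p)
  let v' : ℝ → ℂ := fun l => fresnel t ε l * l
  have h1 : ∀ l : ℝ, HasDerivAt (fun l : ℝ => (l : ℂ)) 1 l := fun l => Complex.ofRealCLM.hasDerivAt
  have hu : ∀ l, HasDerivAt u (u' l) l := fun l => by
    refine ((H.deriv l).mul (((h1 l).const_mul Complex.I).mul_const (s : ℂ)).cexp).congr_deriv ?_
    simp only [u']; ring
  have hv : ∀ l, HasDerivAt v (v' l) l := fun l => by
    refine ((((h1 l).fun_pow 2).const_mul p).cexp.div_const (2 * p)).congr_deriv ?_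
    simp only [v', fresnel]
    rw [← hp]
    push_cast; field_simp
  have hfr : Integrable (fresnel t ε) := by
    have := integrable_fresnel_mul_bounded hε t (h := fun _ => (1 : ℂ)) aestronglyMeasurable_const
      (C := 1) (by simp)
    simpa using this
  have hexp : ∀ l : ℝ, ‖Complex.exp (Complex.I * l * s)‖ = 1 := fun l => by
    rw [norm_exp_I_mul]; simp
  have hcexp : Continuous fun l : ℝ => Complex.exp (Complex.I * l * s) := by fun_prop
  have hub : ∀ l, ‖u l‖ ≤ M := fun l => by
    simp only [u]; rw [norm_mul, hexp, mul_one]; exact H.bound l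
  have huc : Continuous u := H.continuous.mul hcexp
  have hu'c : Continuous u' := (H.cont.add (continuous_const.mul H.continuous)).mul hcexp
  have hu'b : ∀ l, ‖u' l‖ ≤ M' + s * M := fun l => by
    simp only [u']; rw [norm_mul, hexp, mul_one]
    refine (norm_add_le _ _).trans (add_le_add (H'.bound l) ?_)
    rw [norm_mul, norm_mul, Complex.norm_I, one_mul, Complex.norm_real, Real.norm_eq_abs, abs_of_nonneg hs]
    exact mul_le_mul_of_nonneg_left (H.bound l) hs
  have k1 : Integrable (u * v') := (integrable_mul_fresnel hε t).bdd_mul huc.aestronglyMeasurable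
    (ae_of_all _ hub)
  have k2 : Integrable (u' * v) := (hfr.div_const (2 * p)).bdd_mul hu'c.aestronglyMeasurable
    (ae_of_all _ hu'b)
  have k3 : Integrable (u * v) := (hfr.div_const (2 * p)).bdd_mul huc.aestronglyMeasurable
    (ae_of_all _ hub)
  -- `fresnel l * l` is the derivative of `fresnel l / (2(it - ε))`.
  have hparts := integral_mul_deriv_eq_deriv_mul_of_integrable (fun x _ => hu x) (fun x _ => hv x)
    k1 k2 k3
  have e1 : ∫ l : ℝ, fresnel t ε l * (l * h l) * Complex.exp (Complex.I * l * s) = ∫ l, u l * v' l := by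
    refine integral_congr_ae (ae_of_all _ fun l => ?_)
    simp only [u, v']; ring
  have w1 := integrable_wave_mul t hε s H'.continuous H'.bound
  have w2 := integrable_wave_mul t hε s H.continuous H.bound
  have e2 : ∫ l, u' l * v l = (2 * p)⁻¹ * ((∫ l, wave t ε s l * h' l) +
      Complex.I * s * ∫ l, wave t ε s l * h l) := by
    rw [← integral_const_mul (Complex.I * s), ← integral_add w1 (w2.const_mul _), ← integral_const_mul]
    refine integral_congr_ae (ae_of_all _ fun l => ?_)
    simp only [u', v, wave]; ring
  rw [e1, hparts, norm_neg, e2, norm_mul]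
  have b1 := H'.norm_integral_wave_mul_le ht hε hεt s
  have b2 := H.norm_integral_wave_mul_le ht hε hεt s
  have hpi : ‖(2 * p)⁻¹‖ ≤ 1 / (2 * t) := by
    rw [norm_inv, norm_mul, Complex.norm_ofNat, ← one_div]
    exact one_div_le_one_div_of_le (by linarith) (by linarith)
  have b3 : ‖(∫ l, wave t ε s l * h' l) + Complex.I * s * ∫ l, wave t ε s l * h l‖ ≤
      9 / Real.sqrt t * (M' + s * M) := by
    refine (norm_add_le _ _).trans ?_
    rw [norm_mul, norm_mul, Complex.norm_I, one_mul, Complex.norm_real, Real.norm_eq_abs, abs_of_nonneg hs]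
    have := mul_le_mul_of_nonneg_left b2 hs
    have e3 : 9 / Real.sqrt t * (M' + s * M) = 9 * M' / Real.sqrt t + s * (9 * M / Real.sqrt t) := by ring
    linarith
  have hS : 0 ≤ M' + s * M := add_nonneg H'.nonneg (mul_nonneg hs H.nonneg)
  have hst : 0 < Real.sqrt t := Real.sqrt_pos.2 ht
  calc _ ≤ 1 / (2 * t) * (9 / Real.sqrt t * (M' + s * M)) :=
        mul_le_mul hpi b3 (norm_nonneg _) (by positivity)
    _ = (9 / 2) / (t * Real.sqrt t) * (M' + s * M) := by field_simp
    _ ≤ _ := by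
        refine mul_le_mul_of_nonneg_right ?_ hS
        gcongr; norm_num

lemma hasVarBound_const (a : ℂ) : HasVarBound (fun _ => a) (fun _ => 0) ‖a‖ where
  deriv x := hasDerivAt_const x a
  cont := continuous_const
  integrable := integrable_zero _ _ _
  bound _ := le_rfl
  variation := by simp

lemma hasVarBound_zero : HasVarBound (fun _ => 0) (fun _ => 0) 0 := by
  simpa using hasVarBound_const 0

/-! ### The inverse of `Γ` on the real axis -/

/-- Invertibility on the negative half-line follows from `Γ(λ)* = Γ(-λ)`. -/
lemma isUnit_Gam_of_regularGam {α : Fin N → ℝ} {Y : Fin N → R3} (h : RegularGam α Y) (l : ℝ) :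
    IsUnit (Gam α Y (l : ℂ)) := by
  rcases le_total 0 l with hl | hl
  · exact h.1 l hl
  · have h1 := h.1 (-l) (by linarith)
    have h2 : Gam α Y (l : ℂ) = (Gam α Y ((-l : ℝ) : ℂ))ᴴ := by
      rw [conjTranspose_Gam]; simp
    rw [h2]
    exact (Matrix.isUnit_conjTranspose _).2 h1

/-- The entries of `dΓ/dλ` on the real axis. -/
noncomputable def GamDeriv (Y : Fin N → R3) (j k : Fin N) (l : ℝ) : ℂ :=
  -(Complex.I / (4 * (Real.pi : ℂ))) * Complex.exp (Complex.I * l * ‖Y j - Y k‖)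

/-- The entries of `d²Γ/dλ²` on the real axis. -/
noncomputable def GamDeriv2 (Y : Fin N → R3) (j k : Fin N) (l : ℝ) : ℂ :=
  (‖Y j - Y k‖ : ℂ) / (4 * (Real.pi : ℂ)) * Complex.exp (Complex.I * l * ‖Y j - Y k‖)

lemma hasDerivAt_exp_I_mul (d l : ℝ) :
    HasDerivAt (fun l : ℝ => Complex.exp (Complex.I * l * d)) (Complex.exp (Complex.I * l * d) * (Complex.I * d)) l := by
  have h1 : HasDerivAt (fun l : ℝ => (l : ℂ)) 1 l := Complex.ofRealCLM.hasDerivAt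
  refine ((h1.const_mul Complex.I).mul_const (d : ℂ)).cexp.congr_deriv (by ring)

/-- The singularity `1/|y_j - y_k|` disappears from the derivative, so that the formula for the diagonal
is the case `|y_j - y_k| = 0` of the one off the diagonal. -/
lemma hasDerivAt_Gam (α : Fin N → ℝ) {Y : Fin N → R3} (hY : Function.Injective Y) (j k : Fin N) (l : ℝ) :
    HasDerivAt (fun l : ℝ => Gam α Y (l : ℂ) j k) (GamDeriv Y j k l) l := by
  have h1 : HasDerivAt (fun l : ℝ => (l : ℂ)) 1 l := Complex.ofRealCLM.hasDerivAt
  by_cases hjk : j = k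
  · subst hjk
    simp only [Gam, Matrix.of_apply, if_true, sub_self, GamDeriv, norm_zero]
    have h2 := (((h1.const_mul Complex.I).div_const (4 * (Real.pi : ℂ))).const_sub (α j : ℂ))
    have h3 : ∀ z, green z (0 : R3) = 0 := fun z => by simp [green]
    simp only [h3, sub_zero]
    exact h2.congr_deriv (by simp)
  · have hne : Y j - Y k ≠ 0 := sub_ne_zero.2 fun h => hjk (hY h)
    have hn : (‖Y j - Y k‖ : ℂ) ≠ 0 := Complex.ofReal_ne_zero.2 (norm_ne_zero_iff.2 hne)
    simp only [Gam, Matrix.of_apply, if_neg hjk, zero_sub, green, if_neg hne, GamDeriv]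
    refine ((hasDerivAt_exp_I_mul ‖Y j - Y k‖ l).div_const
      (4 * (Real.pi : ℂ) * (‖Y j - Y k‖ : ℂ))).fun_neg.congr_deriv ?_
    field_simp

lemma hasDerivAt_GamDeriv (Y : Fin N → R3) (j k : Fin N) (l : ℝ) :
    HasDerivAt (GamDeriv Y j k) (GamDeriv2 Y j k l) l := by
  refine ((hasDerivAt_exp_I_mul ‖Y j - Y k‖ l).const_mul
    (-(Complex.I / (4 * (Real.pi : ℂ))))).congr_deriv ?_
  simp only [GamDeriv2]
  linear_combination (-(‖Y j - Y k‖ : ℂ) / (4 * (Real.pi : ℂ)) * Complex.exp (Complex.I * l * ‖Y j - Y k‖)) *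
    Complex.I_mul_I

lemma continuous_GamDeriv (Y : Fin N → R3) (j k : Fin N) : Continuous (GamDeriv Y j k) := by
  unfold GamDeriv; fun_prop

lemma continuous_GamDeriv2 (Y : Fin N → R3) (j k : Fin N) : Continuous (GamDeriv2 Y j k) := by
  unfold GamDeriv2; fun_prop

lemma norm_GamDeriv_le (Y : Fin N → R3) (j k : Fin N) (l : ℝ) : ‖GamDeriv Y j k l‖ ≤ 1 := by
  have h : ‖Complex.exp (Complex.I * l * ‖Y j - Y k‖)‖ = 1 := by rw [norm_exp_I_mul]; simp
  rw [GamDeriv, norm_mul, h, mul_one, norm_neg, norm_div, Complex.norm_I, norm_mul, Complex.norm_real,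
    Real.norm_eq_abs, abs_of_pos Real.pi_pos, Complex.norm_ofNat, div_le_one (by positivity)]
  linarith [Real.pi_gt_three]

lemma exists_norm_GamDeriv2_le (Y : Fin N → R3) : ∃ D : ℝ, 0 ≤ D ∧ ∀ j k l, ‖GamDeriv2 Y j k l‖ ≤ D := by
  refine ⟨∑ j, ∑ k, ‖Y j - Y k‖, Finset.sum_nonneg fun _ _ => Finset.sum_nonneg fun _ _ => norm_nonneg _,
    fun j k l => ?_⟩
  have h : ‖Complex.exp (Complex.I * l * ‖Y j - Y k‖)‖ = 1 := by rw [norm_exp_I_mul]; simp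
  rw [GamDeriv2, norm_mul, h, mul_one, norm_div, norm_mul, Complex.norm_real, Complex.norm_real,
    Real.norm_eq_abs Real.pi, abs_of_pos Real.pi_pos, Complex.norm_ofNat, norm_norm]
  have h1 : ‖Y j - Y k‖ / (4 * Real.pi) ≤ ‖Y j - Y k‖ :=
    div_le_self (norm_nonneg _) (by linarith [Real.pi_gt_three])
  refine h1.trans ((Finset.single_le_sum (f := fun k => ‖Y j - Y k‖) (fun _ _ => norm_nonneg _)
    (Finset.mem_univ k)).trans (Finset.single_le_sum (f := fun j => ∑ k, ‖Y j - Y k‖)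
    (fun _ _ => Finset.sum_nonneg fun _ _ => norm_nonneg _) (Finset.mem_univ j)))

section Inverse

variable {α : Fin N → ℝ} {Y : Fin N → R3}

lemma continuous_Gam_inv_ofReal (hG : ∀ l : ℝ, IsUnit (Gam α Y (l : ℂ))) (j k : Fin N) :
    Continuous fun l : ℝ => (Gam α Y (l : ℂ))⁻¹ j k :=
  (continuousOn_Gam_inv α Y j k).comp_continuous Complex.continuous_ofReal hG

/-- `Γ(λ)⁻¹` decays like `1/λ`, because the diagonal of `Γ(λ)` grows linearly while the remaining
entries stay bounded. -/
lemma exists_norm_Gam_inv_le (hG : ∀ l : ℝ, IsUnit (Gam α Y (l : ℂ))) :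
    ∃ K : ℝ, 0 ≤ K ∧ ∀ (l : ℝ) j k, ‖(Gam α Y (l : ℂ))⁻¹ j k‖ ≤ K / (1 + |l|) := by
  set g : ℝ := ∑ j, ∑ b, 1 / (4 * Real.pi * ‖Y j - Y b‖) with hg
  have hg0 : 0 ≤ g := Finset.sum_nonneg fun _ _ => Finset.sum_nonneg fun _ _ => by positivity
  set R : ℝ := 1 + 8 * Real.pi * g with hR
  have hpi := Real.pi_pos
  have hR1 : 1 ≤ R := by have : 0 ≤ 8 * Real.pi * g := by positivity
                         linarith
  have hcomp : ∀ j k, ∃ K : ℝ, ∀ l ∈ Icc (-R) R, ‖(1 + |l|) * ‖(Gam α Y (l : ℂ))⁻¹ j k‖‖ ≤ K := fun j k =>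
    isCompact_Icc.exists_bound_of_continuousOn
      ((continuous_const.add continuous_abs).mul (continuous_Gam_inv_ofReal hG j k).norm).continuousOn
  choose K0 hK0 using hcomp
  have hK0n : ∀ j k, 0 ≤ K0 j k := fun j k => (norm_nonneg _).trans (hK0 j k 0 (by constructor <;> linarith))
  refine ⟨(∑ j, ∑ k, K0 j k) + 16 * Real.pi, add_nonneg (Finset.sum_nonneg fun _ _ =>
    Finset.sum_nonneg fun _ _ => hK0n _ _) (by positivity), fun l j k => ?_⟩
  rw [le_div_iff₀ (by positivity), mul_comm]
  have hsum0 : K0 j k ≤ ∑ j, ∑ k, K0 j k :=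
    (Finset.single_le_sum (f := fun k => K0 j k) (fun _ _ => hK0n _ _) (Finset.mem_univ k)).trans
      (Finset.single_le_sum (f := fun j => ∑ k, K0 j k)
        (fun _ _ => Finset.sum_nonneg fun _ _ => hK0n _ _) (Finset.mem_univ j))
  rcases le_or_gt |l| R with hl | hl
  · have h1 := hK0 j k l (abs_le.1 hl)
    rw [Real.norm_of_nonneg (by positivity)] at h1
    have : 0 ≤ 16 * Real.pi := by positivity
    linarith
  · set B := (Gam α Y (l : ℂ))⁻¹ with hB
    have hmul : Gam α Y (l : ℂ) * B = 1 :=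
      Matrix.mul_nonsing_inv _ ((Matrix.isUnit_iff_isUnit_det _).1 (hG l))
    set m := ∑ b, ‖B b k‖ with hm
    have hm0 : 0 ≤ m := Finset.sum_nonneg fun _ _ => norm_nonneg _
    -- Row `i` of `Γ B = 1`, with all but the term linear in `λ` moved to the right.
    have hrow : ∀ i, |l| / (4 * Real.pi) * ‖B i k‖ ≤ (if i = k then 1 else 0) +
        (∑ b, 1 / (4 * Real.pi * ‖Y i - Y b‖)) * m := by
      intro i
      have h1 : ∑ b, Gam α Y (l : ℂ) i b * B b k = (1 : Matrix (Fin N) (Fin N) ℂ) i k := by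
        rw [← hmul, Matrix.mul_apply]
      have h2 : ((α i : ℂ) - Complex.I * l / (4 * (Real.pi : ℂ))) * B i k =
          (1 : Matrix (Fin N) (Fin N) ℂ) i k + ∑ b, green l (Y i - Y b) * B b k := by
        rw [← h1, ← Finset.sum_add_distrib]
        simp only [Gam, Matrix.of_apply, sub_mul, sub_add_cancel, ite_mul, zero_mul]
        simp
      have h3 : |l| / (4 * Real.pi) ≤ ‖(α i : ℂ) - Complex.I * l / (4 * (Real.pi : ℂ))‖ := by
        refine le_trans (le_of_eq ?_) (Complex.abs_im_le_norm _)
        have : (Complex.I * l / (4 * (Real.pi : ℂ))) = ((l / (4 * Real.pi) : ℝ) : ℂ) * Complex.I := by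
          push_cast; ring
        rw [this, Complex.sub_im, Complex.ofReal_im, Complex.im_ofReal_mul,
          Complex.I_im, zero_sub, abs_neg, mul_one, abs_div, abs_of_pos (by positivity : 0 < 4 * Real.pi)]
      calc |l| / (4 * Real.pi) * ‖B i k‖ ≤ ‖((α i : ℂ) - Complex.I * l / (4 * (Real.pi : ℂ))) * B i k‖ := by
            rw [norm_mul]; exact mul_le_mul_of_nonneg_right h3 (norm_nonneg _)
        _ ≤ ‖(1 : Matrix (Fin N) (Fin N) ℂ) i k‖ + ∑ b, ‖green l (Y i - Y b) * B b k‖ := by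
            rw [h2]; exact (norm_add_le _ _).trans (add_le_add le_rfl (norm_sum_le _ _))
        _ ≤ _ := by
            refine add_le_add (le_of_eq ?_) ?_
            · rw [Matrix.one_apply]; split_ifs <;> simp
            · rw [Finset.sum_mul]
              refine Finset.sum_le_sum fun b _ => ?_
              rw [norm_mul]
              refine mul_le_mul (norm_green_le _ (by simp) _) ?_ (norm_nonneg _) (by positivity)
              exact Finset.single_le_sum (f := fun b => ‖B b k‖) (fun _ _ => norm_nonneg _) (Finset.mem_univ b)
    have htot : |l| / (4 * Real.pi) * m ≤ 1 + g * m := by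
      have := Finset.sum_le_sum fun i (_ : i ∈ Finset.univ) => hrow i
      rw [← Finset.mul_sum, Finset.sum_add_distrib, ← Finset.sum_mul] at this
      rwa [Finset.sum_ite_eq' Finset.univ k, if_pos (Finset.mem_univ k)] at this
    have hBm : ‖B j k‖ ≤ m :=
      Finset.single_le_sum (f := fun b => ‖B b k‖) (fun _ _ => norm_nonneg _) (Finset.mem_univ j)
    have hgl : g ≤ |l| / (8 * Real.pi) := by
      rw [le_div_iff₀ (by positivity)]; linarith
    have hml : |l| * m ≤ 8 * Real.pi := by
      have h1 : g * m ≤ |l| / (8 * Real.pi) * m := mul_le_mul_of_nonneg_right hgl hm0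
      have h2 : |l| / (4 * Real.pi) * m - |l| / (8 * Real.pi) * m = |l| * m / (8 * Real.pi) := by
        field_simp; ring
      have h3 : |l| * m / (8 * Real.pi) ≤ 1 := by linarith
      rwa [div_le_one (by positivity)] at h3
    have hm1 : m ≤ |l| * m := le_mul_of_one_le_left hm0 (by linarith)
    have h5 : (1 + |l|) * ‖B j k‖ ≤ (1 + |l|) * m := mul_le_mul_of_nonneg_left hBm (by positivity)
    have h6 : 0 ≤ ∑ j, ∑ k, K0 j k := (hK0n j k).trans hsum0
    nlinarith

/-- The entries of `d(Γ⁻¹)/dλ = -Γ⁻¹ Γ' Γ⁻¹`. -/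
noncomputable def GamInvDeriv (α : Fin N → ℝ) (Y : Fin N → R3) (j k : Fin N) (l : ℝ) : ℂ :=
  -∑ a, ∑ b, (Gam α Y (l : ℂ))⁻¹ j a * GamDeriv Y a b l * (Gam α Y (l : ℂ))⁻¹ b k

/-- The entries of `d²(Γ⁻¹)/dλ²`. -/
noncomputable def GamInvDeriv2 (α : Fin N → ℝ) (Y : Fin N → R3) (j k : Fin N) (l : ℝ) : ℂ :=
  -∑ a, ∑ b, ((GamInvDeriv α Y j a l * GamDeriv Y a b l + (Gam α Y (l : ℂ))⁻¹ j a * GamDeriv2 Y a b l) *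
    (Gam α Y (l : ℂ))⁻¹ b k + (Gam α Y (l : ℂ))⁻¹ j a * GamDeriv Y a b l * GamInvDeriv α Y b k l)

lemma hasDerivAt_Gam_inv (hY : Function.Injective Y) (hG : ∀ l : ℝ, IsUnit (Gam α Y (l : ℂ)))
    (j k : Fin N) (l : ℝ) :
    HasDerivAt (fun l : ℝ => (Gam α Y (l : ℂ))⁻¹ j k) (GamInvDeriv α Y j k l) l := by
  rw [hasDerivAt_iff_tendsto_slope]
  have hslope : ∀ x : ℝ, slope (fun l : ℝ => (Gam α Y (l : ℂ))⁻¹ j k) l x =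
      -∑ a, ∑ b, (Gam α Y (x : ℂ))⁻¹ j a * slope (fun l : ℝ => Gam α Y (l : ℂ) a b) l x *
        (Gam α Y (l : ℂ))⁻¹ b k := by
    intro x
    have hd : ∀ y : ℝ, IsUnit (Gam α Y (y : ℂ)).det := fun y => (Matrix.isUnit_iff_isUnit_det _).1 (hG y)
    have h1 : (Gam α Y (x : ℂ))⁻¹ - (Gam α Y (l : ℂ))⁻¹ =
        -((Gam α Y (x : ℂ))⁻¹ * (Gam α Y (x : ℂ) - Gam α Y (l : ℂ)) * (Gam α Y (l : ℂ))⁻¹) := by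
      rw [Matrix.mul_sub, Matrix.nonsing_inv_mul _ (hd x), Matrix.sub_mul, Matrix.one_mul, Matrix.mul_assoc,
        Matrix.mul_nonsing_inv _ (hd l), Matrix.mul_one, neg_sub]
    have h2 := congrFun (congrFun h1 j) k
    simp only [Matrix.sub_apply, Matrix.neg_apply, Matrix.mul_apply, Finset.sum_mul] at h2
    rw [slope_def_module, h2, Finset.sum_comm, smul_neg, Finset.smul_sum]
    congr 1
    refine Finset.sum_congr rfl fun a _ => ?_
    rw [Finset.smul_sum]
    refine Finset.sum_congr rfl fun b _ => ?_
    rw [slope_def_module]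
    simp only [Complex.real_smul]
    ring
  rw [show slope (fun l : ℝ => (Gam α Y (l : ℂ))⁻¹ j k) l = _ from funext hslope]
  refine (tendsto_finsetSum _ fun a _ => tendsto_finsetSum _ fun b _ => ?_).neg
  refine Tendsto.mul (Tendsto.mul ?_ ?_) tendsto_const_nhds
  · exact ((continuous_Gam_inv_ofReal hG j a).tendsto l).mono_left nhdsWithin_le_nhds
  · exact hasDerivAt_iff_tendsto_slope.1 (hasDerivAt_Gam α hY a b l)

lemma hasDerivAt_GamInvDeriv (hY : Function.Injective Y) (hG : ∀ l : ℝ, IsUnit (Gam α Y (l : ℂ)))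
    (j k : Fin N) (l : ℝ) :
    HasDerivAt (GamInvDeriv α Y j k) (GamInvDeriv2 α Y j k l) l := by
  refine (HasDerivAt.fun_sum fun a _ => HasDerivAt.fun_sum fun b _ => ?_).fun_neg
  exact ((hasDerivAt_Gam_inv hY hG j a l).fun_mul (hasDerivAt_GamDeriv Y a b l)).fun_mul
    (hasDerivAt_Gam_inv hY hG b k l)

lemma continuous_GamInvDeriv (hG : ∀ l : ℝ, IsUnit (Gam α Y (l : ℂ))) (j k : Fin N) :
    Continuous (GamInvDeriv α Y j k) :=
  (continuous_finsetSum _ fun a _ => continuous_finsetSum _ fun b _ =>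
    ((continuous_Gam_inv_ofReal hG j a).mul (continuous_GamDeriv Y a b)).mul
      (continuous_Gam_inv_ofReal hG b k)).neg

lemma continuous_GamInvDeriv2 (hG : ∀ l : ℝ, IsUnit (Gam α Y (l : ℂ))) (j k : Fin N) :
    Continuous (GamInvDeriv2 α Y j k) :=
  (continuous_finsetSum _ fun a _ => continuous_finsetSum _ fun b _ =>
    ((((continuous_GamInvDeriv hG j a).mul (continuous_GamDeriv Y a b)).add
      ((continuous_Gam_inv_ofReal hG j a).mul (continuous_GamDeriv2 Y a b))).mul
        (continuous_Gam_inv_ofReal hG b k)).add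
      (((continuous_Gam_inv_ofReal hG j a).mul (continuous_GamDeriv Y a b)).mul
        (continuous_GamInvDeriv hG b k))).neg

/-- A double sum of terms of size at most `c`. -/
lemma norm_neg_sum_sum_le {F : Fin N → Fin N → ℂ} {c : ℝ} (h : ∀ a b, ‖F a b‖ ≤ c) :
    ‖-∑ a, ∑ b, F a b‖ ≤ N ^ 2 * c := by
  rw [norm_neg]
  refine (norm_sum_le_of_le _ fun a _ => norm_sum_le_of_le _ fun b _ => h a b).trans (le_of_eq ?_)
  simp; ring

lemma integrable_of_norm_le_inv_one_add_sq {h : ℝ → ℂ} (hc : Continuous h) {D : ℝ}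
    (hD : ∀ l, ‖h l‖ ≤ D * (1 + l ^ 2)⁻¹) : Integrable h ∧ ∫ l, ‖h l‖ ≤ D * Real.pi := by
  have hi := integrable_inv_one_add_sq.const_mul D
  have h1 : Integrable h := hi.mono' hc.aestronglyMeasurable (ae_of_all _ hD)
  refine ⟨h1, (integral_mono h1.norm hi hD).trans (le_of_eq ?_)⟩
  rw [integral_const_mul, integral_univ_inv_one_add_sq]

/-- The entries of `Γ(λ)⁻¹` and of its derivative have bounded variation. -/
lemma exists_hasVarBound_Gam_inv (hY : Function.Injective Y) (hG : ∀ l : ℝ, IsUnit (Gam α Y (l : ℂ))) :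
    ∃ M : ℝ, ∀ j k, HasVarBound (fun l : ℝ => (Gam α Y (l : ℂ))⁻¹ j k) (GamInvDeriv α Y j k) M ∧
      HasVarBound (GamInvDeriv α Y j k) (GamInvDeriv2 α Y j k) M := by
  obtain ⟨K, hK0, hK⟩ := exists_norm_Gam_inv_le hG
  obtain ⟨D, hD0, hD⟩ := exists_norm_GamDeriv2_le Y
  have hden : ∀ l : ℝ, 1 ≤ 1 + |l| := fun l => by linarith [abs_nonneg l]
  have hsq : ∀ l : ℝ, K / (1 + |l|) * (K / (1 + |l|)) ≤ K ^ 2 * (1 + l ^ 2)⁻¹ := fun l => by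
    rw [div_mul_div_comm, ← pow_two, div_eq_mul_inv]
    refine mul_le_mul_of_nonneg_left (inv_anti₀ (by positivity) ?_) (by positivity)
    nlinarith [sq_abs l, abs_nonneg l]
  have hKK : ∀ l j k, ‖(Gam α Y ((l : ℝ) : ℂ))⁻¹ j k‖ ≤ K := fun l j k =>
    (hK l j k).trans (div_le_self hK0 (hden l))
  have hinv1 : ∀ l : ℝ, (1 + l ^ 2)⁻¹ ≤ 1 := fun l => inv_le_one_of_one_le₀ (by nlinarith [sq_nonneg l])
  set M1 : ℝ := N ^ 2 * K ^ 2 with hM1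
  have hM10 : 0 ≤ M1 := by positivity
  have hB1 : ∀ j k l, ‖GamInvDeriv α Y j k l‖ ≤ M1 * (1 + l ^ 2)⁻¹ := fun j k l => by
    rw [hM1, mul_assoc]
    refine norm_neg_sum_sum_le fun a b => ?_
    rw [norm_mul, norm_mul]
    refine le_trans ?_ (hsq l)
    refine mul_le_mul ?_ (hK l b k) (norm_nonneg _) (by positivity)
    calc _ ≤ K / (1 + |l|) * 1 :=
          mul_le_mul (hK l j a) (norm_GamDeriv_le Y a b l) (norm_nonneg _) (by positivity)
      _ = _ := mul_one _
  set M2 : ℝ := N ^ 2 * (2 * (M1 * K) + D * K ^ 2) with hM2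
  have hM20 : 0 ≤ M2 := by positivity
  have hB2 : ∀ j k l, ‖GamInvDeriv2 α Y j k l‖ ≤ M2 * (1 + l ^ 2)⁻¹ := fun j k l => by
    rw [hM2, mul_assoc]
    refine norm_neg_sum_sum_le fun a b => ?_
    have hw : 0 ≤ (1 + l ^ 2)⁻¹ := by positivity
    have e1 : ‖GamInvDeriv α Y j a l * GamDeriv Y a b l * (Gam α Y (l : ℂ))⁻¹ b k‖ ≤
        M1 * (1 + l ^ 2)⁻¹ * 1 * K := by
      rw [norm_mul, norm_mul]
      exact mul_le_mul (mul_le_mul (hB1 j a l) (norm_GamDeriv_le Y a b l) (norm_nonneg _) (by positivity))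
        (hKK l b k) (norm_nonneg _) (by positivity)
    have e2 : ‖(Gam α Y (l : ℂ))⁻¹ j a * GamDeriv2 Y a b l * (Gam α Y (l : ℂ))⁻¹ b k‖ ≤
        D * (K ^ 2 * (1 + l ^ 2)⁻¹) := by
      rw [norm_mul, norm_mul]
      calc _ ≤ K / (1 + |l|) * D * (K / (1 + |l|)) :=
            mul_le_mul (mul_le_mul (hK l j a) (hD a b l) (norm_nonneg _) (by positivity))
              (hK l b k) (norm_nonneg _) (by positivity)
        _ = D * (K / (1 + |l|) * (K / (1 + |l|))) := by ring
        _ ≤ _ := mul_le_mul_of_nonneg_left (hsq l) hD0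
    have e3 : ‖(Gam α Y (l : ℂ))⁻¹ j a * GamDeriv Y a b l * GamInvDeriv α Y b k l‖ ≤
        K * 1 * (M1 * (1 + l ^ 2)⁻¹) := by
      rw [norm_mul, norm_mul]
      exact mul_le_mul (mul_le_mul (hKK l j a) (norm_GamDeriv_le Y a b l) (norm_nonneg _) hK0)
        (hB1 b k l) (norm_nonneg _) (by positivity)
    rw [add_mul]
    refine (norm_add₃_le).trans ?_
    linarith
  refine ⟨K + M1 * 4 + M2 * 4, fun j k => ⟨?_, ?_⟩⟩
  · obtain ⟨i1, i2⟩ := integrable_of_norm_le_inv_one_add_sq (continuous_GamInvDeriv hG j k) (hB1 j k)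
    refine ⟨hasDerivAt_Gam_inv hY hG j k, continuous_GamInvDeriv hG j k, i1, fun l => ?_, ?_⟩
    · linarith [hKK l j k]
    · nlinarith [Real.pi_le_four]
  · obtain ⟨i1, i2⟩ := integrable_of_norm_le_inv_one_add_sq (continuous_GamInvDeriv2 hG j k) (hB2 j k)
    refine ⟨hasDerivAt_GamInvDeriv hY hG j k, continuous_GamInvDeriv2 hG j k, i1, fun l => ?_, ?_⟩
    · have := mul_le_mul_of_nonneg_left (hinv1 l) hM10
      linarith [hB1 j k l]
    · nlinarith [Real.pi_le_four]

end Inverse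

lemma mul_sqrt_eq_rpow {t : ℝ} (ht : 0 < t) : t * Real.sqrt t = t ^ (3 / 2 : ℝ) := by
  rw [Real.sqrt_eq_rpow]
  nth_rewrite 1 [← Real.rpow_one t]
  rw [← Real.rpow_add ht]; norm_num

/-- The oscillatory integral of the free part. -/
lemma norm_integral_fresnel_mul_id_le {t ε : ℝ} (ht : 0 < t) (hε : 0 < ε) (hεt : ε ≤ t) {s : ℝ} (hs : 0 ≤ s) :
    ‖∫ l : ℝ, fresnel t ε l * l * Complex.exp (Complex.I * l * s)‖ ≤ 5 / (t * Real.sqrt t) * s := by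
  have h1 : HasVarBound (fun _ => (1 : ℂ)) (fun _ => 0) 1 := by simpa using hasVarBound_const 1
  have := h1.norm_integral_wave_mul_id_le hasVarBound_zero ht hε hεt hs
  simpa using this

/-- The dispersive estimate when `Γ` is invertible on the whole real axis. -/
theorem exists_weightedBound_of_isUnit (hN : 1 ≤ N) {α : Fin N → ℝ} {Y : Fin N → R3}
    (hY : Function.Injective Y) (hG : ∀ l : ℝ, IsUnit (Gam α Y (l : ℂ))) :
    ∃ C : ℝ, ∀ t : ℝ, 0 < t → WeightedBound Y
      ((expI (hamiltonian α Y) t).comp (acProjection (expI (hamiltonian α Y)))) (C / t ^ (3 / 2 : ℝ)) := by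
  obtain ⟨K, hK0, hK⟩ := exists_norm_Gam_inv_le hG
  obtain ⟨M, hM⟩ := exists_hasVarBound_Gam_inv hY hG
  have hM0 : 0 ≤ M := (hM ⟨0, hN⟩ ⟨0, hN⟩).1.nonneg
  have hC : ∀ (l : ℝ) j k, ‖(l : ℂ) * (Gam α Y (l : ℂ))⁻¹ j k‖ ≤ K := fun l j k => by
    rw [norm_mul, Complex.norm_real, Real.norm_eq_abs]
    have h1 := hK l j k
    rw [le_div_iff₀ (by positivity)] at h1
    nlinarith [norm_nonneg ((Gam α Y (l : ℂ))⁻¹ j k)]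
  refine ⟨5 * (1 + N ^ 2 * M), fun t ht => ?_⟩
  have hst : 0 < Real.sqrt t := Real.sqrt_pos.2 ht
  refine weightedBound_of_forall_inner hN (by positivity) fun g hg f hf => ?_
  have hA : 5 * (1 + N ^ 2 * M) / t ^ (3 / 2 : ℝ) =
      5 / (t * Real.sqrt t) + N ^ 2 * (5 / (t * Real.sqrt t) * M) := by
    rw [← mul_sqrt_eq_rpow ht]; ring
  rw [hA]
  refine norm_inner_expI_le hN hY (fun l _ => hG l) hC ht (by positivity) (by positivity)
    (fun ε hε hεt s hs => norm_integral_fresnel_mul_id_le ht hε hεt hs) (fun ε hε hεt s hs j k => ?_) hg hf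
  calc _ ≤ 5 / (t * Real.sqrt t) * (M + s * M) :=
        (hM j k).1.norm_integral_wave_mul_id_le (hM j k).2 ht hε hεt hs
    _ = _ := by ring

/-! ### A single point interaction -/

section SinglePoint

variable (α : ℝ) (y : R3)

lemma Gam_single_apply (z : ℂ) (j k : Fin 1) :
    Gam (fun _ => α) (fun _ => y) z j k = α - Complex.I * z / (4 * (Real.pi : ℂ)) := by
  simp [Gam, green, Subsingleton.elim j k]

lemma isUnit_Gam_single {z : ℂ} (h : (α : ℂ) - Complex.I * z / (4 * (Real.pi : ℂ)) ≠ 0) :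
    IsUnit (Gam (fun _ : Fin 1 => α) (fun _ => y) z) := by
  rw [Matrix.isUnit_iff_isUnit_det, Matrix.det_unique, Gam_single_apply]
  exact h.isUnit

lemma Gam_single_inv_apply (z : ℂ) (j k : Fin 1) :
    (Gam (fun _ => α) (fun _ => y) z)⁻¹ j k = ((α : ℂ) - Complex.I * z / (4 * (Real.pi : ℂ)))⁻¹ := by
  rw [Gam_inv_apply, Matrix.det_unique, Gam_single_apply, Matrix.adjugate_subsingleton,
    Subsingleton.elim j k]
  simp

lemma Gam_single_I_mul_apply (κ : ℝ) (j k : Fin 1) :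
    Gam (fun _ => α) (fun _ => y) (Complex.I * κ) j k = ((α + κ / (4 * Real.pi) : ℝ) : ℂ) := by
  rw [Gam_single_apply, ← mul_assoc, Complex.I_mul_I]; push_cast; ring

variable {α}

lemma posDef_Gam_single (hα : 0 ≤ α) {κ : ℝ} (hκ : 0 < κ) :
    (Gam (fun _ : Fin 1 => α) (fun _ => y) (Complex.I * κ)).PosDef := by
  have e : Gam (fun _ : Fin 1 => α) (fun _ => y) (Complex.I * κ) =
      Matrix.diagonal fun _ => ((α + κ / (4 * Real.pi) : ℝ) : ℂ) := by
    ext j k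
    rw [Gam_single_I_mul_apply, Subsingleton.elim j k, Matrix.diagonal_apply_eq]
  rw [e]
  refine Matrix.PosDef.diagonal fun _ => ?_
  have : 0 < α + κ / (4 * Real.pi) := by have := Real.pi_pos; positivity
  exact_mod_cast this

lemma norm_greenL_sq {z : ℂ} (hz : 0 < z.im) (y : R3) : ‖greenL z y‖ ^ 2 = 1 / (8 * Real.pi * z.im) := by
  have h := inner_self_eq_norm_sq_to_K (𝕜 := ℂ) (greenL z y)
  rw [L2.inner_def] at h
  have h1 : ∫ x, inner ℂ (greenL z y x) (greenL z y x) = ((∫ x, ‖green z (x - y)‖ ^ 2 : ℝ) : ℂ) := by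
    rw [← integral_complex_ofReal]
    refine integral_congr_ae ?_
    filter_upwards [coeFn_greenL hz y] with x hx
    rw [hx, inner_self_eq_norm_sq_to_K]; push_cast; rfl
  rw [h1, integral_sub_right_eq_self (fun x => ‖green z x‖ ^ 2) y, (integral_norm_green_sq hz).2] at h
  have h2 : ((1 / (8 * Real.pi * z.im) : ℝ) : ℂ) = ((‖greenL z y‖ ^ 2 : ℝ) : ℂ) := by
    rw [h]; push_cast; rfl
  exact_mod_cast h2.symm

/-- The pole part of the resolvent at `-κ²` has norm at most `1/(2κ²)` when `α ≥ 0`. -/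
lemma re_inner_kreinRes_single_le (hα : 0 ≤ α) {κ : ℝ} (hκ : 0 < κ) (v : L2) :
    κ ^ 2 * (inner ℂ v (kreinRes (fun _ : Fin 1 => α) (fun _ => y) (Complex.I * κ) v)).re ≤
      κ ^ 2 * (∫ p, (4 * Real.pi ^ 2 * ‖p‖ ^ 2 + κ ^ 2)⁻¹ * ‖(𝓕 v : L2) p‖ ^ 2) + ‖v‖ ^ 2 / 2 := by
  have hpi := Real.pi_pos
  obtain ⟨a, ha, hin⟩ := inner_kreinRes_I_mul (fun _ : Fin 1 => α) (fun _ => y) κ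
    (posDef_Gam_single y hα hκ).isUnit v
  set γ : ℝ := α + κ / (4 * Real.pi) with hγ
  have hγ1 : κ / (4 * Real.pi) ≤ γ := by linarith
  have hγ0 : 0 < γ := lt_of_lt_of_le (by positivity) hγ1
  have h0 := congrFun ha 0
  simp only [Matrix.mulVec, dotProduct, Fin.sum_univ_one, Fin.isValue] at h0
  rw [Gam_single_I_mul_apply, ← hγ] at h0
  have hev : ‖evalRes (Complex.I * κ) v y‖ ^ 2 ≤ ‖v‖ ^ 2 / (8 * Real.pi * κ) := by
    rw [evalRes, neg_conj_I_mul]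
    have h1 := norm_inner_le_norm (𝕜 := ℂ) (greenL (Complex.I * κ) y) v
    have h2 := norm_greenL_sq (I_mul_im_pos hκ) y
    have h3 : (Complex.I * (κ : ℂ)).im = κ := by simp
    rw [h3] at h2
    calc _ ≤ (‖greenL (Complex.I * κ) y‖ * ‖v‖) ^ 2 := pow_le_pow_left₀ (norm_nonneg _) h1 2
      _ = _ := by rw [mul_pow, h2]; ring
  have hq : starRingEnd ℂ (star a ⬝ᵥ (Gam (fun _ : Fin 1 => α) (fun _ => y) (Complex.I * κ)) *ᵥ a) =
      ((γ * ‖a 0‖ ^ 2 : ℝ) : ℂ) := by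
    simp only [Matrix.mulVec, dotProduct, Fin.sum_univ_one, Fin.isValue, Pi.star_apply, RCLike.star_def]
    rw [Gam_single_I_mul_apply, ← hγ]
    simp only [map_mul, Complex.conj_conj, Complex.conj_ofReal]
    push_cast
    rw [← Complex.mul_conj']; ring
  have hγa : γ * ‖a 0‖ = ‖evalRes (Complex.I * κ) v y‖ := by
    rw [← h0, norm_mul, Complex.norm_real, Real.norm_of_nonneg hγ0.le]
  have hpole : κ ^ 2 * (γ * ‖a 0‖ ^ 2) ≤ ‖v‖ ^ 2 / 2 := by
    have h1 : κ / (4 * Real.pi) * (γ * ‖a 0‖ ^ 2) ≤ ‖v‖ ^ 2 / (8 * Real.pi * κ) := by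
      calc _ ≤ γ * (γ * ‖a 0‖ ^ 2) := mul_le_mul_of_nonneg_right hγ1 (by positivity)
        _ = (γ * ‖a 0‖) ^ 2 := by ring
        _ ≤ _ := by rw [hγa]; exact hev
    have h2 := mul_le_mul_of_nonneg_left h1 (by positivity : 0 ≤ 4 * Real.pi * κ)
    have e1 : 4 * Real.pi * κ * (κ / (4 * Real.pi) * (γ * ‖a 0‖ ^ 2)) = κ ^ 2 * (γ * ‖a 0‖ ^ 2) := by
      field_simp
    have e2 : 4 * Real.pi * κ * (‖v‖ ^ 2 / (8 * Real.pi * κ)) = ‖v‖ ^ 2 / 2 := by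
      field_simp; ring
    rwa [e1, e2] at h2
  rw [hin, inner_freeRes_I_mul hκ, hq, Complex.add_re, Complex.ofReal_re, Complex.ofReal_re]
  linarith

/-- The form of `κ²(-Δ + κ²)⁻¹` tends to zero as `κ → 0`, since `0` is not an eigenvalue of `Δ`. -/
lemma tendsto_mul_integral_symb (v : L2) :
    Tendsto (fun κ : ℝ => κ ^ 2 * ∫ p, (4 * Real.pi ^ 2 * ‖p‖ ^ 2 + κ ^ 2)⁻¹ * ‖(𝓕 v : L2) p‖ ^ 2)
      (𝓝[>] 0) (𝓝 0) := by
  have h1 : Integrable (fun p => ‖(𝓕 v : L2) p‖ ^ 2) :=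
    (memLp_two_iff_integrable_sq_norm (Lp.aestronglyMeasurable _)).1 (Lp.memLp _)
  simp_rw [← integral_const_mul]
  rw [show (0 : ℝ) = ∫ _ : R3, (0 : ℝ) by simp]
  refine tendsto_integral_filter_of_dominated_convergence (fun p => ‖(𝓕 v : L2) p‖ ^ 2) ?_ ?_ h1 ?_
  · refine Eventually.of_forall fun κ => AEStronglyMeasurable.const_mul ?_ _
    exact (Measurable.aestronglyMeasurable (by fun_prop)).mul h1.aestronglyMeasurable
  · rw [integral_zero]
    filter_upwards [self_mem_nhdsWithin] with κ hκ
    refine ae_of_all _ fun p => ?_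
    have hκ' : (0 : ℝ) < κ := hκ
    rw [← mul_assoc, norm_mul, Real.norm_of_nonneg (by positivity : 0 ≤ ‖(𝓕 v : L2) p‖ ^ 2),
      Real.norm_of_nonneg (by positivity)]
    refine mul_le_of_le_one_left (by positivity) ?_
    rw [← div_eq_mul_inv, div_le_one (by positivity)]
    have : 0 ≤ 4 * Real.pi ^ 2 * ‖p‖ ^ 2 := by positivity
    linarith
  · rw [integral_zero]
    filter_upwards [Measure.ae_ne volume (0 : R3)] with p hp
    have hp' : 0 < ‖p‖ := norm_pos_iff.2 hp
    have hpi := Real.pi_pos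
    have hne : 4 * Real.pi ^ 2 * ‖p‖ ^ 2 + (0 : ℝ) ^ 2 ≠ 0 := by positivity
    have hc : ContinuousAt (fun κ : ℝ => κ ^ 2 * ((4 * Real.pi ^ 2 * ‖p‖ ^ 2 + κ ^ 2)⁻¹ * ‖(𝓕 v : L2) p‖ ^ 2)) 0 :=
      ContinuousAt.fun_mul (by fun_prop) (ContinuousAt.fun_mul
        (ContinuousAt.fun_inv₀ (f := fun κ : ℝ => 4 * Real.pi ^ 2 * ‖p‖ ^ 2 + κ ^ 2) (by fun_prop) hne)
        continuousAt_const)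
    have := hc.tendsto.mono_left (nhdsWithin_le_nhds (s := Ioi 0))
    simpa using this

/-- For `α ≥ 0` the Hamiltonian has no eigenvalue in `(-∞, 0]`: such an eigenvector `v` satisfies
`‖v‖² ≤ κ² ⟪v, (H + κ²)⁻¹ v⟫` for all `κ > 0`, whereas the limit `κ → 0` of the right-hand side is at
most `‖v‖²/2`. -/
lemma eq_zero_of_kreinRes_single_eq (hα : 0 ≤ α) {κ : ℝ} (hκ : 0 < κ) {v : L2} {m : ℝ}
    (hm : (κ ^ 2)⁻¹ ≤ m)
    (hv : kreinRes (fun _ : Fin 1 => α) (fun _ => y) (Complex.I * κ) v = (m : ℂ) • v) : v = 0 := by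
  have hm0 : 0 < m := lt_of_lt_of_le (by positivity) hm
  have hY : Function.Injective fun _ : Fin 1 => y := Function.injective_of_subsingleton _
  have hlow : ∀ κ' : ℝ, 0 < κ' → ‖v‖ ^ 2 ≤
      κ' ^ 2 * (inner ℂ v (kreinRes (fun _ : Fin 1 => α) (fun _ => y) (Complex.I * κ') v)).re := by
    intro κ' hκ'
    have h := kreinRes_eq_of_unit (α := fun _ : Fin 1 => α) hY (I_mul_im_pos hκ) (I_mul_im_pos hκ')
      (posDef_Gam_single y hα hκ).isUnit (posDef_Gam_single y hα hκ').isUnit v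
    rw [hv] at h
    have e : v + ((Complex.I * (κ : ℂ)) ^ 2 - (Complex.I * (κ' : ℂ)) ^ 2) • ((m : ℂ) • v) =
        ((1 + (κ' ^ 2 - κ ^ 2) * m : ℝ) : ℂ) • v := by
      rw [smul_smul, mul_pow, mul_pow, Complex.I_sq]
      push_cast
      rw [add_smul, one_smul]; ring_nf
    rw [e, map_smul] at h
    have h2 := congrArg (fun u => (inner ℂ v u).re) h
    simp only [inner_smul_right, Complex.re_ofReal_mul] at h2
    have h3 : (inner ℂ v v).re = ‖v‖ ^ 2 := by
      have := inner_self_eq_norm_sq (𝕜 := ℂ) v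
      simpa using this
    rw [h3] at h2
    set q := (inner ℂ v (kreinRes (fun _ : Fin 1 => α) (fun _ => y) (Complex.I * κ') v)).re with hq
    have hq0 : 0 ≤ q := by
      have := (isPositive_kreinRes hκ' (posDef_Gam_single y hα hκ')).inner_nonneg_right v
      exact (Complex.nonneg_iff.1 this).1
    have h4 : 1 ≤ κ ^ 2 * m := by
      have := mul_le_mul_of_nonneg_left hm (by positivity : 0 ≤ κ ^ 2)
      rwa [mul_inv_cancel₀ (by positivity)] at this
    have h5 : m * ‖v‖ ^ 2 ≤ m * (κ' ^ 2 * q) := by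
      rw [← h2]
      have : (1 + (κ' ^ 2 - κ ^ 2) * m) ≤ κ' ^ 2 * m := by linarith
      calc _ ≤ κ' ^ 2 * m * q := mul_le_mul_of_nonneg_right this hq0
        _ = _ := by ring
    exact le_of_mul_le_mul_left h5 hm0
  have hlim := (tendsto_mul_integral_symb v).add_const (‖v‖ ^ 2 / 2)
  have hle : ‖v‖ ^ 2 ≤ 0 + ‖v‖ ^ 2 / 2 := by
    refine ge_of_tendsto hlim ?_
    filter_upwards [self_mem_nhdsWithin] with κ' hκ'
    exact (hlow κ' hκ').trans (re_inner_kreinRes_single_le y hα hκ' v)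
  have : ‖v‖ ^ 2 = 0 := le_antisymm (by linarith) (by positivity)
  simpa using this

/-- For `α ≥ 0` the spectrum is purely absolutely continuous. -/
lemma acProjection_single (hα : 0 ≤ α) :
    acProjection (expI (hamiltonian (fun _ : Fin 1 => α) fun _ => y)) = ContinuousLinearMap.id ℂ L2 := by
  have hY : Function.Injective fun _ : Fin 1 => y := Function.injective_of_subsingleton _
  have hP := posDef_Gam_single y hα one_pos
  have hreg : ∀ l : ℝ, l ≠ 0 → IsUnit (Gam (fun _ : Fin 1 => α) (fun _ => y) (l : ℂ)) := by
    intro l hl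
    refine isUnit_Gam_single α y fun h => hl ?_
    have := congrArg Complex.im h
    have e : (Complex.I * (l : ℂ) / (4 * (Real.pi : ℂ))) = ((l / (4 * Real.pi) : ℝ) : ℂ) * Complex.I := by
      push_cast; ring
    rw [e, Complex.sub_im, Complex.ofReal_im, Complex.im_ofReal_mul, Complex.I_im, zero_sub, mul_one,
      Complex.zero_im, neg_eq_zero] at this
    exact (div_eq_zero_iff.1 this).resolve_right (by positivity)
  rw [acProjection_expI le_rfl hY one_pos hP hreg]
  have hfin := finiteDimensional_nonposSpace_kreinRes hY one_pos hP
  have htop : (nonposSpace (kreinRes (fun _ : Fin 1 => α) (fun _ => y) (Complex.I * (1 : ℝ))) ((1 : ℝ) ^ 2))ᗮ = ⊤ := by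
    refine Submodule.eq_top_iff'.2 fun f => ?_
    refine mem_orthogonal_nonposSpace (isPositive_kreinRes one_pos hP)
      (kreinRes_I_mul_injective hY one_pos) (by norm_num) fun v hv0 _ m hm hv => ?_
    exact absurd (eq_zero_of_kreinRes_single_eq y hα one_pos hm hv) hv0
  ext1 f
  rw [ContinuousLinearMap.id_apply, Submodule.starProjection_eq_self_iff, htop]
  trivial

variable (α) in
theorem exists_weightedBound_single (hα : α ≠ 0) :
    ∃ C : ℝ, ∀ t : ℝ, 0 < t → WeightedBound (fun _ : Fin 1 => y)
      ((expI (hamiltonian (fun _ : Fin 1 => α) fun _ => y) t).comp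
        (acProjection (expI (hamiltonian (fun _ : Fin 1 => α) fun _ => y)))) (C / t ^ (3 / 2 : ℝ)) := by
  refine exists_weightedBound_of_isUnit le_rfl (Function.injective_of_subsingleton _) fun l =>
    isUnit_Gam_single α y fun h => hα ?_
  have := congrArg Complex.re h
  have e : (Complex.I * (l : ℂ) / (4 * (Real.pi : ℂ))) = ((l / (4 * Real.pi) : ℝ) : ℂ) * Complex.I := by
    push_cast; ring
  rw [e, Complex.sub_re, Complex.re_ofReal_mul] at this
  simpa only [Complex.ofReal_re, Complex.I_re, mul_zero, sub_zero, Complex.zero_re] using this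

/-- At `α = 0` the zero-energy resonance makes `λ Γ(λ)⁻¹` constant, so that the part of the evolution
that passes through the point decays only like `t^{-1/2}`. -/
theorem weightedBound_single_zero {t : ℝ} (ht : 0 < t) :
    WeightedBound (fun _ : Fin 1 => y) (expI (hamiltonian (fun _ : Fin 1 => (0 : ℝ)) fun _ => y) t)
      (5 / (t * Real.sqrt t) + 36 * Real.pi / Real.sqrt t) := by
  have hY : Function.Injective fun _ : Fin 1 => y := Function.injective_of_subsingleton _
  have hpi := Real.pi_pos
  have hst : 0 < Real.sqrt t := Real.sqrt_pos.2 ht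
  have hpiC : (Real.pi : ℂ) ≠ 0 := Complex.ofReal_ne_zero.2 hpi.ne'
  have hB : ∀ l : ℝ, l ≠ 0 → ∀ j k, (l : ℂ) * (Gam (fun _ : Fin 1 => (0 : ℝ)) (fun _ => y) (l : ℂ))⁻¹ j k =
      4 * Real.pi * Complex.I := by
    intro l hl j k
    have hlC : (l : ℂ) ≠ 0 := Complex.ofReal_ne_zero.2 hl
    have hI := Complex.I_ne_zero
    rw [Gam_single_inv_apply, Complex.ofReal_zero, zero_sub]
    field_simp
    rw [Complex.I_sq]
  have hnorm : ‖(4 * Real.pi * Complex.I : ℂ)‖ = 4 * Real.pi := by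
    simp [abs_of_pos hpi]
  have hreg : ∀ l : ℝ, l ≠ 0 → IsUnit (Gam (fun _ : Fin 1 => (0 : ℝ)) (fun _ => y) (l : ℂ)) := by
    intro l hl
    have hlC : (l : ℂ) ≠ 0 := Complex.ofReal_ne_zero.2 hl
    refine isUnit_Gam_single 0 y ?_
    rw [Complex.ofReal_zero, zero_sub]
    exact neg_ne_zero.2 (div_ne_zero (mul_ne_zero Complex.I_ne_zero hlC) (by simp [hpiC]))
  refine weightedBound_of_forall_inner le_rfl (by positivity) fun g hg f hf => ?_
  have h := norm_inner_expI_le le_rfl hY hreg (C := 4 * Real.pi) (A₀ := 5 / (t * Real.sqrt t))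
    (A₁ := 36 * Real.pi / Real.sqrt t) ?_ ht (by positivity) (by positivity)
    (fun ε hε hεt s hs => norm_integral_fresnel_mul_id_le ht hε hεt hs) ?_ hg hf
  -- At zero energy there is a resonance, but no eigenvalue, so no vector is lost in the projection.
  · rw [acProjection_single y le_rfl, ContinuousLinearMap.id_apply] at h
    simpa using h
  · intro l j k
    by_cases hl : l = 0
    · simp [hl, hpi.le]
    · rw [hB l hl, hnorm]
  · intro ε hε hεt s hs j k
    have e : ∫ l : ℝ, fresnel t ε l * (l * (Gam (fun _ : Fin 1 => (0 : ℝ)) (fun _ => y) (l : ℂ))⁻¹ j k) *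
        Complex.exp (Complex.I * l * s) = ∫ l, wave t ε s l * (4 * Real.pi * Complex.I) := by
      refine integral_congr_ae ?_
      filter_upwards [Measure.ae_ne volume (0 : ℝ)] with l hl
      rw [hB l hl, wave]; ring
    rw [e]
    refine ((hasVarBound_const (4 * Real.pi * Complex.I)).norm_integral_wave_mul_le ht hε hεt s).trans ?_
    rw [hnorm]
    have : 0 ≤ 36 * Real.pi / Real.sqrt t * s := by positivity
    have e2 : 9 * (4 * Real.pi) / Real.sqrt t = 36 * Real.pi / Real.sqrt t := by ring
    rw [e2]; linarith

end SinglePoint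

lemma WeightedBound.mono {N : ℕ} {Y : Fin N → R3} {T : L2 →L[ℂ] L2} {B B' : ℝ} (h : WeightedBound Y T B)
    (hB : B ≤ B') : WeightedBound Y T B' := fun f hf =>
  (h f hf).trans (mul_le_mul_left (ENNReal.ofReal_le_ofReal hB) _)

end PointInteraction

theorem theorem1p1 :
    (∀ (N : ℕ) (α : Fin N → ℝ) (Y : Fin N → PointInteraction.R3),
      1 ≤ N → Function.Injective Y →
      PointInteraction.IsUnitaryGroupOf (PointInteraction.hamiltonian α Y)
        (PointInteraction.expI (PointInteraction.hamiltonian α Y)) ∧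
      (PointInteraction.RegularGam α Y →
        ∃ C : ℝ, ∀ t : ℝ, 0 < t →
          PointInteraction.WeightedBound Y
            ((PointInteraction.expI (PointInteraction.hamiltonian α Y) t).comp
              (PointInteraction.acProjection
                (PointInteraction.expI (PointInteraction.hamiltonian α Y))))
            (C / t ^ (3 / 2 : ℝ)))) ∧
    (∀ (α : ℝ) (y : PointInteraction.R3),
      (α ≠ 0 → ∃ C : ℝ, ∀ t : ℝ, 0 < t →
        PointInteraction.WeightedBound (fun _ : Fin 1 => y)
          ((PointInteraction.expI (PointInteraction.hamiltonian (fun _ : Fin 1 => α) fun _ => y) t).comp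
            (PointInteraction.acProjection
              (PointInteraction.expI (PointInteraction.hamiltonian (fun _ : Fin 1 => α) fun _ => y))))
          (C / t ^ (3 / 2 : ℝ))) ∧
      (0 < α → ∃ C : ℝ, ∀ t : ℝ, 0 < t →
        PointInteraction.WeightedBound (fun _ : Fin 1 => y)
          (PointInteraction.expI (PointInteraction.hamiltonian (fun _ : Fin 1 => α) fun _ => y) t)
          (C / t ^ (3 / 2 : ℝ))) ∧
      (α = 0 → ∃ C : ℝ,
        (∀ t : ℝ, 1 ≤ t →
          PointInteraction.WeightedBound (fun _ : Fin 1 => y)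
            (PointInteraction.expI (PointInteraction.hamiltonian (fun _ : Fin 1 => α) fun _ => y) t)
            (C / t ^ (1 / 2 : ℝ))) ∧
        (∀ t : ℝ, 0 < t → t ≤ 1 →
          PointInteraction.WeightedBound (fun _ : Fin 1 => y)
            (PointInteraction.expI (PointInteraction.hamiltonian (fun _ : Fin 1 => α) fun _ => y) t)
            (C / t ^ (3 / 2 : ℝ))))) := by
  open PointInteraction in
  refine ⟨fun N α Y hN hY => ⟨isUnitaryGroupOf_hamiltonian α hY, fun hreg =>
    exists_weightedBound_of_isUnit hN hY (isUnit_Gam_of_regularGam hreg)⟩, fun α y =>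
    ⟨exists_weightedBound_single α y, fun hα => ?_, ?_⟩⟩
  · obtain ⟨C, hC⟩ := exists_weightedBound_single α y hα.ne'
    refine ⟨C, fun t ht => ?_⟩
    have := hC t ht
    rwa [acProjection_single y hα.le, ContinuousLinearMap.comp_id] at this
  · rintro rfl
    have hpi := Real.pi_pos
    refine ⟨5 + 36 * Real.pi, fun t ht => ?_, fun t ht ht1 => ?_⟩
    · have ht0 : 0 < t := by linarith
      have hst : 0 < Real.sqrt t := Real.sqrt_pos.2 ht0
      refine (weightedBound_single_zero y ht0).mono ?_
      rw [← Real.sqrt_eq_rpow, add_div]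
      gcongr
      exact le_mul_of_one_le_left hst.le ht
    · have hst : 0 < Real.sqrt t := Real.sqrt_pos.2 ht
      refine (weightedBound_single_zero y ht).mono ?_
      rw [← mul_sqrt_eq_rpow ht, add_div]
      gcongr
      exact mul_le_of_le_one_left hst.le ht1
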